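/- Let $\overline{\mathbb R}=\mathbb R\cup\{\infty\}$ be the tropical semiring with $\oplus=\min$ and $\odot=+$, let $\mathbb B=\{0,\infty\}\subset\overline{\mathbb R}$ be the Boolean semiring, and let $\varphi:\overline{\mathbb R}\to\mathbb B$ be the homomorphism with $\varphi(a)=0$ for $a\ne\infty$ and $\varphi(\infty)=\infty$. Let $I\subseteq\overline{\mathbb R}[x_0,\dots,x_n]$ be a homogeneous tropical ideal, that is, a homogeneous ideal such that for all $f,g\in I$ and every monomial $\mathbf x^{\mathbf u}$ whose coefficients in $f$ and $g$ are equal and not $\infty$, there is $h\in I$ in which $\mathbf x^{\mathbf u}$ has coefficient $\infty$ and, for every monomial $\mathbf x^{\mathbf v}$, $[h]_{\mathbf v}\ge\min([f]_{\mathbf v},[g]_{\mathbf v})$, with equality whenever $[f]_{\mathbf v}\neq[g]_{\mathbf v}$. Let $\varphi(I)\subseteq\mathbb B[x_0,\dots,x_n]$, the trivialization of $I$, be the ideal obtained by applying $\varphi$ to all coefficients. For $\mathbf w\in\mathbb R^{n+1}$ and $f=\bigoplus c_{\mathbf u}\mathbf x^{\mathbf u}$ let $\mathrm{in}_{\mathbf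 w}(f)\in\mathbb B[x_0,\dots,x_n]$ be the sum of the monomials $\mathbf x^{\mathbf u}$ of $f$ at which the minimum $f(\mathbf w)=\min_{\mathbf u}(c_{\mathbf u}+\mathbf u\cdot\mathbf w)$ is attained, and for an ideal $J$ (over $\overline{\mathbb R}$ or $\mathbb B$) let $\mathrm{in}_{\mathbf w}(J)=\langle \mathrm{in}_{\mathbf w}(f):f\in J\rangle$. The Gröbner complex of $J$ is the set of the closures in $\mathbb R^{n+1}$ of the sets $\{\mathbf w':\mathrm{in}_{\mathbf w'}(J)=\mathrm{in}_{\mathbf w}(J)\}$, $\mathbf w\in\mathbb R^{n+1}$. Let $V(J)\subseteq\mathbb R^{n+1}$ be the set of those $\mathbf w$ such that for every $f\in J$ either $f(\mathbf w)=\infty$ or the minimum in $f(\mathbf w)$ is attained at least twice. A monomial term order $\prec$ is a total order on the monomials that is compatible with multiplication and has $\mathbf x^{\mathbf u}\prec 1$ for every monomial $\mathbf x^{\mathbf u}\ne1$, where $1$ denotes the constant monomial $\mathbf x^{\mathbf 0}$; $\mathrm{in}_\prec(I)\subseteq\mathbb B[x_0,\dots,x_n]$ is the ideal generated by the $\prec$-smallest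 monomials of the nonzero elements of $I$. The recession cone of a nonempty polyhedron $P$ is the largest cone $C$ with $P+C\subseteq P$, and the recession fan of a polyhedral complex is the set of the recession cones of its nonempty cells. A polyhedral complex is $\mathbb R$-rational if each of its polyhedra is given by linear inequalities with integral normal vectors. All polyhedral complexes are finite. Then: 1. The Gröbner complex of $I$ is an $\mathbb R$-rational polyhedral complex, the Gröbner complex of $\varphi(I)$ is an $\mathbb R$-rational polyhedral fan, and the latter is the recession fan of the former. 2. The maximal cones of this fan are in bijection with the ideals of the form $\mathrm{in}_\prec(I)$ with $\prec$ a monomial term order: every maximal cone $C$ has nonempty interior, and it corresponds to the ideal $J$ for which the interior of $C$ is the set of all $\mathbf w\in\mathbb R^{n+1}$ with $\mathrm{in}_{\mathbf w}(\varphi(I))=J$. 3. If $\Sigma$ is any polyhedral complex in $\mathbb R^{n+1}$ whose support (the union of its cells) is $V(I)$, then the support of the recession fan of $\Sigma$, that is, the union of the recession cones of its nonempty cells, is $V(\varphi(I))$. -/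

import Mathlib

namespace TropIdeal

open MvPolynomial

/-- The tropical semiring `ℝ ∪ {∞}` with `⊕ = min` and `⊙ = +`. Its zero is `∞`, its one is the
real number `0`, and its order is the usual order of `ℝ ∪ {∞}`. -/
abbrev TropReal : Type := Tropical (WithTop ℝ)

/-- The Boolean semiring `𝔹 = {0, ∞}`, as a subsemiring of the tropical semiring. -/
noncomputable def boolSubsemiring : Subsemiring TropReal where
  carrier := {x | x = 0 ∨ x = 1}
  mul_mem' := by
    rintro a b (rfl | rfl) (rfl | rfl) <;> simp
  one_mem' := Or.inr rfl
  add_mem' := by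
    rintro a b (rfl | rfl) (rfl | rfl) <;> simp
  zero_mem' := Or.inl rfl

/-- The Boolean semiring as a type. -/
abbrev BoolSemi : Type := boolSubsemiring

/-- The inclusion of the Boolean semiring into the tropical semiring. -/
noncomputable abbrev boolIncl : BoolSemi →+* TropReal := boolSubsemiring.subtype

/-- The identity of the tropical semiring: coefficients that are already in `ℝ ∪ {∞}`. -/
noncomputable abbrev realIncl : TropReal →+* TropReal := RingHom.id TropReal

theorem add_ne_zero_of_left {a b : TropReal} (ha : a ≠ 0) : a + b ≠ 0 := by
  intro h
  exact ha ((Tropical.add_eq_zero_iff).1 h).1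

open Classical in
/-- The semiring homomorphism `φ` from the tropical to the Boolean semiring: `∞ ↦ ∞`, and
every real number goes to `0` (which is the one of both semirings). -/
noncomputable def trivHom : TropReal →+* BoolSemi where
  toFun a := if a = 0 then 0 else 1
  map_one' := by simp
  map_zero' := by simp
  map_mul' a b := by
    by_cases ha : a = 0
    · simp [ha]
    · by_cases hb : b = 0
      · simp [hb]
      · have hab : a * b ≠ 0 := mul_ne_zero ha hb
        simp [ha, hb, hab]
  map_add' a b := by
    have h11 : (1 : BoolSemi) + 1 = 1 := by
      apply Subtype.ext
      simp
    by_cases ha : a = 0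
    · simp [ha]
    · have hab : a + b ≠ 0 := add_ne_zero_of_left ha
      by_cases hb : b = 0
      · simp [ha, hb]
      · simp [ha, hb, hab, h11]

section Groebner

variable {σ : Type*}

/-- An ideal is homogeneous if it contains the homogeneous components of its elements. -/
def IsHomogeneousIdeal {K : Type*} [CommSemiring K] (I : Ideal (MvPolynomial σ K)) : Prop :=
  ∀ f ∈ I, ∀ d : ℕ, homogeneousComponent d f ∈ I

/-- A tropical ideal: an ideal with the monomial elimination axiom. -/
def IsTropicalIdeal (I : Ideal (MvPolynomial σ TropReal)) : Prop :=
  ∀ f ∈ I, ∀ g ∈ I, ∀ u : σ →₀ ℕ, coeff u f = coeff u g → coeff u f ≠ 0 →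
    ∃ h ∈ I, coeff u h = 0 ∧
      ∀ v : σ →₀ ℕ, min (coeff v f) (coeff v g) ≤ coeff v h ∧
        (coeff v f ≠ coeff v g → coeff v h = min (coeff v f) (coeff v g))

/-- The trivialization `φ(I)`, obtained by applying `φ` to all coefficients. -/
noncomputable def trivialization (I : Ideal (MvPolynomial σ TropReal)) :
    Ideal (MvPolynomial σ BoolSemi) :=
  I.map (MvPolynomial.map trivHom : MvPolynomial σ TropReal →+* MvPolynomial σ BoolSemi)

/-- A real vector as a vector with entries in the tropical semiring. -/
def toTrop (w : σ → ℝ) : σ → TropReal := fun i => Tropical.trop ((w i : ℝ) : WithTop ℝ)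

/-! In the following, coefficients are taken in a semiring `K` that is mapped to the tropical
semiring by `ι`; the two cases of interest are `realIncl` and `boolIncl`. -/

variable {K : Type*} [CommSemiring K] (ι : K →+* TropReal)

/-- The value at `w` of the term of `f` with exponent `u`, that is, `c_u + u · w`. -/
noncomputable def termValue (w : σ → TropReal) (f : MvPolynomial σ K) (u : σ →₀ ℕ) : TropReal :=
  ι (coeff u f) * u.prod fun i k => w i ^ k

/-- The value `f(w)`, that is, the minimum over `u` of `c_u + u · w`. -/
noncomputable def polyValue (w : σ → TropReal) (f : MvPolynomial σ K) : TropReal :=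
  eval₂ ι w f

open Classical in
/-- The initial term `in_w(f)`: the sum, with Boolean coefficients, of the monomials of `f` at
which the minimum in `f(w)` is attained. -/
noncomputable def initialForm (w : σ → ℝ) (f : MvPolynomial σ K) : MvPolynomial σ BoolSemi :=
  ∑ u ∈ f.support with termValue ι (toTrop w) f u = polyValue ι (toTrop w) f, monomial u 1

/-- The initial ideal `in_w(I) = ⟨in_w(f) : f ∈ I⟩`. -/
noncomputable def initialIdeal (w : σ → ℝ) (I : Ideal (MvPolynomial σ K)) :
    Ideal (MvPolynomial σ BoolSemi) :=
  Ideal.span {g | ∃ f ∈ I, g = initialForm ι w f}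

/-- The Gröbner complex of `I`, as the set of its cells: the closures of the classes of weight
vectors with the same initial ideal. -/
noncomputable def groebnerComplex (I : Ideal (MvPolynomial σ K)) : Set (Set (σ → ℝ)) :=
  {P | ∃ w : σ → ℝ, P = closure {w' | initialIdeal ι w' I = initialIdeal ι w I}}

/-- The variety of `I`, with coordinates in `ℝ ∪ {∞}`: for every `f` in `I`, either
`f(w) = ∞` or the minimum in `f(w)` is attained at least twice. -/
def variety (I : Ideal (MvPolynomial σ K)) : Set (σ → TropReal) :=
  {w | ∀ f ∈ I, polyValue ι w f = 0 ∨
    ∃ u v : σ →₀ ℕ, u ≠ v ∧ termValue ι w f u = polyValue ι w f ∧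
      termValue ι w f v = polyValue ι w f}

/-- The points of the variety of `I` with real coordinates. -/
def realVariety (I : Ideal (MvPolynomial σ K)) : Set (σ → ℝ) :=
  {w | toTrop w ∈ variety ι I}

/-- `lt` is a monomial term order: a strict total order on exponent vectors that is compatible
with addition, and in which the constant monomial is the largest element (this is the convention
that goes with `min`). -/
structure IsTermOrder (lt : (σ →₀ ℕ) → (σ →₀ ℕ) → Prop) : Prop where
  irrefl : ∀ u, ¬ lt u u
  trans : ∀ u v w, lt u v → lt v w → lt u w
  total : ∀ u v, u ≠ v → lt u v ∨ lt v u
  add_right : ∀ u u' v, lt u u' → lt (u + v) (u' + v)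
  lt_zero : ∀ u, u ≠ 0 → lt u 0

/-- The initial ideal `in_≺(I)`: the monomial ideal generated by the `≺`-smallest monomials in
the supports of the nonzero elements of `I`. -/
noncomputable def termInitialIdeal (lt : (σ →₀ ℕ) → (σ →₀ ℕ) → Prop)
    (I : Ideal (MvPolynomial σ K)) : Ideal (MvPolynomial σ BoolSemi) :=
  Ideal.span {g | ∃ f ∈ I, ∃ u ∈ f.support,
    (∀ v ∈ f.support, v ≠ u → lt u v) ∧ g = monomial u 1}

end Groebner

section Polyhedral

variable {σ : Type*} [Fintype σ]

/-- A polyhedron: the set of solutions of finitely many weak linear inequalities. -/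
def IsPolyhedron (P : Set (σ → ℝ)) : Prop :=
  ∃ (m : ℕ) (A : Fin m → σ → ℝ) (b : Fin m → ℝ), P = {x | ∀ j, ∑ i, A j i * x i ≤ b j}

/-- An `ℝ`-rational polyhedron: the linear inequalities can be taken with integral normal
vectors (and arbitrary real right-hand sides). -/
def IsRRationalPolyhedron (P : Set (σ → ℝ)) : Prop :=
  ∃ (m : ℕ) (A : Fin m → σ → ℤ) (b : Fin m → ℝ), P = {x | ∀ j, ∑ i, (A j i : ℝ) * x i ≤ b j}

/-- A (finite) polyhedral complex: a finite set of polyhedra that contains the nonempty faces of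
its members, such that two members meet in a common face. (The empty set counts as a face and
may, but need not, be a member.) The faces of a polyhedron are its exposed subsets. -/
structure IsPolyhedralComplex (S : Set (Set (σ → ℝ))) : Prop where
  finite : S.Finite
  polyhedron : ∀ P ∈ S, IsPolyhedron P
  face_mem : ∀ P ∈ S, ∀ F : Set (σ → ℝ), F.Nonempty → IsExposed ℝ P F → F ∈ S
  inter_face : ∀ P ∈ S, ∀ Q ∈ S, IsExposed ℝ P (P ∩ Q) ∧ IsExposed ℝ Q (P ∩ Q)

/-- A polyhedral fan: a polyhedral complex all of whose members are cones. -/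
structure IsPolyhedralFan (S : Set (Set (σ → ℝ))) : Prop extends IsPolyhedralComplex S where
  cone : ∀ P ∈ S, (0 : σ → ℝ) ∈ P ∧ ∀ x ∈ P, ∀ t : ℝ, 0 ≤ t → t • x ∈ P

/-- The recession cone of `P`: the largest cone `C` with `P + C ⊆ P`. -/
def recessionCone (P : Set (σ → ℝ)) : Set (σ → ℝ) :=
  {v | ∀ x ∈ P, ∀ t : ℝ, 0 ≤ t → x + t • v ∈ P}

/-- The set of the recession cones of the (nonempty) members of `S`. -/
def recessionFan (S : Set (Set (σ → ℝ))) : Set (Set (σ → ℝ)) :=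
  {C | ∃ P ∈ S, P.Nonempty ∧ C = recessionCone P}

end Polyhedral

end TropIdeal

/-!
Everything is reduced to systems of coefficient vectors with entries in `ℝ ∪ {∞}` that satisfy the
vector elimination axiom. In every degree `≤ D`, and at every weight vector `w`, the sets of
positions at which such vectors, shifted by `w`, attain their minimum are the dependent sets of a
matroid (`IsElim`, `IsBase`). The truncation to degree `≤ D` of a tropical ideal is in effect a
valuated matroid, and a base `B` at `w` is described by the linear inequalities
`u · w ≤ c + b · w` given by the entries `c` of the fundamental vectors of `B` (`mem_bases_iff`).

The Gröbner complex. The initial ideal at `w` is determined by the matroids at `w` in all degrees.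
By Macaulay's theorem the standard monomials of a monomial order form a base
(`IsTropSystem.stdMonos_mem_bases`), and since only finitely many sets of leading monomials occur
(`finite_leadSets`), one degree `D` suffices (`IsTropSystem.initLE_iff`). The closure of a Gröbner
class is therefore the polyhedron of all `w'` at which the bases at `w` remain bases (`cell`).
Bases of maximal weight vary linearly along segments (`IsBase.segment`, `IsBase.sum_sub_le`), which
gives the faces and the intersections of these polyhedra (`isPolyhedralComplex_range_cell`).
Replacing all finite entries by constants turns the inequalities of a cell into those of its
recession cone. Each cell of the trivialized system arises in this way, from a weight vector with
as many bases as possible among those whose bases are all bases of the cell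
(`recessionFan_range_cell`).

Maximal cones. By Farkas' lemma a monomial order agrees with a weight vector on any finite set of
monomials (`IsMonomialOrder.exists_weight`). At a weight vector that represents the order in degree
`≤ D` the standard monomials are the only base, so that its class is open. Conversely, a maximal
cone is the cell of a weight vector that represents an order obtained by refining a weight of the
cone. By homogeneity the order may compare monomials by decreasing degree first, which makes the
constant monomial the largest one (`exists_equiv_maximal_cells`).

The variety. If a ray in the direction `v` stays in `V(I)`, comparing terms far out shows that
`v ∈ V(φ(I))`. For the converse, `V(I)` is cut out by finitely many fundamental vectors
(`IsTropSystem.exists_tropicalBasis`), and it is enough to find a common root `x` of their parts of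
least `v`-weight: then `x + t v ∈ V(I)` for all large `t` (`eventually_initSet_eq`), and one of the
finitely many polyhedra contains points of this ray arbitrarily far out. The parts of least
`v`-weight of all elements of `I` again satisfy elimination, and by `v ∈ V(φ(I))` none of them is a
monomial, so that in each degree there is a real vector `z`, not necessarily of the form
`u ↦ x · u`, at which no minimum is attained only once (`IsElim.exists_no_loop`). The tropical dual
Nullstellensatz of Grigoriev and Podolskii turns `z` into an honest root
(`IsMonomialOrder.exists_common_root`); it is proved here by linear programming duality.
-/

namespace TropIdeal

open MvPolynomial

/-! ### Matroids of minimal positions -/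

section Elimination

variable {E : Type*}

/-- The set of positions at which `f` attains its minimum; it is empty if `f = ∞`. -/
def minSet (f : E → WithTop ℝ) : Set E := {u | f u ≠ ⊤ ∧ ∀ v, f u ≤ f v}

/-- A set `L` of vectors with entries in `ℝ ∪ {∞}`, all supported in the finite set `A`, that is
closed under adding constants and satisfies the vector elimination axiom of valuated matroids.
Closure under tropical sums is not required. -/
structure IsElim (A : Finset E) (L : Set (E → WithTop ℝ)) : Prop where
  supp : ∀ f ∈ L, ∀ u, f u ≠ ⊤ → u ∈ A
  scale : ∀ f ∈ L, ∀ r : ℝ, (fun u => f u + (r : WithTop ℝ)) ∈ L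
  elim : ∀ f ∈ L, ∀ g ∈ L, ∀ u, f u = g u → f u ≠ ⊤ → ∃ h ∈ L, h u = ⊤ ∧
    ∀ v, min (f v) (g v) ≤ h v ∧ (f v ≠ g v → h v = min (f v) (g v))

/-- The system of the vectors `f + x`, `f ∈ L`. -/
def translate (L : Set (E → WithTop ℝ)) (x : E → ℝ) : Set (E → WithTop ℝ) :=
  {g | ∃ f ∈ L, g = fun u => f u + (x u : WithTop ℝ)}

/-- `B` contains none of the nonempty sets `minSet f`, `f ∈ L`. -/
def Indep (L : Set (E → WithTop ℝ)) (B : Set E) : Prop :=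
  ∀ f ∈ L, (minSet f).Nonempty → ¬ minSet f ⊆ B

/-- `e` lies in a set `minSet f`, `f ∈ L`, all of whose other elements belong to `B`. -/
def Spans (L : Set (E → WithTop ℝ)) (B : Set E) (e : E) : Prop :=
  ∃ f ∈ L, e ∈ minSet f ∧ minSet f ⊆ insert e B

/-- The bases of the matroid whose dependent sets are the supersets of the sets `minSet f ≠ ∅`,
`f ∈ L`: the maximal independent subsets of `A`. -/
def IsBase (A : Finset E) (L : Set (E → WithTop ℝ)) (B : Finset E) : Prop :=
  B ⊆ A ∧ Indep L B ∧ ∀ e ∈ A, e ∉ B → Spans L B e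

theorem minSet_add_const (f : E → WithTop ℝ) (r : ℝ) :
    minSet (fun u => f u + (r : WithTop ℝ)) = minSet f := by
  ext u
  simp only [minSet, Set.mem_ofPred_eq]
  constructor
  · rintro ⟨h1, h2⟩
    refine ⟨fun h => h1 (by simp [h]), fun v => ?_⟩
    exact (WithTop.add_le_add_iff_right WithTop.coe_ne_top).1 (h2 v)
  · rintro ⟨h1, h2⟩
    refine ⟨by simp [h1], fun v => ?_⟩
    exact (WithTop.add_le_add_iff_right WithTop.coe_ne_top).2 (h2 v)

theorem exists_scale_eq {A : Finset E} {L : Set (E → WithTop ℝ)} (hL : IsElim A L)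
    {g : E → WithTop ℝ} (hg : g ∈ L) {u : E} (hu : g u ≠ ⊤) {a : WithTop ℝ} (ha : a ≠ ⊤) :
    ∃ g' ∈ L, g' u = a ∧ ∃ r : ℝ, ∀ v, g' v = g v + (r : WithTop ℝ) := by
  obtain ⟨b, hb⟩ := WithTop.ne_top_iff_exists.1 hu
  obtain ⟨c, rfl⟩ := WithTop.ne_top_iff_exists.1 ha
  refine ⟨_, hL.scale g hg (c - b), ?_, c - b, fun v => rfl⟩
  simp only [← hb]
  norm_cast
  ring

theorem eq_of_mem_minSet {f : E → WithTop ℝ} {u v : E} (hu : u ∈ minSet f) (hv : v ∈ minSet f) :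
    f u = f v := le_antisymm (hu.2 v) (hv.2 u)

theorem mem_minSet_of_le {f : E → WithTop ℝ} {u v : E} (hu : u ∈ minSet f) (hv : f v ≤ f u) :
    v ∈ minSet f :=
  ⟨fun h => hu.1 (top_le_iff.1 (h ▸ hv)), fun w => hv.trans (hu.2 w)⟩

variable {A : Finset E} {L : Set (E → WithTop ℝ)}

theorem IsElim.minSet_subset (hL : IsElim A L) {f : E → WithTop ℝ} (hf : f ∈ L) :
    minSet f ⊆ A := fun u hu => hL.supp f hf u hu.1

theorem IsElim.minSet_finite (hL : IsElim A L) {f : E → WithTop ℝ} (hf : f ∈ L) :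
    (minSet f).Finite := A.finite_toSet.subset (hL.minSet_subset hf)

theorem minSet_nonempty_of_finite {f : E → WithTop ℝ} (hfin : {u | f u ≠ ⊤}.Finite) {u : E}
    (hu : f u ≠ ⊤) : (minSet f).Nonempty := by
  obtain ⟨v, hv, hmin⟩ := Set.exists_min_image _ f hfin ⟨u, hu⟩
  refine ⟨v, hv, fun w => ?_⟩
  by_cases hw : f w = ⊤
  · simp [hw]
  · exact hmin w hw

theorem IsElim.minSet_nonempty (hL : IsElim A L) {f : E → WithTop ℝ} (hf : f ∈ L) {u : E}
    (hu : f u ≠ ⊤) : (minSet f).Nonempty :=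
  minSet_nonempty_of_finite (A.finite_toSet.subset fun v hv => hL.supp f hf v hv) hu

theorem IsElim.isElim_translate (hL : IsElim A L) (x : E → ℝ) : IsElim A (translate L x) where
  supp := by
    rintro _ ⟨f, hf, rfl⟩ u hu
    exact hL.supp f hf u fun h => hu (by simp [h])
  scale := by
    rintro _ ⟨f, hf, rfl⟩ r
    refine ⟨_, hL.scale f hf r, ?_⟩
    funext u
    rw [add_assoc, add_assoc, add_comm (x u : WithTop ℝ)]
  elim := by
    rintro _ ⟨f, hf, rfl⟩ _ ⟨g, hg, rfl⟩ u huv hu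
    have huv' : f u = g u := (WithTop.add_right_inj WithTop.coe_ne_top).1 huv
    obtain ⟨h, hh, h1, h2⟩ := hL.elim f hf g hg u huv' fun h => hu (by simp [h])
    refine ⟨_, ⟨h, hh, rfl⟩, by simp [h1], fun v => ?_⟩
    simp only [min_add_add_right]
    refine ⟨add_le_add_left (h2 v).1 _, fun hne => ?_⟩
    rw [(h2 v).2 fun h => hne (by rw [h])]

/-- Strong elimination for the sets of minimal positions. -/
theorem IsElim.strong_elim (hL : IsElim A L) {f g : E → WithTop ℝ} (hf : f ∈ L) (hg : g ∈ L)
    {u v : E} (huf : u ∈ minSet f) (hug : u ∈ minSet g) (hvf : v ∈ minSet f)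
    (hvg : v ∉ minSet g) :
    ∃ h ∈ L, v ∈ minSet h ∧ u ∉ minSet h ∧ minSet h ⊆ minSet f ∪ minSet g := by
  obtain ⟨g', hg', hgu, r, hr⟩ := exists_scale_eq hL hg hug.1 huf.1
  have hms : minSet g' = minSet g := by
    rw [← minSet_add_const g r]; congr 1; exact funext hr
  rw [← hms] at hug hvg ⊢
  obtain ⟨h, hh, hu, hmin⟩ := hL.elim f hf g' hg' u hgu.symm huf.1
  have hfv : f v = f u := eq_of_mem_minSet hvf huf
  have hlt : f v < g' v := by
    by_contra hcon
    exact hvg (mem_minSet_of_le hug (by rw [hgu, ← hfv]; exact not_lt.1 hcon))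
  have hhv : h v = f u := by
    rw [(hmin v).2 hlt.ne, min_eq_left hlt.le, hfv]
  have hle : ∀ w, f u ≤ h w := fun w =>
    (le_min (huf.2 w) (hgu ▸ hug.2 w)).trans (hmin w).1
  have hvh : v ∈ minSet h := ⟨by rw [hhv]; exact huf.1, fun w => hhv ▸ hle w⟩
  refine ⟨h, hh, hvh, fun hcon => hcon.1 hu, fun w hw => ?_⟩
  have hhw : h w = f u := (eq_of_mem_minSet hw hvh).trans hhv
  by_contra hcon
  rw [Set.mem_union, not_or] at hcon
  have h1 : f u < f w := by
    by_contra hc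
    exact hcon.1 (mem_minSet_of_le huf (not_lt.1 hc))
  have h2 : f u < g' w := by
    by_contra hc
    exact hcon.2 (mem_minSet_of_le hug (hgu ▸ not_lt.1 hc))
  exact absurd ((lt_min h1 h2).trans_le (hmin w).1) (by rw [hhw]; exact lt_irrefl _)

/-- Transitivity of spanning. -/
theorem IsElim.spans_of_forall (hL : IsElim A L) {B : Set E} {v : E} (hvB : v ∉ B)
    {f : E → WithTop ℝ} (hf : f ∈ L) (hv : v ∈ minSet f)
    (h : ∀ w ∈ minSet f, w ≠ v → w ∉ B → Spans L B w) : Spans L B v := by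
  induction hn : (minSet f \ insert v B).ncard using Nat.strong_induction_on generalizing f with
  | _ n ih =>
    by_cases hsub : minSet f ⊆ insert v B
    · exact ⟨f, hf, hv, hsub⟩
    · obtain ⟨w, hw, hwB⟩ := Set.not_subset.1 hsub
      rw [Set.mem_insert_iff, not_or] at hwB
      obtain ⟨g, hg, hwg, hgB⟩ := h w hw hwB.1 hwB.2
      have hvg : v ∉ minSet g := by
        intro hc
        rcases hgB hc with hc | hc
        · exact hwB.1 hc.symm
        · exact hvB hc
      obtain ⟨k, hk, hvk, hwk, hsubk⟩ := hL.strong_elim hf hg hw hwg hv hvg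
      have hsub' : minSet k \ insert v B ⊆ minSet f \ insert v B := by
        rintro z ⟨hz, hzB⟩
        refine ⟨?_, hzB⟩
        rcases hsubk hz with hz' | hz'
        · exact hz'
        · rcases hgB hz' with rfl | hz''
          · exact absurd hz hwk
          · exact absurd (Or.inr hz'') hzB
      refine ih _ ?_ hk hvk ?_ rfl
      · rw [← hn]
        refine Set.ncard_lt_ncard ?_ ((hL.minSet_finite hf).subset Set.sdiff_subset)
        refine ⟨hsub', fun hc => hwk (hc ⟨hw, ?_⟩).1⟩
        rw [Set.mem_insert_iff, not_or]; exact hwB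
      · intro z hz hzv hzB
        have := hsub' ⟨hz, by rw [Set.mem_insert_iff, not_or]; exact ⟨hzv, hzB⟩⟩
        exact h z this.1 hzv hzB

theorem Indep.mono {B C : Set E} (hC : Indep L C) (h : B ⊆ C) : Indep L B :=
  fun f hf hne hsub => hC f hf hne (hsub.trans h)

theorem Indep.not_spans {B C : Set E} (hC : Indep L C) {e : E} (h : insert e B ⊆ C) :
    ¬ Spans L B e := fun ⟨f, hf, hef, hsub⟩ => hC f hf ⟨e, hef⟩ (hsub.trans h)

theorem Indep.spans_of_not_indep_insert {B : Set E} (hB : Indep L B) {e : E}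
    (h : ¬ Indep L (insert e B)) : Spans L B e := by
  unfold Indep at h
  push Not at h
  obtain ⟨f, hf, hne, hsub⟩ := h
  refine ⟨f, hf, ?_, hsub⟩
  by_contra hef
  refine hB f hf hne fun u hu => ?_
  rcases hsub hu with rfl | h'
  · exact absurd hu hef
  · exact h'

theorem Indep.exists_isBase {B : Finset E} (hB : Indep L B) (hBA : B ⊆ A) :
    ∃ C, B ⊆ C ∧ IsBase A L C := by
  classical
  let s := A.powerset.filter fun C : Finset E => B ⊆ C ∧ Indep L (C : Set E)
  obtain ⟨C, hC, hmax⟩ := s.exists_max_image Finset.card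
    ⟨B, by simp only [s, Finset.mem_filter, Finset.mem_powerset]; exact ⟨hBA, subset_rfl, hB⟩⟩
  simp only [s, Finset.mem_filter, Finset.mem_powerset] at hC hmax
  refine ⟨C, hC.2.1, hC.1, hC.2.2, fun e he heC => ?_⟩
  refine hC.2.2.spans_of_not_indep_insert fun hind => ?_
  have := hmax (insert e C) ⟨Finset.insert_subset he hC.1,
    hC.2.1.trans (Finset.subset_insert _ _), by rw [Finset.coe_insert]; exact hind⟩
  rw [Finset.card_insert_of_notMem heC] at this
  omega

theorem exists_isBase (A : Finset E) (L : Set (E → WithTop ℝ)) : ∃ B, IsBase A L B := by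
  have : Indep L (((∅ : Finset E)) : Set E) := by
    intro f _ ⟨u, hu⟩ hsub
    simpa using hsub hu
  obtain ⟨B, _, hB⟩ := this.exists_isBase (A := A) (Finset.empty_subset _)
  exact ⟨B, hB⟩

variable [DecidableEq E]

/-- If `e` can be exchanged against `b`, then this gives a base. -/
theorem IsBase.exchange (hL : IsElim A L) {B : Finset E} (hB : IsBase A L B) {e b : E}
    (heB : e ∉ B) (hb : b ∈ B) {f : E → WithTop ℝ} (hf : f ∈ L)
    (hef : e ∈ minSet f) (hbf : b ∈ minSet f) (hsub : minSet f ⊆ insert e (B : Set E)) :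
    IsBase A L (insert e (B.erase b)) := by
  have hbe : b ≠ e := fun h => heB (h ▸ hb)
  have hbspan : Spans L ((insert e (B.erase b) : Finset E) : Set E) b := by
    refine ⟨f, hf, hbf, fun u hu => ?_⟩
    rcases hsub hu with rfl | h
    · simp
    · by_cases hub : u = b
      · simp [hub]
      · simp only [Finset.coe_insert, Finset.coe_erase]
        exact Or.inr (Or.inr ⟨h, hub⟩)
  refine ⟨?_, ?_, ?_⟩
  · exact Finset.insert_subset (hL.minSet_subset hf hef) ((Finset.erase_subset _ _).trans hB.1)
  · intro g hg hne hgs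
    have heg : e ∈ minSet g := by
      by_contra hc
      refine hB.2.1 g hg hne fun u hu => ?_
      have := hgs hu
      simp only [Finset.coe_insert, Finset.coe_erase, Set.mem_insert_iff, Set.mem_sdiff,
        Set.mem_singleton_iff] at this
      rcases this with rfl | h
      · exact absurd hu hc
      · exact h.1
    have hbg : b ∉ minSet g := by
      intro hc
      have := hgs hc
      simp [hbe] at this
    obtain ⟨h, hh, hbh, heh, hs⟩ := hL.strong_elim hf hg hef heg hbf hbg
    refine hB.2.1 h hh ⟨b, hbh⟩ fun u hu => ?_
    have hue : u ≠ e := fun hc => heh (hc ▸ hu)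
    rcases hs hu with h' | h'
    · exact (hsub h').resolve_left hue
    · have := hgs h'
      simp only [Finset.coe_insert, Finset.coe_erase, Set.mem_insert_iff, Set.mem_sdiff,
        Set.mem_singleton_iff] at this
      exact (this.resolve_left hue).1
  · intro d hd hdB
    by_cases hdb : d = b
    · rw [hdb]; exact hbspan
    · have hdB' : d ∉ B := fun h => hdB (by simp [h, hdb])
      obtain ⟨g, hg, hdg, hgs⟩ := hB.2.2 d hd hdB'
      refine hL.spans_of_forall (by exact_mod_cast hdB) hg hdg fun w hw hwd hwB => ?_
      have hwB' : w ∈ B := by exact_mod_cast (hgs hw).resolve_left hwd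
      have : w = b := by
        by_contra hc
        exact hwB (by simp [hc, hwB'])
      rw [this]; exact hbspan

/-- Symmetric exchange. -/
theorem IsBase.symm_exchange (hL : IsElim A L) {B C : Finset E} (hB : IsBase A L B)
    (hC : IsBase A L C) {e : E} (heC : e ∈ C) (heB : e ∉ B) :
    ∃ b ∈ B, b ∉ C ∧ IsBase A L (insert e (B.erase b)) ∧ IsBase A L (insert b (C.erase e)) := by
  obtain ⟨f, hf, hef, hsub⟩ := hB.2.2 e (hC.1 heC) heB
  have hind : ¬ Spans L ((C.erase e : Finset E) : Set E) e := by
    refine hC.2.1.not_spans ?_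
    rw [← Finset.coe_insert, Finset.insert_erase heC]
  have : ∃ b ∈ minSet f, b ≠ e ∧ b ∉ C ∧ ¬ Spans L ((C.erase e : Finset E) : Set E) b := by
    by_contra hcon
    push Not at hcon
    refine hind (hL.spans_of_forall (by simp) hf hef fun w hw hwe hwC => ?_)
    exact hcon w hw hwe fun h => hwC (by simp [h, hwe])
  obtain ⟨b, hbf, hbe, hbC, hbs⟩ := this
  have hbB : b ∈ B := by exact_mod_cast (hsub hbf).resolve_left hbe
  refine ⟨b, hbB, hbC, hB.exchange hL heB hbB hf hef hbf hsub, ?_⟩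
  obtain ⟨g, hg, hbg, hgs⟩ := hC.2.2 b (hB.1 hbB) hbC
  refine hC.exchange hL hbC heC hg hbg ?_ hgs
  by_contra heg
  refine hbs ⟨g, hg, hbg, fun u hu => ?_⟩
  rcases hgs hu with h | h
  · exact Or.inl h
  · right
    simp only [Finset.coe_erase]
    exact ⟨h, fun hc => heg (hc ▸ hu)⟩

/-- A base that cannot be improved by an exchange of one element has maximal weight. -/
theorem IsBase.sum_le_of_local_max (hL : IsElim A L) {B C : Finset E} (hB : IsBase A L B)
    (hC : IsBase A L C) (δ : E → ℝ)
    (h : ∀ e, e ∉ B → ∀ b ∈ B, IsBase A L (insert e (B.erase b)) → δ e ≤ δ b) :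
    ∑ u ∈ C, δ u ≤ ∑ u ∈ B, δ u := by
  induction hn : (C \ B).card generalizing C with
  | zero =>
    have hCB : C ⊆ B := by
      rw [Finset.card_eq_zero, Finset.sdiff_eq_empty_iff_subset] at hn
      exact hn
    have : C = B := by
      refine hCB.antisymm fun u hu => ?_
      by_contra huC
      refine hB.2.1.not_spans ?_ (hC.2.2 u (hB.1 hu) huC)
      rw [← Finset.coe_insert, Finset.coe_subset]
      exact Finset.insert_subset hu hCB
    rw [this]
  | succ n ih =>
    obtain ⟨e, he⟩ : (C \ B).Nonempty := Finset.card_pos.1 (by omega)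
    rw [Finset.mem_sdiff] at he
    obtain ⟨b, hbB, hbC, h1, h2⟩ := hB.symm_exchange hL hC he.1 he.2
    have hle := ih h2 (by
      have : insert b (C.erase e) \ B = (C \ B).erase e := by
        ext u
        simp only [Finset.mem_sdiff, Finset.mem_insert, Finset.mem_erase]
        constructor
        · rintro ⟨rfl | h, h'⟩
          · exact absurd hbB h'
          · exact ⟨h.1, h.2, h'⟩
        · rintro ⟨h, h', h''⟩
          exact ⟨Or.inr ⟨h, h'⟩, h''⟩
      rw [this, Finset.card_erase_of_mem (Finset.mem_sdiff.2 he), hn]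
      rfl)
    rw [Finset.sum_insert (by simp [hbC])] at hle
    have := Finset.add_sum_erase C δ he.1
    have := h e he.2 b hbB h1
    linarith

/-- The matroid is determined by its bases. -/
theorem exists_minSet_subset_of_isBase_iff (hL : IsElim A L) {L' : Set (E → WithTop ℝ)}
    (h : ∀ B, IsBase A L B → IsBase A L' B)
    (h' : ∀ B, IsBase A L' B → IsBase A L B) {f : E → WithTop ℝ} (hf : f ∈ L) {u : E}
    (hu : u ∈ minSet f) : ∃ g ∈ L', u ∈ minSet g ∧ minSet g ⊆ minSet f := by
  classical
  -- `C` is a maximal independent subset of `minSet f \ {u}`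
  let s := A.powerset.filter fun C : Finset E => (C : Set E) ⊆ minSet f \ {u} ∧ Indep L (C : Set E)
  obtain ⟨C, hC, hmax⟩ := s.exists_max_image Finset.card ⟨∅, by
    simp only [s, Finset.mem_filter, Finset.mem_powerset]
    refine ⟨by simp, by simp, fun g _ ⟨v, hv⟩ hsub => by simpa using hsub hv⟩⟩
  simp only [s, Finset.mem_filter, Finset.mem_powerset] at hC hmax
  obtain ⟨hCA, hCf, hCi⟩ := hC
  have huC : u ∉ (C : Set E) := fun hc => (hCf hc).2 rfl
  have hsp : Spans L C u := by
    refine hL.spans_of_forall huC hf hu fun w hw hwu hwC => ?_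
    refine hCi.spans_of_not_indep_insert fun hind => ?_
    have hwC' : w ∉ C := by exact_mod_cast hwC
    have := hmax (insert w C) ⟨Finset.insert_subset (hL.minSet_subset hf hw) hCA, ?_,
      by rw [Finset.coe_insert]; exact hind⟩
    · rw [Finset.card_insert_of_notMem hwC'] at this
      omega
    · rw [Finset.coe_insert]
      exact Set.insert_subset ⟨hw, hwu⟩ hCf
  -- the set `insert u C` is dependent in the first matroid, hence in the second
  have hCi' : Indep L' (C : Set E) := by
    obtain ⟨B, hCB, hB⟩ := hCi.exists_isBase hCA
    exact (h B hB).2.1.mono (by exact_mod_cast hCB)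
  have hdep : ¬ Indep L' (insert u (C : Set E)) := by
    intro hc
    rw [← Finset.coe_insert] at hc
    obtain ⟨B, hCB, hB⟩ := hc.exists_isBase (A := A)
      (Finset.insert_subset (hL.minSet_subset hf hu) hCA)
    refine (h' B hB).2.1.not_spans (e := u) ?_ hsp
    rw [← Finset.coe_insert]
    exact_mod_cast hCB
  obtain ⟨g, hg, hug, hsub⟩ := hCi'.spans_of_not_indep_insert hdep
  refine ⟨g, hg, hug, fun v hv => ?_⟩
  rcases hsub hv with rfl | hv'
  · exact hu
  · exact (hCf hv').1

end Elimination

/-! ### Fundamental vectors, variation of the weight, and loops -/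

section SupportBase

variable {E : Type*} {A : Finset E} {L : Set (E → WithTop ℝ)}

/-- A vector of `L` whose support consists of `e` and elements of `B`, normalized at `e`. -/
structure IsFundVec (L : Set (E → WithTop ℝ)) (B : Finset E) (e : E) (g : E → WithTop ℝ) :
    Prop where
  mem : g ∈ L
  apply_self : g e = 0
  supp : ∀ v, g v ≠ ⊤ → v = e ∨ v ∈ B

/-- The bases of the matroid underlying `L`: `B` contains no support of a vector of `L`, and
each further element has a fundamental vector. -/
structure IsSuppBase (A : Finset E) (L : Set (E → WithTop ℝ)) (B : Finset E) : Prop where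
  subset : B ⊆ A
  indep : ∀ f ∈ L, ∀ u, f u ≠ ⊤ → ∃ v, f v ≠ ⊤ ∧ v ∉ B
  exists_fund : ∀ e ∈ A, e ∉ B → ∃ g, IsFundVec L B e g

/-- An entry above the minimum can be eliminated without changing the set of minimal positions. -/
theorem IsElim.elim_above (hL : IsElim A L) {f g : E → WithTop ℝ} (hf : f ∈ L) (hg : g ∈ L)
    {u p : E} (hu : u ∈ minSet f) (hpg : p ∈ minSet g) (hpf : p ∉ minSet f) (hp : f p ≠ ⊤) :
    ∃ h ∈ L, minSet h = minSet f ∧ h p = ⊤ ∧ ∀ w, f w = ⊤ → g w = ⊤ → h w = ⊤ := by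
  obtain ⟨g', hg', hgp, r, hr⟩ := exists_scale_eq hL hg hpg.1 hp
  have hlt : f u < f p := by
    by_contra hc
    exact hpf (mem_minSet_of_le hu (not_lt.1 hc))
  have hge : ∀ w, f p ≤ g' w := fun w => by
    rw [← hgp, hr, hr]
    exact add_le_add_left (hpg.2 w) _
  obtain ⟨h, hh, hhp, hmin⟩ := hL.elim f hf g' hg' p hgp.symm hp
  have hle : ∀ w, f u ≤ h w := fun w =>
    (le_min (hu.2 w) (hlt.le.trans (hge w))).trans (hmin w).1
  have heq : ∀ w ∈ minSet f, h w = f u := fun w hw => by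
    have h1 : f w = f u := eq_of_mem_minSet hw hu
    have h2 : f w < g' w := h1 ▸ hlt.trans_le (hge w)
    rw [(hmin w).2 h2.ne, min_eq_left h2.le, h1]
  refine ⟨h, hh, ?_, hhp, fun w hfw hgw => ?_⟩
  · ext w
    constructor
    · intro hw
      by_contra hc
      have h1 : f u < f w := by
        by_contra hc'
        exact hc (mem_minSet_of_le hu (not_lt.1 hc'))
      have h2 : h w ≤ f u := (hw.2 u).trans (heq u hu).le
      exact absurd ((lt_min h1 (hlt.trans_le (hge w))).trans_le (hmin w).1) (not_lt.2 h2)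
    · intro hw
      refine ⟨by rw [heq w hw]; exact hu.1, fun v => ?_⟩
      rw [heq w hw]
      exact hle v
  · have h1 : g' w = ⊤ := by rw [hr, hgw, top_add]
    have := (hmin w).1
    rw [hfw, h1, min_self, top_le_iff] at this
    exact this

theorem exists_fund_of_isSuppBase (B : Finset E) (hB : IsSuppBase A L B) :
    ∃ g : E → E → WithTop ℝ, ∀ e ∈ A, e ∉ B → IsFundVec L B e (g e) := by
  classical
  choose g hg using hB.exists_fund
  refine ⟨fun e => if h : e ∈ A ∧ e ∉ B then g e h.1 h.2 else fun _ => ⊤, fun e he heB => ?_⟩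
  simp only [he, heB, not_false_eq_true, and_self, dif_pos]
  exact hg e he heB

theorem exists_fund (A : Finset E) (L : Set (E → WithTop ℝ)) :
    ∃ G : Finset E → E → E → WithTop ℝ,
      ∀ B, IsSuppBase A L B → ∀ e ∈ A, e ∉ B → IsFundVec L B e (G B e) := by
  have : ∀ B, ∃ g : E → E → WithTop ℝ, IsSuppBase A L B →
      ∀ e ∈ A, e ∉ B → IsFundVec L B e (g e) := by
    intro B
    by_cases hB : IsSuppBase A L B
    · obtain ⟨g, hg⟩ := exists_fund_of_isSuppBase B hB
      exact ⟨g, fun _ => hg⟩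
    · exact ⟨fun _ _ => ⊤, fun h => absurd h hB⟩
  choose G hG using this
  exact ⟨G, hG⟩

/-- The vectors `x` for which `B` is a base at `x` form a polyhedron, with one inequality
`x e ≤ c + x b` for each finite entry `c` at `b` of the fundamental vector of `e`. -/
theorem isBase_translate_iff (hL : IsElim A L) {B : Finset E} (hB : IsSuppBase A L B)
    {g : E → E → WithTop ℝ} (hg : ∀ e ∈ A, e ∉ B → IsFundVec L B e (g e)) (x : E → ℝ) :
    IsBase A (translate L x) B ↔
      ∀ e ∈ A, e ∉ B → ∀ b ∈ B, ∀ c : ℝ, g e b = c → x e ≤ c + x b := by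
  have hgx : ∀ e, (fun u => g e u + (x u : WithTop ℝ)) e = g e e + (x e : WithTop ℝ) :=
    fun _ => rfl
  constructor
  · intro h e he heB b hb c hc
    obtain ⟨hm, h0, hs⟩ := hg e he heB
    set k : E → WithTop ℝ := fun u => g e u + (x u : WithTop ℝ) with hk
    have hkL : k ∈ translate L x := ⟨g e, hm, rfl⟩
    have hke : k e = (x e : WithTop ℝ) := by simp [hk, h0]
    have hemin : e ∈ minSet k := by
      by_contra hcon
      refine h.2.1 k hkL ((hL.isElim_translate x).minSet_nonempty hkL (u := e) (by simp [hke]))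
        fun v hv => ?_
      rcases hs v (fun hc => hv.1 (by simp [hk, hc])) with rfl | h'
      · exact absurd hv hcon
      · exact_mod_cast h'
    have := hemin.2 b
    rw [hke] at this
    simp only [hk, hc] at this
    exact_mod_cast this
  · intro h
    have hmin : ∀ e ∈ A, e ∉ B → e ∈ minSet fun u => g e u + (x u : WithTop ℝ) := by
      intro e he heB
      obtain ⟨hm, h0, hs⟩ := hg e he heB
      refine ⟨by simp [h0], fun v => ?_⟩
      by_cases hv : g e v = ⊤
      · simp [hv]
      obtain ⟨c, hc⟩ := WithTop.ne_top_iff_exists.1 hv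
      rcases hs v hv with rfl | hvB
      · exact le_rfl
      · have := h e he heB v hvB c hc.symm
        simp only [h0, ← hc, zero_add]
        exact_mod_cast this
    refine ⟨hB.subset, ?_, fun e he heB => ?_⟩
    · -- the entries outside `B` are eliminated by fundamental vectors
      have key : ∀ n, ∀ f ∈ translate L x, (minSet f).Nonempty → minSet f ⊆ (B : Set E) →
          ({u | f u ≠ ⊤} \ (B : Set E)).ncard = n → False := by
        intro n
        induction n using Nat.strong_induction_on with
        | _ n ih =>
          intro f hf hne hsub hn
          obtain ⟨u, hu⟩ := hne
          obtain ⟨f', hf', hff'⟩ := id hf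
          obtain ⟨d, hd, hdB⟩ := hB.indep f' hf' u fun hc => hu.1 (by simp [hff', hc])
          have hfd : f d ≠ ⊤ := by simp [hff', hd]
          have hdA : d ∈ A := hL.supp f' hf' d hd
          obtain ⟨k, hk, hkm, hkd, hkw⟩ := (hL.isElim_translate x).elim_above hf
            ⟨g d, (hg d hdA hdB).mem, rfl⟩ hu (hmin d hdA hdB)
            (fun hc => hdB (by exact_mod_cast hsub hc)) hfd
          refine ih _ ?_ k hk ⟨u, hkm ▸ hu⟩ (hkm ▸ hsub) rfl
          rw [← hn]
          refine Set.ncard_lt_ncard ?_ ?_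
          · refine ⟨?_, fun hc => (hc ⟨hfd, by exact_mod_cast hdB⟩).1 hkd⟩
            rintro w ⟨hw, hwB⟩
            refine ⟨fun hfw => hw (hkw w hfw ?_), hwB⟩
            by_contra hgw
            have hgw' : g d w ≠ ⊤ := fun hc => hgw (by simp [hc])
            rcases (hg d hdA hdB).supp w hgw' with rfl | h'
            · exact hfd hfw
            · exact hwB (by exact_mod_cast h')
          · exact (A.finite_toSet.subset fun w hw =>
              (hL.isElim_translate x).supp f hf w hw).subset Set.sdiff_subset
      exact fun f hf hne hsub => key _ f hf hne hsub rfl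
    · refine ⟨_, ⟨g e, (hg e he heB).mem, rfl⟩, hmin e he heB, fun v hv => ?_⟩
      rcases (hg e he heB).supp v (fun hc => hv.1 (by simp [hc])) with h' | h'
      · exact Or.inl h'
      · exact Or.inr (by exact_mod_cast h')

variable [DecidableEq E]

/-- Gauss–Jordan elimination. The pivots have to be treated one after the other: reducing a single
vector by the others need not terminate over `ℝ ∪ {∞}`. -/
theorem IsBase.exists_reduced (hL : IsElim A L) {B : Finset E} (hB : IsBase A L B)
    (A' : Finset E) (hA' : A' ⊆ A \ B) :
    ∃ F : E → E → WithTop ℝ, ∀ d ∈ A \ B, F d ∈ L ∧ d ∈ minSet (F d) ∧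
      minSet (F d) ⊆ insert d (B : Set E) ∧ ∀ d' ∈ A', d' ≠ d → F d d' = ⊤ := by
  induction A' using Finset.induction_on with
  | empty =>
    have : ∀ d, ∃ f : E → WithTop ℝ, d ∈ A \ B →
        f ∈ L ∧ d ∈ minSet f ∧ minSet f ⊆ insert d (B : Set E) := by
      intro d
      by_cases hd : d ∈ A \ B
      · rw [Finset.mem_sdiff] at hd
        obtain ⟨f, h⟩ := hB.2.2 d hd.1 hd.2
        exact ⟨f, fun _ => h⟩
      · exact ⟨fun _ => ⊤, fun h => absurd h hd⟩
    choose F hF using this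
    exact ⟨F, fun d hd => ⟨(hF d hd).1, (hF d hd).2.1, (hF d hd).2.2, by simp⟩⟩
  | insert p A' hp ih =>
    have hpA : p ∈ A \ B := hA' (Finset.mem_insert_self _ _)
    obtain ⟨F, hF⟩ := ih ((Finset.subset_insert _ _).trans hA')
    have hpB : p ∉ B := (Finset.mem_sdiff.1 hpA).2
    have : ∀ d, ∃ f : E → WithTop ℝ, d ∈ A \ B →
        f ∈ L ∧ d ∈ minSet f ∧ minSet f ⊆ insert d (B : Set E) ∧
          ∀ d' ∈ insert p A', d' ≠ d → f d' = ⊤ := by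
      intro d
      by_cases hd : d ∈ A \ B
      swap
      · exact ⟨fun _ => ⊤, fun h => absurd h hd⟩
      obtain ⟨h1, h2, h3, h4⟩ := hF d hd
      by_cases hdp : p = d
      · refine ⟨F d, fun _ => ⟨h1, h2, h3, fun d' hd' hne => ?_⟩⟩
        rcases Finset.mem_insert.1 hd' with rfl | h
        · exact absurd hdp hne
        · exact h4 d' h hne
      by_cases htop : F d p = ⊤
      · refine ⟨F d, fun _ => ⟨h1, h2, h3, fun d' hd' hne => ?_⟩⟩
        rcases Finset.mem_insert.1 hd' with rfl | h
        · exact htop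
        · exact h4 d' h hne
      have hpf : p ∉ minSet (F d) := fun hc => by
        rcases h3 hc with h | h
        · exact hdp h
        · exact hpB (by exact_mod_cast h)
      obtain ⟨h, hh, hm, hhp, hw⟩ :=
        hL.elim_above h1 (hF p hpA).1 h2 (hF p hpA).2.1 hpf htop
      refine ⟨h, fun _ => ⟨hh, hm ▸ h2, hm ▸ h3, fun d' hd' hne => ?_⟩⟩
      rcases Finset.mem_insert.1 hd' with rfl | h'
      · exact hhp
      · exact hw d' (h4 d' h' hne) ((hF p hpA).2.2.2 d' h' fun hc => hp (hc ▸ h'))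
    choose F' hF' using this
    exact ⟨F', hF'⟩

theorem IsBase.isSuppBase (hL : IsElim A L) {B : Finset E} (hB : IsBase A L B) :
    IsSuppBase A L B := by
  refine ⟨hB.1, fun f hf u hu => ?_, fun e he heB => ?_⟩
  · obtain ⟨v, hv, hvB⟩ := Set.not_subset.1 (hB.2.1 f hf (hL.minSet_nonempty hf hu))
    exact ⟨v, hv.1, by exact_mod_cast hvB⟩
  · obtain ⟨F, hF⟩ := hB.exists_reduced hL (A \ B) subset_rfl
    obtain ⟨h1, h2, h3, h4⟩ := hF e (Finset.mem_sdiff.2 ⟨he, heB⟩)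
    obtain ⟨g, hg, hge, r, hr⟩ := exists_scale_eq hL h1 h2.1 WithTop.zero_ne_top
    refine ⟨g, hg, hge, fun v hv => ?_⟩
    have hv' : F e v ≠ ⊤ := fun hc => hv (by rw [hr, hc, top_add])
    by_contra hcon
    rw [not_or] at hcon
    exact hv' (h4 v (Finset.mem_sdiff.2 ⟨hL.supp _ h1 v hv', hcon.2⟩) hcon.1)

theorem IsBase.isSuppBase_of_translate (hL : IsElim A L) {B : Finset E} {x : E → ℝ}
    (hB : IsBase A (translate L x) B) : IsSuppBase A L B := by
  obtain ⟨h1, h2, h3⟩ := hB.isSuppBase (hL.isElim_translate x)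
  refine ⟨h1, fun f hf u hu => ?_, fun e he heB => ?_⟩
  · obtain ⟨v, hv, hvB⟩ := h2 _ ⟨f, hf, rfl⟩ u (by simp [hu])
    exact ⟨v, fun hc => hv (by simp [hc]), hvB⟩
  · obtain ⟨g, ⟨f, hf, hfg⟩, hge, hgs⟩ := h3 e he heB
    have hfv : ∀ v, f v ≠ ⊤ → v = e ∨ v ∈ B := fun v hv => hgs v (by simp [hfg, hv])
    have hfe : f e ≠ ⊤ := fun hc => by simp [hfg, hc] at hge
    obtain ⟨k, hk, hke, r, hr⟩ := exists_scale_eq hL hf hfe WithTop.zero_ne_top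
    exact ⟨k, hk, hke, fun v hv => hfv v fun hc => hv (by rw [hr, hc, top_add])⟩

theorem IsSuppBase.eq_of_subset {B C : Finset E} (hB : IsSuppBase A L B)
    (hC : IsSuppBase A L C) (h : B ⊆ C) : B = C := by
  refine h.antisymm fun e he => ?_
  by_contra heB
  obtain ⟨g, hg, hge, hgs⟩ := hB.exists_fund e (hC.subset he) heB
  obtain ⟨v, hv, hvC⟩ := hC.indep g hg e (by simp [hge])
  rcases hgs v hv with rfl | h'
  · exact hvC he
  · exact hvC (h h')

/-- An inequality of the polyhedron of `B` is tight if and only if the corresponding exchange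
leads to a base. -/
theorem IsBase.exchange_iff (hL : IsElim A L) {B : Finset E} {x : E → ℝ}
    (hB : IsBase A (translate L x) B) {e b : E} (heB : e ∉ B) (hb : b ∈ B)
    {g : E → WithTop ℝ} (hg : IsFundVec L B e g) :
    IsBase A (translate L x) (insert e (B.erase b)) ↔ ∃ c : ℝ, g b = c ∧ x e = c + x b := by
  classical
  set k : E → WithTop ℝ := fun u => g u + (x u : WithTop ℝ) with hk
  have hkL : k ∈ translate L x := ⟨g, hg.mem, rfl⟩
  have hke : k e = (x e : WithTop ℝ) := by simp [hk, hg.apply_self]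
  have hsub : minSet k ⊆ insert e (B : Set E) := by
    intro v hv
    rcases hg.supp v (fun hc => hv.1 (by simp [hk, hc])) with h' | h'
    · exact Or.inl h'
    · exact Or.inr (by exact_mod_cast h')
  have hne : (minSet k).Nonempty := (hL.isElim_translate x).minSet_nonempty hkL (u := e)
    (by simp [hke])
  have hemin : e ∈ minSet k := by
    by_contra hcon
    refine hB.2.1 k hkL hne fun v hv => (hsub hv).resolve_left fun h => hcon (h ▸ hv)
  constructor
  · intro h
    have hbmin : b ∈ minSet k := by
      by_contra hcon
      refine h.2.1 k hkL hne fun v hv => ?_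
      simp only [Finset.coe_insert, Finset.coe_erase]
      rcases hsub hv with h' | h'
      · exact Or.inl h'
      · exact Or.inr ⟨h', fun h'' => hcon (h'' ▸ hv)⟩
    have heq := eq_of_mem_minSet hemin hbmin
    obtain ⟨c, hc⟩ := WithTop.ne_top_iff_exists.1 (fun hc : g b = ⊤ => hbmin.1 (by simp [hk, hc]))
    refine ⟨c, hc.symm, ?_⟩
    rw [hke] at heq
    simp only [hk, ← hc] at heq
    exact_mod_cast heq
  · rintro ⟨c, hc, hx⟩
    refine hB.exchange (hL.isElim_translate x) heB hb hkL hemin (mem_minSet_of_le hemin ?_) hsub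
    rw [hke, hx]
    simp [hk, hc]

/-- The set of `x` for which `B` is a base at `x` is convex. -/
theorem IsBase.segment (hL : IsElim A L) {B : Finset E} {x y : E → ℝ}
    (hx : IsBase A (translate L x) B) (hy : IsBase A (translate L y) B) {t : ℝ} (h0 : 0 ≤ t)
    (h1 : t ≤ 1) : IsBase A (translate L (x + t • (y - x))) B := by
  have hB := hx.isSuppBase_of_translate hL
  obtain ⟨g, hg⟩ := exists_fund_of_isSuppBase B hB
  rw [isBase_translate_iff hL hB hg] at hx hy ⊢
  intro e he heB b hb c hc
  have h2 := hx e he heB b hb c hc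
  have h3 := hy e he heB b hb c hc
  simp only [Pi.add_apply, Pi.smul_apply, Pi.sub_apply, smul_eq_mul]
  nlinarith [mul_le_mul_of_nonneg_left h3 h0, mul_le_mul_of_nonneg_left h2 (sub_nonneg.2 h1)]

/-- If a base `B` at `x` is still a base at `y`, then it has maximal weight with respect to
`y - x` among the bases at `x`. -/
theorem IsBase.sum_sub_le (hL : IsElim A L) {B C : Finset E} {x y : E → ℝ}
    (hBx : IsBase A (translate L x) B) (hBy : IsBase A (translate L y) B)
    (hCx : IsBase A (translate L x) C) :
    ∑ u ∈ C, (y u - x u) ≤ ∑ u ∈ B, (y u - x u) := by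
  refine hBx.sum_le_of_local_max (hL.isElim_translate x) hCx (fun u => y u - x u)
    fun e heB b hb hex => ?_
  have hB := hBx.isSuppBase_of_translate hL
  obtain ⟨g, hg⟩ := exists_fund_of_isSuppBase B hB
  have he : e ∈ A := hex.1 (Finset.mem_insert_self _ _)
  obtain ⟨c, hc, hxe⟩ := (hBx.exchange_iff hL heB hb (hg e he heB)).1 hex
  have := (isBase_translate_iff hL hB hg y).1 hBy e he heB b hb c hc
  linarith

/-- Conversely, a base at `x` that has the same weight with respect to `y - x` as a base that is
common to `x` and `y` is a base at `y`: it stays a base along the whole segment. -/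
theorem IsBase.of_sum_sub_eq (hL : IsElim A L) {B C : Finset E} {x y : E → ℝ}
    (hBx : IsBase A (translate L x) B) (hBy : IsBase A (translate L y) B)
    (hCx : IsBase A (translate L x) C)
    (heq : ∑ u ∈ C, (y u - x u) = ∑ u ∈ B, (y u - x u)) : IsBase A (translate L y) C := by
  have hC := hCx.isSuppBase_of_translate hL
  obtain ⟨g, hg⟩ := exists_fund_of_isSuppBase C hC
  set p : ℝ → E → ℝ := fun t => x + t • (y - x) with hp
  have hpe : ∀ t u, p t u = x u + t * (y u - x u) := fun t u => rfl
  let s : Set ℝ := {t | IsBase A (translate L (p t)) C}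
  have hs : s = {t | ∀ e ∈ A, e ∉ C → ∀ b ∈ C, ∀ c : ℝ, g e b = c → p t e ≤ c + p t b} := by
    ext t
    exact isBase_translate_iff hL hC hg (p t)
  have hclosed : IsClosed s := by
    rw [hs]
    simp only [Set.ofPred_forall, hpe]
    refine isClosed_iInter fun e => isClosed_iInter fun _ => isClosed_iInter fun _ =>
      isClosed_iInter fun b => isClosed_iInter fun _ => isClosed_iInter fun c =>
      isClosed_iInter fun _ => isClosed_le (by fun_prop) (by fun_prop)
  have hsub : Set.Icc (0 : ℝ) 1 ⊆ s := by
    refine (hclosed.inter isClosed_Icc).Icc_subset_of_forall_exists_gt ?_ ?_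
    · change IsBase A (translate L (p 0)) C
      simpa [hp] using hCx
    rintro t ⟨hts, ht0, ht1⟩ t' ht'
    have hBt : IsBase A (translate L (p t)) B := hBx.segment hL hBy ht0 ht1.le
    have hev : ∀ᶠ t₁ in nhdsWithin t (Set.Ioi t), t₁ ∈ s := by
      have : ∀ᶠ t₁ in nhdsWithin t (Set.Ioi t), ∀ e ∈ A, ∀ b ∈ A, e ∉ C → b ∈ C →
          ∀ c : ℝ, g e b = c → p t₁ e ≤ c + p t₁ b := by
        rw [Filter.eventually_all_finset]
        intro e he
        rw [Filter.eventually_all_finset]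
        intro b _
        by_cases hcase : e ∉ C ∧ b ∈ C ∧ g e b ≠ ⊤
        swap
        · refine Filter.Eventually.of_forall fun t₁ h1 h2 c hc => ?_
          exact absurd ⟨h1, h2, by simp [hc]⟩ hcase
        obtain ⟨heC, hbC, htop⟩ := hcase
        obtain ⟨c, hc⟩ := WithTop.ne_top_iff_exists.1 htop
        have hle := (isBase_translate_iff hL hC hg (p t)).1 hts e he heC b hbC c hc.symm
        rcases hle.eq_or_lt with heq' | hlt
        · have hex := (IsBase.exchange_iff hL hts heC hbC (hg e he heC)).2
            ⟨c, hc.symm, heq'⟩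
          have hsum := hBt.sum_sub_le hL hBy hex
          have hδ : ∀ u, y u - p t u = (1 - t) * (y u - x u) := fun u => by rw [hpe]; ring
          simp only [hδ, ← Finset.mul_sum] at hsum
          rw [← heq, mul_le_mul_iff_right₀ (by linarith), Finset.sum_insert (by simp [heC])] at hsum
          have herase := Finset.add_sum_erase C (fun u => y u - x u) hbC
          filter_upwards [self_mem_nhdsWithin] with t₁ ht₁ _ _ c' hc'
          have : c' = c := by rw [← hc] at hc'; exact_mod_cast hc'.symm
          subst this
          have h1 : y e - x e ≤ y b - x b := by linarith
          rw [hpe, hpe] at heq' ⊢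
          nlinarith [Set.mem_Ioi.1 ht₁]
        · have : ∀ᶠ t₁ in nhdsWithin t (Set.Ioi t), p t₁ e < c + p t₁ b := by
            refine Filter.Eventually.filter_mono nhdsWithin_le_nhds ?_
            refine ContinuousAt.eventually_lt ?_ ?_ hlt
            · simp only [hpe]; fun_prop
            · simp only [hpe]; fun_prop
          filter_upwards [this] with t₁ ht₁ _ _ c' hc'
          have : c' = c := by rw [← hc] at hc'; exact_mod_cast hc'.symm
          subst this
          exact ht₁.le
      filter_upwards [this] with t₁ ht₁
      rw [hs]
      exact fun e he heC b hb c hc => ht₁ e he b (hC.subset hb) heC hb c hc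
    obtain ⟨t₁, h1, h2⟩ := (hev.and (Ioc_mem_nhdsGT ht')).exists
    exact ⟨t₁, h1, h2⟩
  have := hsub (Set.right_mem_Icc.2 zero_le_one)
  simpa [s, hp] using this

/-- A system without vectors of singleton support has a real point `z` at which no vector of the
system attains its minimum only once. -/
theorem IsElim.exists_no_loop (hL : IsElim A L)
    (h : ∀ f ∈ L, ∀ u, f u ≠ ⊤ → ∃ v, v ≠ u ∧ f v ≠ ⊤) :
    ∃ z : E → ℝ, ∀ f ∈ translate L z, ∀ u ∈ minSet f, ∃ v ∈ minSet f, v ≠ u := by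
  obtain ⟨B, hB0⟩ := exists_isBase A L
  have hB := hB0.isSuppBase hL
  obtain ⟨g, hg⟩ := exists_fund_of_isSuppBase B hB
  -- `z` vanishes on `B`, and it is the minimum of the fundamental vector of `e` elsewhere
  have hz : ∀ e, ∃ r : ℝ, (e ∈ B → r = 0) ∧ (e ∈ A → e ∉ B →
      ∃ b ∈ B, g e b = r ∧ ∀ b' ∈ B, (r : WithTop ℝ) ≤ g e b') := by
    intro e
    by_cases heB : e ∈ B
    · exact ⟨0, fun _ => rfl, fun _ hc => absurd heB hc⟩
    by_cases he : e ∈ A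
    swap
    · exact ⟨0, fun _ => rfl, fun hc => absurd hc he⟩
    have hf := hg e he heB
    obtain ⟨v, hve, hv⟩ := h (g e) hf.mem e (by simp [hf.apply_self])
    have hvB : v ∈ B := (hf.supp v hv).resolve_left hve
    obtain ⟨b, hb, hmin⟩ := B.exists_min_image (g e) ⟨v, hvB⟩
    have hbt : g e b ≠ ⊤ := fun hc => hv (top_le_iff.1 (hc ▸ hmin v hvB))
    obtain ⟨r, hr⟩ := WithTop.ne_top_iff_exists.1 hbt
    exact ⟨r, fun hc => absurd hc heB, fun _ _ => ⟨b, hb, hr.symm, fun b' hb' => hr ▸ hmin b' hb'⟩⟩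
  choose z hz0 hz1 using hz
  refine ⟨z, fun f hf u hu => ?_⟩
  have hBz : IsBase A (translate L z) B := by
    rw [isBase_translate_iff hL hB hg]
    intro e he heB b hb c hc
    obtain ⟨b', hb', _, hmin⟩ := hz1 e he heB
    have := hmin b hb
    rw [hc] at this
    rw [hz0 b hb, add_zero]
    exact_mod_cast this
  by_contra hcon
  push Not at hcon
  have huA : u ∈ A := (hL.isElim_translate z).minSet_subset hf hu
  have huB : u ∉ B := fun hc => hBz.2.1 f hf ⟨u, hu⟩ fun v hv => by
    rw [hcon v hv]; exact_mod_cast hc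
  obtain ⟨b, hb, hbu, -⟩ := hz1 u huA huB
  have hex := (hBz.exchange_iff hL huB hb (hg u huA huB)).2
    ⟨z u, hbu, by rw [hz0 b hb, add_zero]⟩
  refine hex.2.1 f hf ⟨u, hu⟩ fun v hv => ?_
  rw [hcon v hv]
  simp

end SupportBase

/-! ### The cells of a truncated system form a polyhedral complex -/

section Cells

variable {σ : Type*} [Fintype σ]

/-- The pairing `u · w` of an exponent vector with a weight vector. -/
noncomputable def dot (w : σ → ℝ) (u : σ →₀ ℕ) : ℝ := ∑ i, (u i : ℝ) * w i

theorem dot_add (w v : σ → ℝ) (u : σ →₀ ℕ) : dot (w + v) u = dot w u + dot v u := by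
  simp [dot, mul_add, Finset.sum_add_distrib]

theorem dot_smul (t : ℝ) (w : σ → ℝ) (u : σ →₀ ℕ) : dot (t • w) u = t * dot w u := by
  simp only [dot, Finset.mul_sum, Pi.smul_apply, smul_eq_mul]
  exact Finset.sum_congr rfl fun i _ => by ring

theorem dot_sub (w v : σ → ℝ) (u : σ →₀ ℕ) : dot (w - v) u = dot w u - dot v u := by
  simp [dot, mul_sub, Finset.sum_sub_distrib]

theorem dot_zero_left (u : σ →₀ ℕ) : dot (0 : σ → ℝ) u = 0 := by
  simp [dot]

theorem dot_add_right (w : σ → ℝ) (u v : σ →₀ ℕ) : dot w (u + v) = dot w u + dot w v := by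
  simp [dot, add_mul, Finset.sum_add_distrib]

theorem dot_neg (w : σ → ℝ) (u : σ →₀ ℕ) : dot (-w) u = -dot w u := by
  simp [dot]

/-- The total weight `∑_{u ∈ B} u · w`, as a linear function of `w`. -/
noncomputable def weight (B : Finset (σ →₀ ℕ)) : (σ → ℝ) →ₗ[ℝ] ℝ where
  toFun w := ∑ u ∈ B, dot w u
  map_add' w v := by simp only [dot_add, Finset.sum_add_distrib]
  map_smul' t w := by simp only [dot_smul, Finset.mul_sum, RingHom.id_apply, smul_eq_mul]

theorem weight_sub (B : Finset (σ →₀ ℕ)) (w v : σ → ℝ) :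
    ∑ u ∈ B, (dot w u - dot v u) = weight B w - weight B v := by
  simp [weight, Finset.sum_sub_distrib]

variable (A : Finset (σ →₀ ℕ)) (L : Set ((σ →₀ ℕ) → WithTop ℝ))

/-- The set of bases at the weight vector `w`. -/
def bases (w : σ → ℝ) : Set (Finset (σ →₀ ℕ)) := {B | IsBase A (translate L (dot w)) B}

/-- The set of the weight vectors `w'` for which all bases at `w` are bases at `w'`. -/
def cell (w : σ → ℝ) : Set (σ → ℝ) := {w' | bases A L w ⊆ bases A L w'}

variable {A L}

theorem bases_finite (w : σ → ℝ) : (bases A L w).Finite :=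
  A.powerset.finite_toSet.subset fun _ hB => Finset.mem_coe.2 (Finset.mem_powerset.2 hB.1)

theorem bases_nonempty (w : σ → ℝ) : (bases A L w).Nonempty :=
  exists_isBase A (translate L (dot w))

theorem mem_cell_self (w : σ → ℝ) : w ∈ cell A L w := fun _ h => h

theorem cell_subset_of_mem {w v : σ → ℝ} (h : v ∈ cell A L w) : cell A L v ⊆ cell A L w :=
  fun _ hx _ hB => hx (h hB)

theorem cell_finite : (Set.range (cell A L)).Finite := by
  have : Set.range (cell A L) ⊆ (fun S => {w' | S ⊆ bases A L w'}) '' (𝒫 (A.powerset : Set _)) := by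
    rintro _ ⟨w, rfl⟩
    exact ⟨bases A L w, fun _ hB => Finset.mem_coe.2 (Finset.mem_powerset.2 hB.1), rfl⟩
  exact ((Finset.finite_toSet _).powerset.image _).subset this

theorem isRRationalPolyhedron_of_fintype {κ : Type*} [Fintype κ] (a : κ → σ → ℤ) (β : κ → ℝ) :
    IsRRationalPolyhedron {x : σ → ℝ | ∀ k, ∑ i, (a k i : ℝ) * x i ≤ β k} := by
  refine ⟨Fintype.card κ, fun j => a ((Fintype.equivFin κ).symm j),
    fun j => β ((Fintype.equivFin κ).symm j), ?_⟩
  ext x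
  exact ⟨fun h j => h _, fun h k => by simpa using h (Fintype.equivFin κ k)⟩

theorem IsRRationalPolyhedron.isPolyhedron {P : Set (σ → ℝ)} (h : IsRRationalPolyhedron P) :
    IsPolyhedron P := by
  obtain ⟨m, a, b, rfl⟩ := h
  exact ⟨m, fun j i => a j i, b, rfl⟩

theorem IsPolyhedron.isClosed {P : Set (σ → ℝ)} (h : IsPolyhedron P) : IsClosed P := by
  obtain ⟨m, a, b, rfl⟩ := h
  simp only [Set.ofPred_forall]
  exact isClosed_iInter fun j => isClosed_le (by fun_prop) (by fun_prop)

theorem mem_bases_iff (hL : IsElim A L) {B : Finset (σ →₀ ℕ)} (hB : IsSuppBase A L B)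
    {g : (σ →₀ ℕ) → (σ →₀ ℕ) → WithTop ℝ} (hg : ∀ e ∈ A, e ∉ B → IsFundVec L B e (g e))
    (w : σ → ℝ) :
    B ∈ bases A L w ↔ ∀ e ∈ A, e ∉ B → ∀ b ∈ B, ∀ c : ℝ, g e b = c → dot w e ≤ c + dot w b :=
  isBase_translate_iff hL hB hg (dot w)

theorem dot_add_smul_sub (x y : σ → ℝ) (t : ℝ) :
    dot (x + t • (y - x)) = dot x + t • (dot y - dot x) := by
  funext u
  simp only [dot_add, dot_smul, dot_sub, Pi.add_apply, Pi.smul_apply, Pi.sub_apply, smul_eq_mul]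

variable [DecidableEq σ]

theorem isRRationalPolyhedron_cell (hL : IsElim A L) (w : σ → ℝ) :
    IsRRationalPolyhedron (cell A L w) := by
  classical
  obtain ⟨G, hG⟩ := exists_fund A L
  have hS : ∀ B ∈ bases A L w, IsSuppBase A L B :=
    fun B hB => IsBase.isSuppBase_of_translate hL hB
  -- the inequalities are indexed by a base, an element outside and an element inside
  let κ := (A.powerset ×ˢ A ×ˢ A : Finset _)
  let good : κ → Prop := fun k => k.1.1 ∈ bases A L w ∧ k.1.2.1 ∉ k.1.1 ∧ k.1.2.2 ∈ k.1.1 ∧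
    G k.1.1 k.1.2.1 k.1.2.2 ≠ ⊤
  let a : κ → σ → ℤ := fun k i => if good k then (k.1.2.1 i : ℤ) - (k.1.2.2 i : ℤ) else 0
  let β : κ → ℝ := fun k => if good k then (G k.1.1 k.1.2.1 k.1.2.2).untopD 0 else 0
  convert isRRationalPolyhedron_of_fintype a β using 1
  have hrow : ∀ k : κ, good k → ∀ x : σ → ℝ,
      ∑ i, (a k i : ℝ) * x i = dot x k.1.2.1 - dot x k.1.2.2 := by
    intro k hk x
    simp [a, hk, dot, sub_mul, Finset.sum_sub_distrib]
  ext x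
  simp only [Set.mem_ofPred_eq]
  constructor
  · intro hx k
    by_cases hk : good k
    · rw [hrow k hk]
      obtain ⟨c, hc⟩ := WithTop.ne_top_iff_exists.1 hk.2.2.2
      have hkA := Finset.mem_product.1 (Finset.mem_product.1 k.2).2
      have := (mem_bases_iff hL (hS _ hk.1) (hG _ (hS _ hk.1)) x).1 (hx hk.1) _ hkA.1 hk.2.1 _
        hk.2.2.1 c hc.symm
      simp only [β, hk, if_true, ← hc, WithTop.untopD_coe]
      linarith
    · simp [a, β, hk]
  · intro hx B hB
    rw [mem_bases_iff hL (hS _ hB) (hG _ (hS _ hB))]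
    intro e he heB b hb c hc
    have hbA := (hS _ hB).subset hb
    let k : κ := ⟨(B, e, b), Finset.mem_product.2 ⟨Finset.mem_powerset.2 (hS _ hB).subset,
      Finset.mem_product.2 ⟨he, hbA⟩⟩⟩
    have hk : good k := ⟨hB, heB, hb, by simp [k, hc]⟩
    have := hx k
    rw [hrow k hk] at this
    simp only [β, hk, if_true, k, hc, WithTop.untopD_coe] at this
    linarith

theorem isClosed_cell (hL : IsElim A L) (w : σ → ℝ) : IsClosed (cell A L w) :=
  (isRRationalPolyhedron_cell hL w).isPolyhedron.isClosed

theorem mem_bases_segment (hL : IsElim A L) {B : Finset (σ →₀ ℕ)} {x y : σ → ℝ}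
    (hx : B ∈ bases A L x) (hy : B ∈ bases A L y) {t : ℝ} (h0 : 0 ≤ t) (h1 : t ≤ 1) :
    B ∈ bases A L (x + t • (y - x)) := by
  have := IsBase.segment hL hx hy h0 h1
  rwa [← dot_add_smul_sub] at this

/-- If `x` and `y` have a common base, then the bases at the points between `x` and `y` are the
common bases of `x` and `y`. -/
theorem bases_segment (hL : IsElim A L) {B : Finset (σ →₀ ℕ)} {x y : σ → ℝ}
    (hx : B ∈ bases A L x) (hy : B ∈ bases A L y) {t : ℝ} (h0 : 0 < t) (h1 : t < 1) :
    bases A L (x + t • (y - x)) = bases A L x ∩ bases A L y := by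
  refine Set.Subset.antisymm (fun C hC => ?_) fun C hC =>
    mem_bases_segment hL hC.1 hC.2 h0.le h1.le
  set z := x + t • (y - x) with hz
  have hBz : B ∈ bases A L z := mem_bases_segment hL hx hy h0.le h1.le
  have h2 := IsBase.sum_sub_le hL hBz hx hC
  have h3 := IsBase.sum_sub_le hL hBz hy hC
  have hw : ∀ D : Finset (σ →₀ ℕ), weight D z = weight D x + t * (weight D y - weight D x) := by
    intro D; simp [hz]
  have heq : weight C x - weight C y = weight B x - weight B y := by
    simp only [weight_sub, hw] at h2 h3
    nlinarith
  refine ⟨IsBase.of_sum_sub_eq hL hBz hx hC ?_, IsBase.of_sum_sub_eq hL hBz hy hC ?_⟩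
  · simp only [weight_sub, hw]
    linear_combination t * heq
  · simp only [weight_sub, hw]
    linear_combination (-(1 - t)) * heq

theorem closure_bases_eq (hL : IsElim A L) (w : σ → ℝ) :
    closure {w' | bases A L w' = bases A L w} = cell A L w := by
  refine Set.Subset.antisymm (closure_minimal (fun w' h => ?_) (isClosed_cell hL w))
    fun y hy => ?_
  · exact (show bases A L w' = bases A L w from h).ge
  · obtain ⟨B, hB⟩ := bases_nonempty (A := A) (L := L) w
    have hcont : Continuous fun t : ℝ => y + t • (w - y) := by fun_prop
    have h0 : (0 : ℝ) ∈ closure (Set.Ioo (0 : ℝ) 1) := by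
      rw [closure_Ioo zero_ne_one]
      exact Set.left_mem_Icc.2 zero_le_one
    have := map_mem_closure hcont h0 (t := {w' | bases A L w' = bases A L w}) fun t ht => by
      change bases A L (y + t • (w - y)) = bases A L w
      rw [bases_segment hL (hy hB) hB ht.1 ht.2]
      exact Set.inter_eq_self_of_subset_right hy
    simpa using this

/-- A convex set that lies in one region has a point with a smallest set of bases. -/
theorem exists_bases_subset (hL : IsElim A L) {F : Set (σ → ℝ)} (hF : Convex ℝ F)
    (hne : F.Nonempty) {B : Finset (σ →₀ ℕ)} (hB : ∀ x ∈ F, B ∈ bases A L x) :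
    ∃ x ∈ F, ∀ y ∈ F, bases A L x ⊆ bases A L y := by
  let s : Set ℕ := (fun x => (bases A L x).ncard) '' F
  obtain ⟨x, hx, hmin⟩ := Nat.sInf_mem (s := s) (hne.image _)
  refine ⟨x, hx, fun y hy => ?_⟩
  have hz : x + (1 / 2 : ℝ) • (y - x) ∈ F :=
    hF.add_smul_sub_mem hx hy ⟨by norm_num, by norm_num⟩
  have hbz := bases_segment hL (hB x hx) (hB y hy) (t := 1 / 2) (by norm_num) (by norm_num)
  have hle : (bases A L x).ncard ≤ (bases A L x ∩ bases A L y).ncard := by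
    rw [← hbz]
    refine le_of_eq_of_le hmin (Nat.sInf_le ⟨_, hz, rfl⟩)
  have := Set.eq_of_subset_of_ncard_le Set.inter_subset_left hle (bases_finite x)
  exact Set.inter_eq_left.1 this

/-- A segment from a point `y` to a point `x` all of whose bases are bases at `y` can be prolonged
beyond `x` without losing bases. -/
theorem exists_prolong (hL : IsElim A L) {x y : σ → ℝ} (h : bases A L x ⊆ bases A L y) :
    ∃ ε : ℝ, 0 < ε ∧ bases A L x ⊆ bases A L (x + ε • (x - y)) := by
  obtain ⟨G, hG⟩ := exists_fund A L
  have hS : ∀ B ∈ bases A L x, IsSuppBase A L B :=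
    fun B hB => IsBase.isSuppBase_of_translate hL hB
  have hev : ∀ᶠ ε : ℝ in nhdsWithin 0 (Set.Ioi 0), ∀ B ∈ bases A L x,
      ∀ e ∈ A, ∀ b ∈ A, e ∉ B → b ∈ B → ∀ c : ℝ, G B e b = c →
        dot (x + ε • (x - y)) e ≤ c + dot (x + ε • (x - y)) b := by
    rw [Filter.eventually_all_finite (bases_finite x)]
    intro B hB
    rw [Filter.eventually_all_finset]
    intro e he
    rw [Filter.eventually_all_finset]
    intro b _
    by_cases hcase : e ∉ B ∧ b ∈ B ∧ G B e b ≠ ⊤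
    swap
    · exact Filter.Eventually.of_forall fun ε h1 h2 c hc =>
        absurd ⟨h1, h2, by simp [hc]⟩ hcase
    obtain ⟨heB, hb, htop⟩ := hcase
    obtain ⟨c, hc⟩ := WithTop.ne_top_iff_exists.1 htop
    have hle := (mem_bases_iff hL (hS B hB) (hG B (hS B hB)) x).1 hB e he heB b hb c hc.symm
    rcases hle.eq_or_lt with heq | hlt
    · have hex := (IsBase.exchange_iff hL hB heB hb (hG B (hS B hB) e he heB)).2
        ⟨c, hc.symm, heq⟩
      obtain ⟨c', hc', heq'⟩ :=
        (IsBase.exchange_iff hL (h hB) heB hb (hG B (hS B hB) e he heB)).1 (h hex)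
      have hcc : c' = c := by rw [← hc] at hc'; exact_mod_cast hc'.symm
      subst hcc
      refine Filter.Eventually.of_forall fun ε _ _ c₁ hc₁ => ?_
      have hcc : c₁ = c' := by rw [← hc] at hc₁; exact_mod_cast hc₁.symm
      subst hcc
      simp only [dot_add, dot_smul, dot_sub]
      rw [heq, heq']
      apply le_of_eq
      ring
    · have : ∀ᶠ ε : ℝ in nhdsWithin 0 (Set.Ioi 0),
          dot (x + ε • (x - y)) e < c + dot (x + ε • (x - y)) b := by
        refine Filter.Eventually.filter_mono nhdsWithin_le_nhds ?_
        simp only [dot_add, dot_smul]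
        refine ContinuousAt.eventually_lt (by fun_prop) (by fun_prop) ?_
        simpa using hlt
      filter_upwards [this] with ε hε _ _ c₁ hc₁
      have hcc : c₁ = c := by rw [← hc] at hc₁; exact_mod_cast hc₁.symm
      subst hcc
      exact hε.le
  obtain ⟨ε, hε, hpos⟩ := (hev.and self_mem_nhdsWithin).exists
  refine ⟨ε, hpos, fun B hB => ?_⟩
  rw [mem_bases_iff hL (hS B hB) (hG B (hS B hB))]
  exact fun e he heB b hb c hc => hε B hB e he b ((hS B hB).subset hb) heB hb c hc

theorem isExposed_cell_inter (hL : IsElim A L) (a b : σ → ℝ) :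
    IsExposed ℝ (cell A L a) (cell A L a ∩ cell A L b) := by
  rintro ⟨x, hxa, hxb⟩
  obtain ⟨B, hB⟩ := bases_nonempty (A := A) (L := L) a
  -- the face is cut out by the sum of the weight differences of the bases at `b` and of `B`
  let l : (σ → ℝ) →ₗ[ℝ] ℝ := ∑ C ∈ (bases_finite (A := A) (L := L) b).toFinset,
    (weight C - weight B)
  have hl : ∀ y, l y = ∑ C ∈ (bases_finite (A := A) (L := L) b).toFinset,
      (weight C y - weight B y) := fun y => by simp [l]
  have hle : ∀ y ∈ cell A L a, ∀ x ∈ cell A L a ∩ cell A L b, ∀ C ∈ bases A L b,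
      weight C y - weight B y ≤ weight C x - weight B x := by
    intro y hy x hx C hC
    have := IsBase.sum_sub_le hL (hx.1 hB) (hy hB) (hx.2 hC)
    simp only [weight_sub] at this
    linarith
  refine ⟨LinearMap.toContinuousLinearMap l, ?_⟩
  ext y
  simp only [Set.mem_ofPred_eq, LinearMap.coe_toContinuousLinearMap', hl]
  constructor
  · intro hy
    refine ⟨hy.1, fun y' hy' => Finset.sum_le_sum fun C hC => ?_⟩
    exact hle y' hy' y hy C (by simpa using hC)
  · rintro ⟨hy, hmax⟩
    refine ⟨hy, fun C hC => ?_⟩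
    have heq := (Finset.sum_eq_sum_iff_of_le fun C hC =>
      hle y hy x ⟨hxa, hxb⟩ C (by simpa using hC)).1 (le_antisymm
        (Finset.sum_le_sum fun C hC => hle y hy x ⟨hxa, hxb⟩ C (by simpa using hC)) (hmax x hxa))
      C (by simpa using hC)
    refine IsBase.of_sum_sub_eq hL (hxa hB) (hy hB) (hxb hC) ?_
    simp only [weight_sub]
    linarith

theorem isPolyhedralComplex_range_cell (hL : IsElim A L) :
    IsPolyhedralComplex (Set.range (cell A L)) where
  finite := cell_finite
  polyhedron := by
    rintro _ ⟨w, rfl⟩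
    exact (isRRationalPolyhedron_cell hL w).isPolyhedron
  face_mem := by
    rintro _ ⟨w, rfl⟩ F hne hF
    obtain ⟨l, hl⟩ := hF hne
    obtain ⟨B, hB⟩ := bases_nonempty (A := A) (L := L) w
    have hsub : F ⊆ cell A L w := by rw [hl]; exact fun x hx => hx.1
    have hconv : Convex ℝ F := by
      have hc : Convex ℝ (cell A L w) := by
        obtain ⟨m, a, b, h⟩ := (isRRationalPolyhedron_cell hL w).isPolyhedron
        rw [h]
        intro x hx y hy s t hs ht hst j
        have h1 := mul_le_mul_of_nonneg_left (hx j) hs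
        have h2 := mul_le_mul_of_nonneg_left (hy j) ht
        have : ∑ i, a j i * (s • x + t • y) i =
            s * ∑ i, a j i * x i + t * ∑ i, a j i * y i := by
          simp only [Finset.mul_sum, ← Finset.sum_add_distrib, Pi.add_apply, Pi.smul_apply,
            smul_eq_mul]
          exact Finset.sum_congr rfl fun i _ => by ring
        rw [this]
        calc _ ≤ s * b j + t * b j := add_le_add h1 h2
          _ = b j := by rw [← add_mul, hst, one_mul]
      exact hF.convex hc
    obtain ⟨x, hx, hmin⟩ := exists_bases_subset hL hconv hne fun y hy => hsub hy hB
    refine ⟨x, Set.Subset.antisymm (fun y hy => ?_) fun y hy => hmin y hy⟩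
    have hxw := hsub hx
    obtain ⟨ε, hε, hpro⟩ := exists_prolong hL hy
    rw [hl] at hx ⊢
    have h1 := hx.2 _ (fun C hC => hpro (hxw hC) : x + ε • (x - y) ∈ cell A L w)
    simp only [map_add, map_smul, map_sub, smul_eq_mul] at h1
    have h2 : l x ≤ l y := by
      by_contra hcon
      nlinarith [not_le.1 hcon]
    exact ⟨cell_subset_of_mem hxw hy, fun z hz => (hx.2 z hz).trans h2⟩
  inter_face := by
    rintro _ ⟨a, rfl⟩ _ ⟨b, rfl⟩
    refine ⟨isExposed_cell_inter hL a b, ?_⟩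
    rw [Set.inter_comm]
    exact isExposed_cell_inter hL b a

end Cells

/-! ### Flattening the finite entries -/

section Trivial

variable {E : Type*}

open Classical in
/-- The vector with the support of `f` and with all finite entries equal to `r`. -/
noncomputable def flatten (f : E → WithTop ℝ) (r : ℝ) : E → WithTop ℝ :=
  fun u => if f u = ⊤ then ⊤ else (r : WithTop ℝ)

theorem flatten_eq_top {f : E → WithTop ℝ} {r : ℝ} {u : E} : flatten f r u = ⊤ ↔ f u = ⊤ := by
  unfold flatten
  split_ifs with h <;> simp [h]

theorem flatten_of_ne_top {f : E → WithTop ℝ} {u : E} (h : f u ≠ ⊤) (r : ℝ) :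
    flatten f r u = r := by
  simp [flatten, h]

/-- The trivialization of `L`: the vectors that are constant on the support of a vector of `L`. -/
def flat (L : Set (E → WithTop ℝ)) : Set (E → WithTop ℝ) :=
  {g | ∃ f ∈ L, ∃ r : ℝ, g = flatten f r}

variable {A : Finset E} {L : Set (E → WithTop ℝ)}

theorem IsElim.flat (hL : IsElim A L) : IsElim A (flat L) where
  supp := by
    rintro _ ⟨f, hf, r, rfl⟩ u hu
    exact hL.supp f hf u fun h => hu (flatten_eq_top.2 h)
  scale := by
    rintro _ ⟨f, hf, r, rfl⟩ s
    refine ⟨f, hf, r + s, funext fun u => ?_⟩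
    by_cases hu : f u = ⊤
    · rw [flatten_eq_top.2 hu, flatten_eq_top.2 hu, top_add]
    · rw [flatten_of_ne_top hu, flatten_of_ne_top hu]
      norm_cast
  elim := by
    rintro _ ⟨f, hf, r, rfl⟩ _ ⟨g, hg, s, rfl⟩ u huv hu
    have hfu : f u ≠ ⊤ := fun h => hu (flatten_eq_top.2 h)
    have hgu : g u ≠ ⊤ := fun h => hu (huv.trans (flatten_eq_top.2 h))
    have hrs : r = s := by
      rw [flatten_of_ne_top hfu, flatten_of_ne_top hgu] at huv
      exact_mod_cast huv
    subst hrs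
    obtain ⟨g', hg', hgu', t, ht⟩ := exists_scale_eq hL hg hgu hfu
    obtain ⟨h, hh, hhu, hmin⟩ := hL.elim f hf g' hg' u hgu'.symm hfu
    have htop : ∀ v, g' v = ⊤ ↔ g v = ⊤ := fun v => by rw [ht]; simp
    refine ⟨flatten h r, ⟨h, hh, r, rfl⟩, flatten_eq_top.2 hhu, fun v => ?_⟩
    have hmv := hmin v
    by_cases hf' : f v = ⊤ <;> by_cases hg' : g v = ⊤
    · have h1 := hmv.1
      rw [hf', (htop v).2 hg', min_self, top_le_iff] at h1
      rw [flatten_eq_top.2 hf', flatten_eq_top.2 hg', flatten_eq_top.2 h1]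
      simp
    · have hg'' : g' v ≠ ⊤ := fun h => hg' ((htop v).1 h)
      have h1 := hmv.2 (by rw [hf']; exact hg''.symm)
      rw [hf', min_eq_right le_top] at h1
      rw [flatten_eq_top.2 hf', flatten_of_ne_top hg', flatten_of_ne_top (h1 ▸ hg'')]
      simp
    · have h1 := hmv.2 (by rw [(htop v).2 hg']; exact hf')
      rw [(htop v).2 hg', min_eq_left le_top] at h1
      rw [flatten_eq_top.2 hg', flatten_of_ne_top hf', flatten_of_ne_top (h1 ▸ hf')]
      simp
    · rw [flatten_of_ne_top hf', flatten_of_ne_top hg']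
      refine ⟨?_, fun h => absurd rfl h⟩
      rw [min_self]
      by_cases hh' : h v = ⊤
      · rw [flatten_eq_top.2 hh']; exact le_top
      · rw [flatten_of_ne_top hh']

theorem IsFundVec.flatten {B : Finset E} {e : E} {g : E → WithTop ℝ} (hg : IsFundVec L B e g) :
    IsFundVec (flat L) B e (flatten g 0) where
  mem := ⟨g, hg.mem, 0, rfl⟩
  apply_self := by
    rw [flatten_of_ne_top (by simp [hg.apply_self])]
    rfl
  supp v hv := hg.supp v fun h => hv (flatten_eq_top.2 h)

theorem IsSuppBase.isSuppBase_flat {B : Finset E} (hB : IsSuppBase A L B) :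
    IsSuppBase A (flat L) B where
  subset := hB.subset
  indep := by
    rintro _ ⟨f, hf, r, rfl⟩ u hu
    obtain ⟨v, hv, hvB⟩ := hB.indep f hf u fun h => hu (flatten_eq_top.2 h)
    exact ⟨v, fun h => hv (flatten_eq_top.1 h), hvB⟩
  exists_fund e he heB := by
    obtain ⟨g, hg⟩ := hB.exists_fund e he heB
    exact ⟨_, hg.flatten⟩

theorem IsSuppBase.of_flat (hL : IsElim A L) {B : Finset E} (hB : IsSuppBase A (flat L) B) :
    IsSuppBase A L B where
  subset := hB.subset
  indep f hf u hu := by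
    obtain ⟨v, hv, hvB⟩ := hB.indep _ ⟨f, hf, 0, rfl⟩ u fun h => hu (flatten_eq_top.1 h)
    exact ⟨v, fun h => hv (flatten_eq_top.2 h), hvB⟩
  exists_fund e he heB := by
    obtain ⟨_, ⟨f, hf, r, rfl⟩, hge, hgs⟩ := hB.exists_fund e he heB
    have hfe : f e ≠ ⊤ := fun h => by
      rw [flatten_eq_top.2 h] at hge
      exact WithTop.top_ne_zero hge
    obtain ⟨k, hk, hke, s, hs⟩ := exists_scale_eq hL hf hfe WithTop.zero_ne_top
    refine ⟨k, hk, hke, fun v hv => hgs v fun h => hv ?_⟩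
    rw [hs, flatten_eq_top.1 h, top_add]

end Trivial

/-! ### Recession cones of the cells -/

section Recession

variable {σ : Type*} [Fintype σ] {A : Finset (σ →₀ ℕ)} {L : Set ((σ →₀ ℕ) → WithTop ℝ)}

/-- The region of a base for the trivialized system is the recession cone of its region. -/
theorem mem_bases_flat_iff (hL : IsElim A L) {B : Finset (σ →₀ ℕ)} (hB : IsSuppBase A L B)
    {g : (σ →₀ ℕ) → (σ →₀ ℕ) → WithTop ℝ} (hg : ∀ e ∈ A, e ∉ B → IsFundVec L B e (g e))
    (v : σ → ℝ) :
    B ∈ bases A (flat L) v ↔ ∀ e ∈ A, e ∉ B → ∀ b ∈ B, g e b ≠ ⊤ → dot v e ≤ dot v b := by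
  rw [mem_bases_iff hL.flat hB.isSuppBase_flat fun e he heB => (hg e he heB).flatten]
  constructor
  · intro h e he heB b hb hgb
    simpa using h e he heB b hb 0 (flatten_of_ne_top hgb 0)
  · intro h e he heB b hb c hc
    have hgb : g e b ≠ ⊤ := fun hcon => by
      rw [flatten_eq_top.2 hcon] at hc
      exact WithTop.top_ne_coe hc
    rw [flatten_of_ne_top hgb] at hc
    have : c = 0 := by exact_mod_cast hc.symm
    rw [this, zero_add]
    exact h e he heB b hb hgb

theorem mem_bases_flat_zero (hL : IsElim A L) {B : Finset (σ →₀ ℕ)} (hB : IsSuppBase A L B) :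
    B ∈ bases A (flat L) 0 := by
  obtain ⟨g, hg⟩ := exists_fund_of_isSuppBase B hB
  rw [mem_bases_flat_iff hL hB hg]
  simp [dot_zero_left]

theorem mem_bases_flat_smul (hL : IsElim A L) {B : Finset (σ →₀ ℕ)} (hB : IsSuppBase A L B)
    {v : σ → ℝ} (hv : B ∈ bases A (flat L) v) {t : ℝ} (ht : 0 ≤ t) :
    B ∈ bases A (flat L) (t • v) := by
  obtain ⟨g, hg⟩ := exists_fund_of_isSuppBase B hB
  rw [mem_bases_flat_iff hL hB hg] at hv ⊢
  intro e he heB b hb hgb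
  rw [dot_smul, dot_smul]
  exact mul_le_mul_of_nonneg_left (hv e he heB b hb hgb) ht

variable [DecidableEq σ]

theorem isSuppBase_of_mem_bases (hL : IsElim A L) {B : Finset (σ →₀ ℕ)} {w : σ → ℝ}
    (hB : B ∈ bases A L w) : IsSuppBase A L B := IsBase.isSuppBase_of_translate hL hB

theorem isSuppBase_of_mem_bases_flat (hL : IsElim A L) {B : Finset (σ →₀ ℕ)} {w : σ → ℝ}
    (hB : B ∈ bases A (flat L) w) : IsSuppBase A L B :=
  (isSuppBase_of_mem_bases hL.flat hB).of_flat hL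

theorem isPolyhedralFan_range_cell_flat (hL : IsElim A L) :
    IsPolyhedralFan (Set.range (cell A (flat L))) where
  toIsPolyhedralComplex := isPolyhedralComplex_range_cell hL.flat
  cone := by
    rintro _ ⟨w, rfl⟩
    refine ⟨fun B hB => mem_bases_flat_zero hL (isSuppBase_of_mem_bases_flat hL hB),
      fun x hx t ht B hB => ?_⟩
    exact mem_bases_flat_smul hL (isSuppBase_of_mem_bases_flat hL hB) (hx hB) ht

theorem recessionCone_cell (hL : IsElim A L) (w : σ → ℝ) :
    recessionCone (cell A L w) = {v | bases A L w ⊆ bases A (flat L) v} := by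
  ext v
  constructor
  · intro hv B hB
    have hS := isSuppBase_of_mem_bases hL hB
    obtain ⟨g, hg⟩ := exists_fund_of_isSuppBase B hS
    rw [mem_bases_flat_iff hL hS hg]
    intro e he heB b hb hgb
    obtain ⟨c, hc⟩ := WithTop.ne_top_iff_exists.1 hgb
    by_contra hcon
    push Not at hcon
    have hd : 0 < dot v e - dot v b := by linarith
    obtain ⟨n, hn⟩ := exists_nat_gt ((c + dot w b - dot w e) / (dot v e - dot v b))
    have := (mem_bases_iff hL hS hg _).1 (hv w (mem_cell_self w) n n.cast_nonneg hB) e he heB b hb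
      c hc.symm
    rw [div_lt_iff₀ hd] at hn
    simp only [dot_add, dot_smul] at this
    linarith
  · intro hv x hx t ht B hB
    have hS := isSuppBase_of_mem_bases hL hB
    obtain ⟨g, hg⟩ := exists_fund_of_isSuppBase B hS
    rw [mem_bases_iff hL hS hg]
    intro e he heB b hb c hc
    have h1 := (mem_bases_iff hL hS hg x).1 (hx hB) e he heB b hb c hc
    have h2 := (mem_bases_flat_iff hL hS hg v).1 (hv hB) e he heB b hb (by simp [hc])
    simp only [dot_add, dot_smul]
    nlinarith [mul_le_mul_of_nonneg_left h2 ht]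

/-- Far out in the direction `v`, all bases are bases at `v` for the trivialized system. -/
theorem eventually_bases_subset (hL : IsElim A L) (w v : σ → ℝ) :
    ∀ᶠ r : ℝ in Filter.atTop, bases A L (w + r • v) ⊆ bases A (flat L) v := by
  have : ∀ᶠ r : ℝ in Filter.atTop, ∀ B ∈ A.powerset, B ∈ bases A L (w + r • v) →
      B ∈ bases A (flat L) v := by
    rw [Filter.eventually_all_finset]
    intro B _
    by_cases hB : B ∈ bases A (flat L) v
    · exact Filter.Eventually.of_forall fun _ _ => hB
    by_cases hS : IsSuppBase A L B
    swap
    · exact Filter.Eventually.of_forall fun _ h => absurd (isSuppBase_of_mem_bases hL h) hS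
    obtain ⟨g, hg⟩ := exists_fund_of_isSuppBase B hS
    rw [mem_bases_flat_iff hL hS hg] at hB
    push Not at hB
    obtain ⟨e, he, heB, b, hb, hgb, hlt⟩ := hB
    obtain ⟨c, hc⟩ := WithTop.ne_top_iff_exists.1 hgb
    have hd : 0 < dot v e - dot v b := by linarith
    filter_upwards [Filter.eventually_gt_atTop ((c + dot w b - dot w e) / (dot v e - dot v b))]
      with r hr hcon
    have := (mem_bases_iff hL hS hg _).1 hcon e he heB b hb c hc.symm
    rw [div_lt_iff₀ hd] at hr
    simp only [dot_add, dot_smul] at this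
    linarith
  filter_upwards [this] with r hr B hB
  exact hr B (Finset.mem_powerset.2 hB.1) hB

/-- If, for all bases at `w`, every inequality that is an equality at `v` is also one at `v'`, then
all bases at `v` are bases at `v'`. -/
theorem bases_flat_subset_of_forall_eq (hL : IsElim A L) {w v v' : σ → ℝ}
    (hwv : bases A L w ⊆ bases A (flat L) v) (hwv' : bases A L w ⊆ bases A (flat L) v')
    {B : Finset (σ →₀ ℕ)} (hB : B ∈ bases A L w)
    {g : (σ →₀ ℕ) → (σ →₀ ℕ) → WithTop ℝ} (hg : ∀ e ∈ A, e ∉ B → IsFundVec L B e (g e))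
    (h : ∀ e ∈ A, e ∉ B → ∀ b ∈ B, g e b ≠ ⊤ → dot v e = dot v b → dot v' e = dot v' b) :
    bases A (flat L) v ⊆ bases A (flat L) v' := by
  have hS := isSuppBase_of_mem_bases hL hB
  have hev : ∀ᶠ ε : ℝ in nhdsWithin 0 (Set.Ioi 0), ∀ e ∈ A, ∀ b ∈ A, e ∉ B → b ∈ B →
      g e b ≠ ⊤ → dot (v + ε • (-v')) e ≤ dot (v + ε • (-v')) b := by
    rw [Filter.eventually_all_finset]
    intro e he
    rw [Filter.eventually_all_finset]
    intro b _
    by_cases hcase : e ∉ B ∧ b ∈ B ∧ g e b ≠ ⊤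
    swap
    · exact Filter.Eventually.of_forall fun ε h1 h2 h3 => absurd ⟨h1, h2, h3⟩ hcase
    obtain ⟨heB, hb, htop⟩ := hcase
    rcases ((mem_bases_flat_iff hL hS hg v).1 (hwv hB) e he heB b hb htop).eq_or_lt with heq | hlt
    · refine Filter.Eventually.of_forall fun ε _ _ _ => ?_
      simp only [dot_add, dot_smul, dot_neg]
      rw [heq, h e he heB b hb htop heq]
    · have : ∀ᶠ ε : ℝ in nhdsWithin 0 (Set.Ioi 0),
          dot (v + ε • (-v')) e < dot (v + ε • (-v')) b := by
        refine Filter.Eventually.filter_mono nhdsWithin_le_nhds ?_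
        simp only [dot_add, dot_smul]
        refine ContinuousAt.eventually_lt (by fun_prop) (by fun_prop) ?_
        simpa using hlt
      filter_upwards [this] with ε hε _ _ _
      exact hε.le
  obtain ⟨ε, hε, hpos : 0 < ε⟩ := (hev.and self_mem_nhdsWithin).exists
  have hBε : B ∈ bases A (flat L) (v + ε • (-v')) := by
    rw [mem_bases_flat_iff hL hS hg]
    exact fun e he heB b hb hgb => hε e he b (hS.subset hb) heB hb hgb
  intro C hC
  have hCS := isSuppBase_of_mem_bases_flat hL hC
  have hB0 := mem_bases_flat_zero hL hS
  have hC0 := mem_bases_flat_zero hL hCS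
  have h1 := IsBase.sum_sub_le hL.flat hB0 (hwv' hB) hC0
  have h2 := IsBase.sum_sub_le hL.flat (hwv hB) hBε hC
  refine IsBase.of_sum_sub_eq hL.flat hB0 (hwv' hB) hC0 (le_antisymm h1 ?_)
  simp only [weight_sub, map_add, map_smul, map_neg, smul_eq_mul, map_zero] at h1 h2 ⊢
  by_contra hcon
  nlinarith [not_le.1 hcon]

/-- Each cell of the trivialized system is the recession cone of a cell: one takes a cell whose
bases are bases at `v` for the trivialized system, and whose number of bases is as large as
possible. -/
theorem exists_recessionCone_eq_cell_flat (hL : IsElim A L) (v : σ → ℝ) :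
    ∃ w, recessionCone (cell A L w) = cell A (flat L) v := by
  classical
  obtain ⟨G, hG⟩ := exists_fund A L
  -- a weight `w` with a maximal number of bases
  let s : Set ℕ := {k | ∃ w, bases A L w ⊆ bases A (flat L) v ∧ (bases A L w).ncard = k}
  have hsne : s.Nonempty := by
    obtain ⟨r, hr⟩ := (eventually_bases_subset hL 0 v).exists
    exact ⟨_, _, hr, rfl⟩
  have hsb : BddAbove s := by
    refine ⟨(bases A (flat L) v).ncard, ?_⟩
    rintro _ ⟨w, hw, rfl⟩
    exact Set.ncard_le_ncard hw (bases_finite v)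
  obtain ⟨w, hw, hmax⟩ := Nat.sSup_mem hsne hsb
  have hmax' : ∀ w', bases A L w' ⊆ bases A (flat L) v →
      (bases A L w').ncard ≤ (bases A L w).ncard := fun w' hw' => by
    rw [hmax]; exact le_csSup hsb ⟨w', hw', rfl⟩
  refine ⟨w, ?_⟩
  rw [recessionCone_cell hL]
  refine Set.Subset.antisymm (fun v' hv' => ?_) fun v' hv' => hw.trans hv'
  have hv' : bases A L w ⊆ bases A (flat L) v' := hv'
  obtain ⟨B₁, hB₁⟩ := bases_nonempty (A := A) (L := L) w
  have hS : ∀ B ∈ bases A L w, IsSuppBase A L B := fun B hB => isSuppBase_of_mem_bases hL hB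
  -- the inequalities that become tight when moving from `w` in the direction `-v'`
  let q : Finset (Finset (σ →₀ ℕ) × (σ →₀ ℕ) × (σ →₀ ℕ)) :=
    {k ∈ A.powerset ×ˢ A ×ˢ A | k.1 ∈ bases A L w ∧ k.2.1 ∉ k.1 ∧ k.2.2 ∈ k.1 ∧
      G k.1 k.2.1 k.2.2 ≠ ⊤ ∧ dot v k.2.1 = dot v k.2.2 ∧ dot v' k.2.1 < dot v' k.2.2}
  have hmemq : ∀ B e b, (B, e, b) ∈ q ↔ B ∈ bases A L w ∧ e ∈ A ∧ e ∉ B ∧ b ∈ B ∧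
      G B e b ≠ ⊤ ∧ dot v e = dot v b ∧ dot v' e < dot v' b := by
    intro B e b
    simp only [q, Finset.mem_filter, Finset.mem_product, Finset.mem_powerset]
    constructor
    · rintro ⟨⟨-, h1, -⟩, h2, h3, h4, h5, h6⟩
      exact ⟨h2, h1, h3, h4, h5, h6⟩
    · rintro ⟨h2, h1, h3, h4, h5, h6⟩
      exact ⟨⟨(hS B h2).subset, h1, (hS B h2).subset h4⟩, h2, h3, h4, h5, h6⟩
  rcases q.eq_empty_or_nonempty with hq | hq
  · refine bases_flat_subset_of_forall_eq hL hw hv' hB₁ (hG B₁ (hS B₁ hB₁))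
      fun e he heB b hb hgb heq => ?_
    have hle := (mem_bases_flat_iff hL (hS B₁ hB₁) (hG B₁ (hS B₁ hB₁)) v').1 (hv' hB₁) e he heB b hb
      hgb
    refine hle.eq_of_not_lt fun hlt => ?_
    have := (hmemq B₁ e b).2 ⟨hB₁, he, heB, hb, hgb, heq, hlt⟩
    rw [hq] at this
    simp at this
  · exfalso
    let τ : Finset (σ →₀ ℕ) × (σ →₀ ℕ) × (σ →₀ ℕ) → ℝ := fun k =>
      ((G k.1 k.2.1 k.2.2).untopD 0 + dot w k.2.2 - dot w k.2.1) / (dot v' k.2.2 - dot v' k.2.1)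
    obtain ⟨⟨B₀, e₀, b₀⟩, hk₀, hmin⟩ := q.exists_min_image τ hq
    obtain ⟨hB₀, he₀, heB₀, hb₀, htop₀, heq₀, hlt₀⟩ := (hmemq _ _ _).1 hk₀
    set s₀ := τ (B₀, e₀, b₀) with hs₀
    have hτ : ∀ B e b (c : ℝ), G B e b = c → dot v' e < dot v' b →
        τ (B, e, b) * (dot v' b - dot v' e) = c + dot w b - dot w e := by
      intro B e b c hc hlt
      have : dot v' b - dot v' e ≠ 0 := by linarith
      simp only [τ, hc, WithTop.untopD_coe]
      field_simp
    obtain ⟨c₀, hc₀⟩ := WithTop.ne_top_iff_exists.1 htop₀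
    have hτ₀ := hτ B₀ e₀ b₀ c₀ hc₀.symm hlt₀
    -- for large `r`, the bases at `w` are bases at `w - s₀ • v' + r • v`
    have hev : ∀ᶠ r : ℝ in Filter.atTop, ∀ B ∈ bases A L w, ∀ e ∈ A, ∀ b ∈ A, e ∉ B → b ∈ B →
        ∀ c : ℝ, G B e b = c →
          dot (w + s₀ • (-v') + r • v) e ≤ c + dot (w + s₀ • (-v') + r • v) b := by
      rw [Filter.eventually_all_finite (bases_finite w)]
      intro B hB
      rw [Filter.eventually_all_finset]
      intro e he
      rw [Filter.eventually_all_finset]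
      intro b _
      by_cases hcase : e ∉ B ∧ b ∈ B ∧ G B e b ≠ ⊤
      swap
      · exact Filter.Eventually.of_forall fun ε h1 h2 c hc =>
          absurd ⟨h1, h2, by simp [hc]⟩ hcase
      obtain ⟨heB, hb, htop⟩ := hcase
      obtain ⟨c, hc⟩ := WithTop.ne_top_iff_exists.1 htop
      have hle := (mem_bases_iff hL (hS B hB) (hG B (hS B hB)) w).1 hB e he heB b hb c hc.symm
      have hlev := (mem_bases_flat_iff hL (hS B hB) (hG B (hS B hB)) v).1 (hw hB) e he heB b hb
        htop
      have hlev' := (mem_bases_flat_iff hL (hS B hB) (hG B (hS B hB)) v').1 (hv' hB) e he heB b hb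
        htop
      have hcc : ∀ c₁ : ℝ, G B e b = c₁ → c₁ = c := fun c₁ hc₁ => by
        rw [← hc] at hc₁; exact_mod_cast hc₁.symm
      simp only [dot_add, dot_smul, dot_neg]
      rcases hlev.eq_or_lt with heq | hlt
      · refine Filter.Eventually.of_forall fun r _ _ c₁ hc₁ => ?_
        rw [hcc c₁ hc₁, heq]
        rcases hlev'.eq_or_lt with heq' | hlt'
        · rw [heq']; linarith
        · have h1 := hmin _ ((hmemq B e b).2 ⟨hB, he, heB, hb, htop, heq, hlt'⟩)
          have h2 := hτ B e b c hc.symm hlt'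
          have h3 : s₀ * (dot v' b - dot v' e) ≤ c + dot w b - dot w e :=
            h2 ▸ mul_le_mul_of_nonneg_right h1 (by linarith)
          linarith
      · have hd : 0 < dot v b - dot v e := by linarith
        filter_upwards [Filter.eventually_ge_atTop
          ((dot w e - s₀ * dot v' e - c - dot w b + s₀ * dot v' b) / (dot v b - dot v e))]
          with r hr _ _ c₁ hc₁
        rw [div_le_iff₀ hd] at hr
        rw [hcc c₁ hc₁]
        linarith
    obtain ⟨r, hr, hrT⟩ := (hev.and (eventually_bases_subset hL (w + s₀ • (-v')) v)).exists
    set w₁ := w + s₀ • (-v') + r • v with hw₁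
    have hsub : bases A L w ⊆ bases A L w₁ := by
      intro B hB
      rw [mem_bases_iff hL (hS B hB) (hG B (hS B hB))]
      exact fun e he heB b hb c hc => hr B hB e he b ((hS B hB).subset hb) heB hb c hc
    have hex : insert e₀ (B₀.erase b₀) ∈ bases A L w₁ := by
      refine (IsBase.exchange_iff hL (hsub hB₀) heB₀ hb₀ (hG B₀ (hS B₀ hB₀) e₀ he₀ heB₀)).2
        ⟨c₀, hc₀.symm, ?_⟩
      simp only [hw₁, dot_add, dot_smul, dot_neg, heq₀]
      linarith
    have hnot : insert e₀ (B₀.erase b₀) ∉ bases A L w := by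
      intro hcon
      have h1 := mem_bases_flat_zero hL (hS _ hB₀)
      have h2 := mem_bases_flat_zero hL (hS _ hcon)
      have h3 := IsBase.sum_sub_le hL.flat h2 (hv' hcon) h1
      simp only [dot_zero_left, sub_zero] at h3
      rw [Finset.sum_insert (by simp [heB₀]), ← Finset.add_sum_erase B₀ _ hb₀] at h3
      linarith
    have hss : bases A L w ⊂ bases A L w₁ := ⟨hsub, fun hcon => hnot (hcon hex)⟩
    have := Set.ncard_lt_ncard hss (bases_finite w₁)
    have := hmax' w₁ hrT
    omega

theorem recessionFan_range_cell (hL : IsElim A L) :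
    recessionFan (Set.range (cell A L)) = Set.range (cell A (flat L)) := by
  ext C
  constructor
  · rintro ⟨_, ⟨w, rfl⟩, -, rfl⟩
    obtain ⟨B, hB⟩ := bases_nonempty (A := A) (L := L) w
    have h0 : (0 : σ → ℝ) ∈ recessionCone (cell A L w) := by
      rw [recessionCone_cell hL]
      exact fun C hC => mem_bases_flat_zero hL (isSuppBase_of_mem_bases hL hC)
    have hconv : Convex ℝ (recessionCone (cell A L w)) := by
      rw [recessionCone_cell hL]
      refine convex_iff_segment_subset.2 fun x hx y hy => ?_
      rw [segment_eq_image']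
      rintro _ ⟨t, ht, rfl⟩ C hC
      exact mem_bases_segment hL.flat (hx hC) (hy hC) ht.1 ht.2
    obtain ⟨v, hv, hmin⟩ := exists_bases_subset hL.flat hconv ⟨0, h0⟩ (B := B) fun x hx => by
      rw [recessionCone_cell hL] at hx
      exact hx hB
    refine ⟨v, Set.Subset.antisymm (fun y hy => ?_) fun y hy => hmin y hy⟩
    rw [recessionCone_cell hL] at hv ⊢
    exact fun D hD => hy (hv hD)
  · rintro ⟨v, rfl⟩
    obtain ⟨w, hw⟩ := exists_recessionCone_eq_cell_flat hL v
    exact ⟨_, ⟨w, rfl⟩, ⟨w, mem_cell_self w⟩, hw.symm⟩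

end Recession

/-! ### Monomial orders -/

section MonomialOrder

variable {σ : Type*}

/-- A strict total order on exponent vectors that is compatible with addition. -/
structure IsMonomialOrder (lt : (σ →₀ ℕ) → (σ →₀ ℕ) → Prop) : Prop where
  irrefl : ∀ u, ¬ lt u u
  trans : ∀ u v w, lt u v → lt v w → lt u w
  total : ∀ u v, u ≠ v → lt u v ∨ lt v u
  add_right : ∀ u u' v, lt u u' → lt (u + v) (u' + v)

theorem IsTermOrder.isMonomialOrder {lt : (σ →₀ ℕ) → (σ →₀ ℕ) → Prop} (h : IsTermOrder lt) :
    IsMonomialOrder lt := ⟨h.irrefl, h.trans, h.total, h.add_right⟩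

theorem IsMonomialOrder.exists_min {lt : (σ →₀ ℕ) → (σ →₀ ℕ) → Prop} (h : IsMonomialOrder lt)
    {s : Set (σ →₀ ℕ)} (hs : s.Finite) (hne : s.Nonempty) :
    ∃ u ∈ s, ∀ v ∈ s, v ≠ u → lt u v := by
  induction s, hs using Set.Finite.induction_on with
  | empty => simp at hne
  | @insert a s ha _ ih =>
    rcases s.eq_empty_or_nonempty with rfl | hs'
    · exact ⟨a, by simp, fun v hv hva => absurd (by simpa using hv) hva⟩
    · obtain ⟨u, hu, hmin⟩ := ih hs'
      have hau : a ≠ u := fun hc => ha (hc ▸ hu)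
      rcases h.total a u hau with hlt | hlt
      · refine ⟨a, by simp, fun v hv hva => ?_⟩
        rcases hv with rfl | hv
        · exact absurd rfl hva
        · by_cases hvu : v = u
          · exact hvu ▸ hlt
          · exact h.trans _ _ _ hlt (hmin v hv hvu)
      · refine ⟨u, Or.inr hu, fun v hv hvu => ?_⟩
        rcases hv with rfl | hv
        · exact hlt
        · exact hmin v hv hvu

variable [Fintype σ]

/-- The order by the weight `v`, with ties broken by `lt`. -/
def weightOrder (v : σ → ℝ) (lt : (σ →₀ ℕ) → (σ →₀ ℕ) → Prop) (a b : σ →₀ ℕ) : Prop :=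
  dot v a < dot v b ∨ (dot v a = dot v b ∧ lt a b)

theorem IsMonomialOrder.weightOrder {lt : (σ →₀ ℕ) → (σ →₀ ℕ) → Prop} (h : IsMonomialOrder lt)
    (v : σ → ℝ) : IsMonomialOrder (weightOrder v lt) where
  irrefl u := by
    rintro (hc | ⟨-, hc⟩)
    · exact lt_irrefl _ hc
    · exact h.irrefl u hc
  trans a b c := by
    rintro (h1 | ⟨h1, h1'⟩) (h2 | ⟨h2, h2'⟩)
    · exact Or.inl (h1.trans h2)
    · exact Or.inl (h2 ▸ h1)
    · exact Or.inl (h1 ▸ h2)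
    · exact Or.inr ⟨h1.trans h2, h.trans _ _ _ h1' h2'⟩
  total a b hab := by
    rcases lt_trichotomy (dot v a) (dot v b) with h1 | h1 | h1
    · exact Or.inl (Or.inl h1)
    · rcases h.total a b hab with h2 | h2
      · exact Or.inl (Or.inr ⟨h1, h2⟩)
      · exact Or.inr (Or.inr ⟨h1.symm, h2⟩)
    · exact Or.inr (Or.inl h1)
  add_right a b c := by
    rintro (h1 | ⟨h1, h2⟩)
    · left; rw [dot_add_right, dot_add_right]; linarith
    · right
      exact ⟨by rw [dot_add_right, dot_add_right, h1], h.add_right _ _ _ h2⟩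

end MonomialOrder

/-! ### Initial forms in all degrees -/

section System

variable {σ : Type*} [Fintype σ]

/-- The coefficient vectors of (the elements of) a homogeneous tropical ideal, without the
requirement of closure under addition. -/
structure IsTropSystem (S : Set ((σ →₀ ℕ) → WithTop ℝ)) : Prop where
  finite : ∀ f ∈ S, {u | f u ≠ ⊤}.Finite
  scale : ∀ f ∈ S, ∀ r : ℝ, (fun u => f u + (r : WithTop ℝ)) ∈ S
  elim : ∀ f ∈ S, ∀ g ∈ S, ∀ u, f u = g u → f u ≠ ⊤ → ∃ h ∈ S, h u = ⊤ ∧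
    ∀ v, min (f v) (g v) ≤ h v ∧ (f v ≠ g v → h v = min (f v) (g v))
  shift : ∀ f ∈ S, ∀ a, ∃ g ∈ S, (∀ u, g (u + a) = f u) ∧ ∀ v, g v ≠ ⊤ → ∃ u, v = u + a
  component : ∀ f ∈ S, ∀ d : ℕ, ∃ g ∈ S, (∀ u, u.degree = d → g u = f u) ∧
    ∀ u, u.degree ≠ d → g u = ⊤

/-- The positions of the terms of `f` of minimal `w`-weight. -/
def initSet (w : σ → ℝ) (f : (σ →₀ ℕ) → WithTop ℝ) : Set (σ →₀ ℕ) :=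
  minSet fun u => f u + (dot w u : WithTop ℝ)

/-- The exponent vectors of degree at most `D`. -/
noncomputable def monos (σ : Type*) [Fintype σ] (D : ℕ) : Finset (σ →₀ ℕ) :=
  (Finsupp.finite_of_degree_le (σ := σ) D).toFinset

theorem mem_monos {D : ℕ} {u : σ →₀ ℕ} : u ∈ monos σ D ↔ u.degree ≤ D := by
  simp [monos]

/-- The vectors of `S` supported in degree at most `D`. -/
def trunc (S : Set ((σ →₀ ℕ) → WithTop ℝ)) (D : ℕ) : Set ((σ →₀ ℕ) → WithTop ℝ) :=
  {f ∈ S | ∀ u, f u ≠ ⊤ → u.degree ≤ D}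

/-- The exponents of the `lt`-smallest monomials of the initial forms `in_w(f)`, `f ∈ S`. -/
def leadSet (S : Set ((σ →₀ ℕ) → WithTop ℝ)) (w : σ → ℝ) (lt : (σ →₀ ℕ) → (σ →₀ ℕ) → Prop) :
    Set (σ →₀ ℕ) :=
  {u | ∃ f ∈ S, u ∈ initSet w f ∧ ∀ v ∈ initSet w f, v ≠ u → lt u v}

/-- Every initial form at `w` is a sum of initial forms at `w'`. -/
def InitLE (S : Set ((σ →₀ ℕ) → WithTop ℝ)) (w w' : σ → ℝ) : Prop :=
  ∀ f ∈ S, ∀ u ∈ initSet w f, ∃ g ∈ S, u ∈ initSet w' g ∧ initSet w' g ⊆ initSet w f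

theorem ne_top_of_mem_initSet {w : σ → ℝ} {f : (σ →₀ ℕ) → WithTop ℝ} {u : σ →₀ ℕ}
    (h : u ∈ initSet w f) : f u ≠ ⊤ := fun hc => h.1 (by simp [hc])

variable {S : Set ((σ →₀ ℕ) → WithTop ℝ)}

theorem IsTropSystem.isElim_trunc (hS : IsTropSystem S) (D : ℕ) :
    IsElim (monos σ D) (trunc S D) where
  supp f hf u hu := mem_monos.2 (hf.2 u hu)
  scale f hf r := ⟨hS.scale f hf.1 r, fun u hu => hf.2 u fun hc => hu (by simp [hc])⟩
  elim f hf g hg u huv hu := by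
    obtain ⟨h, hh, h1, h2⟩ := hS.elim f hf.1 g hg.1 u huv hu
    refine ⟨h, ⟨hh, fun v hv => ?_⟩, h1, h2⟩
    by_contra hcon
    have hfv : f v = ⊤ := by
      by_contra hc; exact hcon (hf.2 v hc)
    have hgv : g v = ⊤ := by
      by_contra hc; exact hcon (hg.2 v hc)
    have := (h2 v).1
    rw [hfv, hgv, min_self, top_le_iff] at this
    exact hv this

theorem IsTropSystem.initSet_nonempty (hS : IsTropSystem S) {f : (σ →₀ ℕ) → WithTop ℝ}
    (hf : f ∈ S) (w : σ → ℝ) {u : σ →₀ ℕ} (hu : f u ≠ ⊤) : (initSet w f).Nonempty := by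
  refine minSet_nonempty_of_finite (u := u) ((hS.finite f hf).subset fun v hv hc => hv ?_)
    (by simp [hu])
  simp [hc]

theorem IsTropSystem.initSet_finite (hS : IsTropSystem S) {f : (σ →₀ ℕ) → WithTop ℝ}
    (hf : f ∈ S) (w : σ → ℝ) : (initSet w f).Finite :=
  (hS.finite f hf).subset fun _ hv => ne_top_of_mem_initSet hv

/-- By homogeneity, an initial form may be replaced by its part in one degree. -/
theorem IsTropSystem.exists_component (hS : IsTropSystem S) {f : (σ →₀ ℕ) → WithTop ℝ}
    (hf : f ∈ S) {w : σ → ℝ} {u : σ →₀ ℕ} (hu : u ∈ initSet w f) :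
    ∃ g ∈ S, u ∈ initSet w g ∧ initSet w g ⊆ initSet w f ∧
      (∀ v, g v ≠ ⊤ → v.degree = u.degree ∧ f v ≠ ⊤) := by
  obtain ⟨g, hg, h1, h2⟩ := hS.component f hf u.degree
  have hle : ∀ v, f v + (dot w v : WithTop ℝ) ≤ g v + (dot w v : WithTop ℝ) := by
    intro v
    by_cases hv : v.degree = u.degree
    · rw [h1 v hv]
    · rw [h2 v hv, top_add]; exact le_top
  have hug : u ∈ initSet w g := by
    refine ⟨?_, fun v => ?_⟩
    · simpa only [h1 u rfl] using hu.1
    · simp only [h1 u rfl]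
      exact (hu.2 v).trans (hle v)
  refine ⟨g, hg, hug, fun v hv => mem_minSet_of_le hu ?_, fun v hv => ?_⟩
  · have := hv.2 u
    simp only [h1 u rfl] at this
    exact (hle v).trans this
  · by_cases hvd : v.degree = u.degree
    · exact ⟨hvd, by rwa [← h1 v hvd]⟩
    · exact absurd (h2 v hvd) hv

theorem IsTropSystem.exists_trunc (hS : IsTropSystem S) {f : (σ →₀ ℕ) → WithTop ℝ}
    (hf : f ∈ S) {w : σ → ℝ} {u : σ →₀ ℕ} (hu : u ∈ initSet w f) {D : ℕ} (hD : u.degree ≤ D) :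
    ∃ g ∈ trunc S D, u ∈ initSet w g ∧ initSet w g ⊆ initSet w f := by
  obtain ⟨g, hg, h1, h2, h3⟩ := hS.exists_component hf hu
  exact ⟨g, ⟨hg, fun v hv => (h3 v hv).1.le.trans hD⟩, h1, h2⟩

theorem IsTropSystem.exists_shift (hS : IsTropSystem S) {f : (σ →₀ ℕ) → WithTop ℝ}
    (hf : f ∈ S) (a : σ →₀ ℕ) (w : σ → ℝ) :
    ∃ g ∈ S, initSet w g = (fun u => u + a) '' initSet w f := by
  obtain ⟨g, hg, h1, h2⟩ := hS.shift f hf a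
  have hval : ∀ u, g (u + a) + (dot w (u + a) : WithTop ℝ) =
      f u + (dot w u : WithTop ℝ) + (dot w a : WithTop ℝ) := by
    intro u
    rw [h1, dot_add_right, add_assoc]
    norm_cast
  refine ⟨g, hg, ?_⟩
  ext v
  constructor
  · intro hv
    obtain ⟨u, rfl⟩ := h2 v (ne_top_of_mem_initSet hv)
    refine ⟨u, ⟨fun hc => hv.1 ?_, fun u' => ?_⟩, rfl⟩
    · simp only [hval, hc, top_add]
    · have := hv.2 (u' + a)
      simp only [hval] at this
      exact (WithTop.add_le_add_iff_right WithTop.coe_ne_top).1 this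
  · rintro ⟨u, hu, rfl⟩
    refine ⟨?_, fun v => ?_⟩
    · simp only [hval]
      simpa using hu.1
    · by_cases hv : g v = ⊤
      · simp [hv]
      · obtain ⟨u', rfl⟩ := h2 v hv
        simp only [hval]
        exact add_le_add_left (hu.2 u') _

theorem IsTropSystem.add_mem_leadSet (hS : IsTropSystem S) {w : σ → ℝ}
    {lt : (σ →₀ ℕ) → (σ →₀ ℕ) → Prop} (hlt : IsMonomialOrder lt) {u : σ →₀ ℕ}
    (hu : u ∈ leadSet S w lt) (a : σ →₀ ℕ) : u + a ∈ leadSet S w lt := by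
  obtain ⟨f, hf, huf, hmin⟩ := hu
  obtain ⟨g, hg, heq⟩ := hS.exists_shift hf a w
  refine ⟨g, hg, heq ▸ ⟨u, huf, rfl⟩, fun v hv hne => ?_⟩
  rw [heq] at hv
  obtain ⟨v', hv', rfl⟩ := hv
  exact hlt.add_right _ _ _ (hmin v' hv' fun hc => hne (by rw [hc]))

theorem IsTropSystem.mem_leadSet_of_le (hS : IsTropSystem S) {w : σ → ℝ}
    {lt : (σ →₀ ℕ) → (σ →₀ ℕ) → Prop} (hlt : IsMonomialOrder lt) {u v : σ →₀ ℕ}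
    (hu : u ∈ leadSet S w lt) (huv : u ≤ v) : v ∈ leadSet S w lt := by
  obtain ⟨a, rfl⟩ := exists_add_of_le huv
  exact hS.add_mem_leadSet hlt hu a

theorem IsTropSystem.exists_trunc_of_mem_leadSet (hS : IsTropSystem S) {w : σ → ℝ}
    {lt : (σ →₀ ℕ) → (σ →₀ ℕ) → Prop} {u : σ →₀ ℕ} (hu : u ∈ leadSet S w lt) {D : ℕ}
    (hD : u.degree ≤ D) :
    ∃ f ∈ trunc S D, u ∈ initSet w f ∧ ∀ v ∈ initSet w f, v ≠ u → lt u v := by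
  obtain ⟨f, hf, huf, hmin⟩ := hu
  obtain ⟨g, hg, h1, h2⟩ := hS.exists_trunc hf huf hD
  exact ⟨g, hg, h1, fun v hv hne => hmin v (h2 hv) hne⟩

open Classical in
/-- The standard monomials of degree at most `D`: those that are not leading monomials. -/
noncomputable def stdMonos (S : Set ((σ →₀ ℕ) → WithTop ℝ)) (w : σ → ℝ)
    (lt : (σ →₀ ℕ) → (σ →₀ ℕ) → Prop) (D : ℕ) : Finset (σ →₀ ℕ) :=
  {u ∈ monos σ D | u ∉ leadSet S w lt}

theorem mem_stdMonos {w : σ → ℝ} {lt : (σ →₀ ℕ) → (σ →₀ ℕ) → Prop} {D : ℕ} {u : σ →₀ ℕ} :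
    u ∈ stdMonos S w lt D ↔ u.degree ≤ D ∧ u ∉ leadSet S w lt := by
  simp [stdMonos, mem_monos]

/-- Macaulay's theorem: the standard monomials form a base. -/
theorem IsTropSystem.stdMonos_mem_bases (hS : IsTropSystem S) (w : σ → ℝ)
    {lt : (σ →₀ ℕ) → (σ →₀ ℕ) → Prop} (hlt : IsMonomialOrder lt) (D : ℕ) :
    stdMonos S w lt D ∈ bases (monos σ D) (trunc S D) w := by
  have hE := (hS.isElim_trunc D).isElim_translate (dot w)
  refine ⟨fun u hu => mem_monos.2 (mem_stdMonos.1 hu).1, ?_, ?_⟩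
  · rintro _ ⟨f, hf, rfl⟩ hne hsub
    obtain ⟨u, hu, hmin⟩ := hlt.exists_min (hS.initSet_finite hf.1 w) hne
    exact (mem_stdMonos.1 (Finset.mem_coe.1 (hsub hu))).2 ⟨f, hf.1, hu, hmin⟩
  · -- induction on the number of larger monomials
    have key : ∀ n e, e ∈ monos σ D → e ∉ stdMonos S w lt D →
        {v | v ∈ monos σ D ∧ lt e v}.ncard = n →
        Spans (translate (trunc S D) (dot w)) (stdMonos S w lt D) e := by
      intro n
      induction n using Nat.strong_induction_on with
      | _ n ih =>
        intro e he heB hn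
        have hlead : e ∈ leadSet S w lt := by
          by_contra hc
          exact heB (mem_stdMonos.2 ⟨mem_monos.1 he, hc⟩)
        obtain ⟨f, hf, hef, hmin⟩ := hS.exists_trunc_of_mem_leadSet hlead (mem_monos.1 he)
        refine hE.spans_of_forall (by exact_mod_cast heB) ⟨f, hf, rfl⟩ hef fun v hv hve hvB => ?_
        have hvA : v ∈ monos σ D := mem_monos.2 (hf.2 v (ne_top_of_mem_initSet hv))
        have hlt' := hmin v hv hve
        refine ih _ ?_ v hvA (by exact_mod_cast hvB) rfl
        rw [← hn]
        refine Set.ncard_lt_ncard ⟨fun z hz => ⟨hz.1, hlt.trans _ _ _ hlt' hz.2⟩, fun hc => ?_⟩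
          ((monos σ D).finite_toSet.subset fun z hz => hz.1)
        exact hlt.irrefl v (hc ⟨hvA, hlt'⟩).2
    exact fun e he heB => key _ e he heB rfl

variable [DecidableEq σ]

/-- There are only finitely many sets of leading monomials: a set of monomials that belongs to
infinitely many of them can be enlarged, by an element of the support of some vector. -/
theorem IsTropSystem.finite_leadSets (hS : IsTropSystem S) :
    {M | ∃ w lt, IsMonomialOrder lt ∧ M = leadSet S w lt}.Finite := by
  have key : ∀ (N : Ideal (MvPolynomial σ ℚ)) (G : Set (σ →₀ ℕ)),
      N = Ideal.span ((fun s => MvPolynomial.monomial s (1 : ℚ)) '' G) →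
      {M | (∃ w lt, IsMonomialOrder lt ∧ M = leadSet S w lt) ∧ G ⊆ M}.Finite := by
    intro N
    induction N using WellFoundedGT.induction with
    | _ N ih =>
      intro G hN
      by_cases hcase : ∀ f ∈ S, ∀ u, f u ≠ ⊤ → ∃ v, f v ≠ ⊤ ∧ ∃ m ∈ G, m ≤ v
      · refine (Set.finite_singleton {v | ∃ m ∈ G, m ≤ v}).subset ?_
        rintro _ ⟨⟨w, lt, hlt, rfl⟩, hG⟩
        refine Set.mem_singleton_iff.2 (Set.Subset.antisymm (fun u hu => ?_) ?_)
        · have hB := isSuppBase_of_mem_bases (hS.isElim_trunc u.degree)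
            (hS.stdMonos_mem_bases w hlt u.degree)
          obtain ⟨g, hg⟩ := hB.exists_fund u (mem_monos.2 le_rfl)
            fun hc => (mem_stdMonos.1 hc).2 hu
          obtain ⟨v, hv, m, hm, hmv⟩ := hcase g hg.mem.1 u (by simp [hg.apply_self])
          rcases hg.supp v hv with rfl | hvB
          · exact ⟨m, hm, hmv⟩
          · exact absurd (hS.mem_leadSet_of_le hlt (hG hm) hmv) (mem_stdMonos.1 hvB).2
        · rintro v ⟨m, hm, hmv⟩
          exact hS.mem_leadSet_of_le hlt (hG hm) hmv
      · push Not at hcase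
        obtain ⟨f, hf, u, hu, hfG⟩ := hcase
        refine ((hS.finite f hf).biUnion fun m hm => ih (Ideal.span
          ((fun s => MvPolynomial.monomial s (1 : ℚ)) '' insert m G)) ?_ (insert m G) rfl).subset ?_
        · rw [hN]
          refine lt_of_le_of_ne (Ideal.span_mono (Set.image_mono (Set.subset_insert _ _)))
            fun heq => ?_
          have : MvPolynomial.monomial m (1 : ℚ) ∈
              Ideal.span ((fun s => MvPolynomial.monomial s (1 : ℚ)) '' G) := by
            rw [heq]
            exact Ideal.subset_span ⟨m, Set.mem_insert _ _, rfl⟩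
          rw [MvPolynomial.mem_ideal_span_monomial_image] at this
          obtain ⟨s, hs, hsm⟩ := this m (by simp)
          exact hfG m hm s hs hsm
        · rintro _ ⟨⟨w, lt, hlt, rfl⟩, hG⟩
          obtain ⟨m, hm, hmin⟩ := hlt.exists_min (hS.initSet_finite hf w)
            (hS.initSet_nonempty hf w hu)
          refine Set.mem_biUnion (ne_top_of_mem_initSet hm : m ∈ {u | f u ≠ ⊤}) ?_
          exact ⟨⟨w, lt, hlt, rfl⟩, Set.insert_subset ⟨f, hf, hm, hmin⟩ hG⟩
  refine (key _ ∅ rfl).subset fun M hM => ⟨hM, Set.empty_subset _⟩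

/-- All sets of leading monomials are generated in degree at most `D`. -/
def GeneratedBy (S : Set ((σ →₀ ℕ) → WithTop ℝ)) (D : ℕ) : Prop :=
  ∀ w lt, IsMonomialOrder lt → ∀ u ∈ leadSet S w lt, ∃ m ∈ leadSet S w lt, m ≤ u ∧ m.degree ≤ D

omit [DecidableEq σ] in
theorem GeneratedBy.mono {D D' : ℕ} (h : GeneratedBy S D) (hD : D ≤ D') : GeneratedBy S D' :=
  fun w lt hlt u hu => by
    obtain ⟨m, h1, h2, h3⟩ := h w lt hlt u hu
    exact ⟨m, h1, h2, h3.trans hD⟩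

theorem IsTropSystem.exists_generatedBy (hS : IsTropSystem S) : ∃ D, GeneratedBy S D := by
  have hM : ∀ M : Set (σ →₀ ℕ), ∃ D : ℕ, ∀ u ∈ M, ∃ m ∈ M, m ≤ u ∧ m.degree ≤ D := by
    intro M
    have hfin : {m | Minimal (fun x => x ∈ M) m}.Finite :=
      WellQuasiOrderedLE.finite_of_isAntichain (setOfPred_minimal_antichain _)
    obtain ⟨D, hD⟩ := (hfin.image Finsupp.degree).bddAbove
    refine ⟨D, fun u hu => ?_⟩
    obtain ⟨m, hmu, hm⟩ := exists_minimal_le_of_wellFoundedLT (fun x => x ∈ M) u hu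
    exact ⟨m, hm.prop, hmu, hD ⟨m, hm, rfl⟩⟩
  choose d hd using hM
  obtain ⟨D, hD⟩ := (hS.finite_leadSets.image d).bddAbove
  refine ⟨D, fun w lt hlt u hu => ?_⟩
  obtain ⟨m, h1, h2, h3⟩ := hd _ u hu
  exact ⟨m, h1, h2, h3.trans (hD ⟨_, ⟨w, lt, hlt, rfl⟩, rfl⟩)⟩

theorem IsTropSystem.exists_of_bases_eq (hS : IsTropSystem S) {D : ℕ} {w w' : σ → ℝ}
    (h : bases (monos σ D) (trunc S D) w = bases (monos σ D) (trunc S D) w')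
    {f : (σ →₀ ℕ) → WithTop ℝ} (hf : f ∈ trunc S D) {u : σ →₀ ℕ} (hu : u ∈ initSet w f) :
    ∃ g ∈ trunc S D, u ∈ initSet w' g ∧ initSet w' g ⊆ initSet w f := by
  obtain ⟨_, ⟨g, hg, rfl⟩, h1, h2⟩ := exists_minSet_subset_of_isBase_iff
    ((hS.isElim_trunc D).isElim_translate (dot w)) (L' := translate (trunc S D) (dot w'))
    (fun B hB => (h ▸ hB : B ∈ bases (monos σ D) (trunc S D) w'))
    (fun B hB => (h ▸ hB : B ∈ bases (monos σ D) (trunc S D) w)) ⟨f, hf, rfl⟩ hu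
  exact ⟨g, hg, h1, h2⟩

omit [DecidableEq σ] in
theorem IsTropSystem.bases_subset_of_initLE (hS : IsTropSystem S) {w w' : σ → ℝ}
    (h : InitLE S w w') (h' : InitLE S w' w) (D : ℕ) :
    bases (monos σ D) (trunc S D) w ⊆ bases (monos σ D) (trunc S D) w' := by
  rintro B ⟨hBA, hind, hsp⟩
  refine ⟨hBA, ?_, fun e he heB => ?_⟩
  · rintro _ ⟨f, hf, rfl⟩ ⟨u, hu⟩ hsub
    obtain ⟨g, hg, hug, hgs⟩ := h' f hf.1 u hu
    obtain ⟨k, hk, huk, hks⟩ := hS.exists_trunc hg hug (hf.2 u (ne_top_of_mem_initSet hu))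
    exact hind _ ⟨k, hk, rfl⟩ ⟨u, huk⟩ ((hks.trans hgs).trans hsub)
  · obtain ⟨_, ⟨f, hf, rfl⟩, hef, hsub⟩ := hsp e he heB
    obtain ⟨g, hg, heg, hgs⟩ := h f hf.1 e hef
    obtain ⟨k, hk, hek, hks⟩ := hS.exists_trunc hg heg (mem_monos.1 he)
    exact ⟨_, ⟨k, hk, rfl⟩, hek, (hks.trans hgs).trans hsub⟩

/-- The standard monomials for an order that refines the order by `v` have maximal weight `v` among
all bases. -/
theorem IsTropSystem.weight_le_stdMonos (hS : IsTropSystem S) (w v : σ → ℝ)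
    {lt : (σ →₀ ℕ) → (σ →₀ ℕ) → Prop} (hlt : IsMonomialOrder lt) {D : ℕ} {C : Finset (σ →₀ ℕ)}
    (hC : C ∈ bases (monos σ D) (trunc S D) w) :
    weight C v ≤ weight (stdMonos S w (weightOrder v lt) D) v := by
  have hlt' := hlt.weightOrder v
  have hL := hS.isElim_trunc D
  have hB := hS.stdMonos_mem_bases w hlt' D
  refine IsBase.sum_le_of_local_max (hL.isElim_translate (dot w)) hB hC (dot v)
    fun e heB b hb hex => ?_
  have he : e ∈ monos σ D := hex.1 (Finset.mem_insert_self _ _)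
  obtain ⟨g, hg⟩ := (isSuppBase_of_mem_bases hL hB).exists_fund e he heB
  obtain ⟨c, hc, heq⟩ := (IsBase.exchange_iff hL hB heB hb hg).1 hex
  obtain ⟨m, hm, hmin⟩ := hlt'.exists_min (hS.initSet_finite hg.mem.1 w)
    (hS.initSet_nonempty hg.mem.1 w (u := e) (by simp [hg.apply_self]))
  have hme : m = e := by
    refine (hg.supp m (ne_top_of_mem_initSet hm)).resolve_right fun hmB => ?_
    exact (mem_stdMonos.1 hmB).2 ⟨g, hg.mem.1, hm, hmin⟩
  subst hme
  have hbm : b ∈ initSet w g := by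
    refine mem_minSet_of_le hm ?_
    simp only [hc, hg.apply_self, heq, zero_add]
    norm_cast
  rcases hmin b hbm (fun hc => heB (hc ▸ hb)) with h | h
  · exact h.le
  · exact h.1.le

/-- The bases in degree at most `D` determine the bases in all degrees. -/
theorem IsTropSystem.bases_subset_of_bases_eq (hS : IsTropSystem S) {D : ℕ}
    (hD : GeneratedBy S D) {lt : (σ →₀ ℕ) → (σ →₀ ℕ) → Prop} (hlt : IsMonomialOrder lt)
    {w w' : σ → ℝ} (h : bases (monos σ D) (trunc S D) w = bases (monos σ D) (trunc S D) w')
    (d : ℕ) : bases (monos σ d) (trunc S d) w ⊆ bases (monos σ d) (trunc S d) w' := by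
  have hsub : ∀ {w w' : σ → ℝ} {lt}, IsMonomialOrder lt →
      bases (monos σ D) (trunc S D) w = bases (monos σ D) (trunc S D) w' →
      leadSet S w lt ⊆ leadSet S w' lt := by
    intro w w' lt hlt h u hu
    obtain ⟨m, hm, hmu, hmD⟩ := hD w lt hlt u hu
    obtain ⟨f, hf, hmf, hmin⟩ := hS.exists_trunc_of_mem_leadSet hm hmD
    obtain ⟨g, hg, hmg, hgs⟩ := hS.exists_of_bases_eq h hf hmf
    exact hS.mem_leadSet_of_le hlt ⟨g, hg.1, hmg, fun v hv hne => hmin v (hgs hv) hne⟩ hmu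
  have hstd : ∀ {lt}, IsMonomialOrder lt →
      stdMonos S w lt d ∈ bases (monos σ d) (trunc S d) w' := by
    intro lt hlt
    have : stdMonos S w lt d = stdMonos S w' lt d := by
      ext u
      rw [mem_stdMonos, mem_stdMonos, (hsub hlt h).antisymm (hsub hlt h.symm)]
    rw [this]
    exact hS.stdMonos_mem_bases w' hlt d
  have hL := hS.isElim_trunc d
  -- a common base of maximal weight with respect to `w' - w`, which also has minimal weight
  set v := w' - w with hv
  have hlt' := hlt.weightOrder (-v)
  set B := stdMonos S w (weightOrder (-v) lt) d
  have hBw : B ∈ bases (monos σ d) (trunc S d) w := hS.stdMonos_mem_bases w hlt' d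
  have hBw' : B ∈ bases (monos σ d) (trunc S d) w' := hstd hlt'
  intro C hC
  refine IsBase.of_sum_sub_eq hL hBw hBw' hC (le_antisymm (IsBase.sum_sub_le hL hBw hBw' hC) ?_)
  have := hS.weight_le_stdMonos w (-v) hlt hC
  simp only [map_neg, neg_le_neg_iff, hv, map_sub] at this
  simp only [weight_sub]
  exact this

theorem IsTropSystem.initLE_iff (hS : IsTropSystem S) {D : ℕ} (hD : GeneratedBy S D)
    {lt : (σ →₀ ℕ) → (σ →₀ ℕ) → Prop} (hlt : IsMonomialOrder lt) {w w' : σ → ℝ} :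
    (InitLE S w w' ∧ InitLE S w' w) ↔
      bases (monos σ D) (trunc S D) w = bases (monos σ D) (trunc S D) w' := by
  have hle : ∀ {w w' : σ → ℝ},
      bases (monos σ D) (trunc S D) w = bases (monos σ D) (trunc S D) w' → InitLE S w w' := by
    intro w w' h f hf u hu
    obtain ⟨f', hf', huf', hsub⟩ := hS.exists_trunc hf hu le_rfl
    obtain ⟨g, hg, hug, hgs⟩ := hS.exists_of_bases_eq
      ((hS.bases_subset_of_bases_eq hD hlt h u.degree).antisymm
        (hS.bases_subset_of_bases_eq hD hlt h.symm u.degree)) hf' huf'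
    exact ⟨g, hg.1, hug, hgs.trans hsub⟩
  exact ⟨fun h => (hS.bases_subset_of_initLE h.1 h.2 D).antisymm
    (hS.bases_subset_of_initLE h.2 h.1 D), fun h => ⟨hle h, hle h.symm⟩⟩

end System

/-! ### The trivialized system -/

section Flat

variable {σ : Type*} [Fintype σ] {S : Set ((σ →₀ ℕ) → WithTop ℝ)}

omit [Fintype σ] in
theorem trunc_flat (S : Set ((σ →₀ ℕ) → WithTop ℝ)) (D : ℕ) :
    trunc (flat S) D = flat (trunc S D) := by
  ext g
  constructor
  · rintro ⟨⟨f, hf, r, rfl⟩, h⟩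
    exact ⟨f, ⟨hf, fun u hu => h u fun hc => hu (flatten_eq_top.1 hc)⟩, r, rfl⟩
  · rintro ⟨f, hf, r, rfl⟩
    exact ⟨⟨f, hf.1, r, rfl⟩, fun u hu => hf.2 u fun hc => hu (flatten_eq_top.2 hc)⟩

omit [Fintype σ] in
theorem IsTropSystem.exists_mem_trunc (hS : IsTropSystem S) {f : (σ →₀ ℕ) → WithTop ℝ}
    (hf : f ∈ S) : ∃ D, ∀ D', D ≤ D' → f ∈ trunc S D' := by
  obtain ⟨D, hD⟩ := ((hS.finite f hf).image Finsupp.degree).bddAbove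
  exact ⟨D, fun D' h => ⟨hf, fun u hu => (hD ⟨u, hu, rfl⟩).trans h⟩⟩

omit [Fintype σ] in
theorem flatten_add_const (f : (σ →₀ ℕ) → WithTop ℝ) (r s : ℝ) :
    (fun u => flatten f r u + (s : WithTop ℝ)) = flatten f (r + s) := by
  funext u
  by_cases hu : f u = ⊤
  · rw [flatten_eq_top.2 hu, flatten_eq_top.2 hu, top_add]
  · rw [flatten_of_ne_top hu, flatten_of_ne_top hu]
    norm_cast

theorem IsTropSystem.isTropSystem_flat (hS : IsTropSystem S) : IsTropSystem (flat S) where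
  finite := by
    rintro _ ⟨f, hf, r, rfl⟩
    exact (hS.finite f hf).subset fun u hu hc => hu (flatten_eq_top.2 hc)
  scale := by
    rintro _ ⟨f, hf, r, rfl⟩ s
    exact ⟨f, hf, r + s, flatten_add_const f r s⟩
  elim := by
    rintro _ ⟨f, hf, r, rfl⟩ _ ⟨g, hg, s, rfl⟩ u huv hu
    obtain ⟨D₁, h₁⟩ := hS.exists_mem_trunc hf
    obtain ⟨D₂, h₂⟩ := hS.exists_mem_trunc hg
    obtain ⟨h, hh, hres⟩ := (hS.isElim_trunc (max D₁ D₂)).flat.elim _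
      ⟨f, h₁ _ (le_max_left _ _), r, rfl⟩ _ ⟨g, h₂ _ (le_max_right _ _), s, rfl⟩ u huv hu
    obtain ⟨k, hk, t, rfl⟩ := hh
    exact ⟨_, ⟨k, hk.1, t, rfl⟩, hres⟩
  shift := by
    rintro _ ⟨f, hf, r, rfl⟩ a
    obtain ⟨g, hg, h1, h2⟩ := hS.shift f hf a
    refine ⟨_, ⟨g, hg, r, rfl⟩, fun u => ?_, fun v hv => h2 v fun hc => hv (flatten_eq_top.2 hc)⟩
    simp only [flatten, h1]
  component := by
    rintro _ ⟨f, hf, r, rfl⟩ d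
    obtain ⟨g, hg, h1, h2⟩ := hS.component f hf d
    refine ⟨_, ⟨g, hg, r, rfl⟩, fun u hu => ?_, fun u hu => flatten_eq_top.2 (h2 u hu)⟩
    simp only [flatten, h1 u hu]

theorem initSet_flatten (w : σ → ℝ) (f : (σ →₀ ℕ) → WithTop ℝ) (r : ℝ) :
    initSet w (flatten f r) = initSet w (flatten f 0) := by
  unfold initSet
  rw [← minSet_add_const (fun u => flatten f 0 u + (dot w u : WithTop ℝ)) r]
  congr 1
  funext u
  have := congrFun (flatten_add_const f 0 r) u
  rw [add_right_comm, this, zero_add]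

/-- The initial positions of a flattened vector are the positions in the support of least
`w`-weight. -/
theorem mem_initSet_flatten {w : σ → ℝ} {f : (σ →₀ ℕ) → WithTop ℝ} {u : σ →₀ ℕ} {r : ℝ} :
    u ∈ initSet w (flatten f r) ↔ f u ≠ ⊤ ∧ ∀ v, f v ≠ ⊤ → dot w u ≤ dot w v := by
  rw [initSet_flatten]
  constructor
  · intro h
    have hu : f u ≠ ⊤ := fun hc => ne_top_of_mem_initSet h (flatten_eq_top.2 hc)
    refine ⟨hu, fun v hv => ?_⟩
    have := h.2 v
    simp only [flatten_of_ne_top hu, flatten_of_ne_top hv] at this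
    have h2 : (0 : ℝ) + dot w u ≤ 0 + dot w v := by exact_mod_cast this
    linarith
  · rintro ⟨hu, h⟩
    refine ⟨by simp [flatten_of_ne_top hu], fun v => ?_⟩
    by_cases hv : f v = ⊤
    · simp [flatten_eq_top.2 hv]
    · simp only [flatten_of_ne_top hu, flatten_of_ne_top hv]
      have := h v hv
      norm_cast
      linarith

end Flat

/-! ### Initial ideals of polynomial ideals -/

section Polynomials

variable {σ : Type*} {K : Type*} [CommSemiring K]

theorem boolSemi_eq_zero_or_one (a : BoolSemi) : a = 0 ∨ a = 1 := by
  obtain ⟨a, rfl | rfl⟩ := a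
  · exact Or.inl rfl
  · exact Or.inr rfl

theorem boolSemi_one_ne_zero : (1 : BoolSemi) ≠ 0 := by
  intro h
  have := congrArg (Subtype.val) h
  simp at this

theorem boolSemi_add_eq_zero {a b : BoolSemi} : a + b = 0 ↔ a = 0 ∧ b = 0 := by
  rw [Subtype.ext_iff, Subtype.ext_iff, Subtype.ext_iff]
  exact Tropical.add_eq_zero_iff

theorem boolSemi_sum_eq_zero {κ : Type*} {s : Finset κ} {f : κ → BoolSemi} :
    ∑ k ∈ s, f k = 0 ↔ ∀ k ∈ s, f k = 0 := by
  classical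
  induction s using Finset.induction_on with
  | empty => simp
  | insert a s ha ih => rw [Finset.sum_insert ha, boolSemi_add_eq_zero, ih]; simp

theorem boolSemi_mul_ne_zero {a b : BoolSemi} (ha : a ≠ 0) (hb : b ≠ 0) : a * b ≠ 0 := by
  rw [(boolSemi_eq_zero_or_one a).resolve_left ha, (boolSemi_eq_zero_or_one b).resolve_left hb,
    one_mul]
  exact boolSemi_one_ne_zero

/-- A polynomial with Boolean coefficients is determined by its support. -/
theorem boolPoly_ext {p q : MvPolynomial σ BoolSemi}
    (h : ∀ u, u ∈ p.support ↔ u ∈ q.support) : p = q := by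
  ext1 u
  have hu := h u
  rw [mem_support_iff, mem_support_iff] at hu
  rcases boolSemi_eq_zero_or_one (coeff u p) with h1 | h1
  · rw [h1]
    by_contra hc
    exact hu.2 (Ne.symm hc) h1
  · have h2 : coeff u q ≠ 0 := hu.1 (by rw [h1]; exact boolSemi_one_ne_zero)
    rw [h1, (boolSemi_eq_zero_or_one _).resolve_left h2]

theorem boolPoly_mul_mem_support {p q : MvPolynomial σ BoolSemi} {a b : σ →₀ ℕ}
    (ha : a ∈ p.support) (hb : b ∈ q.support) : a + b ∈ (p * q).support := by
  classical
  rw [mem_support_iff] at *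
  rw [coeff_mul, Ne, boolSemi_sum_eq_zero]
  intro h
  exact boolSemi_mul_ne_zero ha hb (h (a, b) (Finset.HasAntidiagonal.mem_antidiagonal.2 rfl))

/-- Ideals of Boolean polynomials with a generating set closed under multiplication by monomials:
membership means being a sum of generators. -/
theorem boolPoly_mem_span_iff {G : Set (MvPolynomial σ BoolSemi)}
    (hG : ∀ g ∈ G, ∀ a : σ →₀ ℕ, monomial a 1 * g ∈ G) {p : MvPolynomial σ BoolSemi} :
    p ∈ Ideal.span G ↔ ∀ u ∈ p.support, ∃ g ∈ G, u ∈ g.support ∧ g.support ⊆ p.support := by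
  classical
  constructor
  · intro hp
    induction hp using Submodule.span_induction with
    | mem g hg => exact fun u hu => ⟨g, hg, hu, subset_rfl⟩
    | zero => simp
    | add p q _ _ hp hq =>
      have hsup : ∀ v, v ∈ (p + q).support ↔ v ∈ p.support ∨ v ∈ q.support := by
        intro v
        rw [mem_support_iff, mem_support_iff, mem_support_iff, coeff_add, Ne, boolSemi_add_eq_zero]
        tauto
      intro u hu
      rcases (hsup u).1 hu with h | h
      · obtain ⟨g, hg, h1, h2⟩ := hp u h
        exact ⟨g, hg, h1, fun v hv => (hsup v).2 (Or.inl (h2 hv))⟩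
      · obtain ⟨g, hg, h1, h2⟩ := hq u h
        exact ⟨g, hg, h1, fun v hv => (hsup v).2 (Or.inr (h2 hv))⟩
    | smul a p _ hp =>
      intro u hu
      rw [smul_eq_mul] at hu ⊢
      obtain ⟨c, hc, b, hb, rfl⟩ := Finset.mem_add.1 (support_mul a p hu)
      obtain ⟨g, hg, h1, h2⟩ := hp b hb
      have hc1 : c ∈ (monomial c (1 : BoolSemi)).support := by
        rw [mem_support_iff, coeff_monomial, if_pos rfl]
        exact boolSemi_one_ne_zero
      refine ⟨monomial c 1 * g, hG g hg c, boolPoly_mul_mem_support hc1 h1, fun v hv => ?_⟩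
      obtain ⟨c', hc', b', hb', rfl⟩ := Finset.mem_add.1 (support_mul _ _ hv)
      have : c' = c := by simpa using support_monomial_subset hc'
      rw [this]
      exact boolPoly_mul_mem_support hc (h2 hb')
  · intro h
    choose! g hg h1 h2 using h
    have : p = ∑ u ∈ p.support, g u := by
      refine boolPoly_ext fun v => ?_
      rw [mem_support_iff (p := ∑ u ∈ p.support, g u), coeff_sum, Ne, boolSemi_sum_eq_zero]
      push Not
      constructor
      · exact fun hv => ⟨v, hv, mem_support_iff.1 (h1 v hv)⟩
      · rintro ⟨u, hu, hv⟩
        exact h2 u hu (mem_support_iff.2 hv)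
    rw [this]
    exact Ideal.sum_mem _ fun u hu => Ideal.subset_span (hg u hu)

/-- The coefficient vector of `f`, with entries in `ℝ ∪ {∞}`. -/
noncomputable def coeffVec (ι : K →+* TropReal) (f : MvPolynomial σ K) : (σ →₀ ℕ) → WithTop ℝ :=
  fun u => Tropical.untrop (ι (coeff u f))

theorem untrop_ne_top {a : TropReal} : Tropical.untrop a ≠ ⊤ ↔ a ≠ 0 := by
  rw [Ne, Ne, ← Tropical.untrop_zero, Tropical.untrop_inj_iff]

theorem coeffVec_ne_top {ι : K →+* TropReal} (hι : ∀ c, ι c = 0 → c = 0) {f : MvPolynomial σ K}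
    {u : σ →₀ ℕ} : coeffVec ι f u ≠ ⊤ ↔ u ∈ f.support := by
  rw [coeffVec, untrop_ne_top, mem_support_iff, not_iff_not]
  exact ⟨hι _, fun h => by rw [h, map_zero]⟩

theorem realIncl_injective_zero : ∀ c, realIncl c = 0 → c = 0 := fun _ h => h

theorem boolIncl_injective_zero : ∀ c, boolIncl c = 0 → c = 0 := fun _ h => Subtype.ext h

variable [Fintype σ]

theorem untrop_termValue (ι : K →+* TropReal) (w : σ → ℝ) (f : MvPolynomial σ K) (u : σ →₀ ℕ) :
    Tropical.untrop (termValue ι (toTrop w) f u) = coeffVec ι f u + (dot w u : WithTop ℝ) := by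
  have : Tropical.untrop (u.prod fun i k => toTrop w i ^ k) = (dot w u : WithTop ℝ) := by
    rw [Finsupp.prod_fintype _ _ (by simp), untrop_prod]
    simp only [Tropical.untrop_pow, toTrop, Tropical.untrop_trop, dot, WithTop.coe_sum]
    refine Finset.sum_congr rfl fun i _ => ?_
    rw [← nsmul_eq_mul, WithTop.coe_nsmul]
  rw [termValue, Tropical.untrop_mul, this]
  rfl

omit [Fintype σ] in
theorem polyValue_eq_sum (ι : K →+* TropReal) (w : σ → TropReal) (f : MvPolynomial σ K) :
    polyValue ι w f = ∑ u ∈ f.support, termValue ι w f u := eval₂_eq ι w f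

omit [Fintype σ] in
theorem untrop_polyValue_le (ι : K →+* TropReal) (w : σ → TropReal)
    (f : MvPolynomial σ K) {u : σ →₀ ℕ} (hu : u ∈ f.support) :
    Tropical.untrop (polyValue ι w f) ≤ Tropical.untrop (termValue ι w f u) := by
  rw [polyValue_eq_sum, Finset.untrop_sum']
  exact Finset.inf_le hu

theorem mem_initSet_coeffVec_iff {ι : K →+* TropReal} (hι : ∀ c, ι c = 0 → c = 0) (w : σ → ℝ)
    (f : MvPolynomial σ K) (u : σ →₀ ℕ) :
    u ∈ initSet w (coeffVec ι f) ↔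
      u ∈ f.support ∧ termValue ι (toTrop w) f u = polyValue ι (toTrop w) f := by
  constructor
  · intro h
    have hu : u ∈ f.support := (coeffVec_ne_top hι).1 (ne_top_of_mem_initSet h)
    refine ⟨hu, Tropical.untrop_injective (le_antisymm ?_ (untrop_polyValue_le ι _ f hu))⟩
    rw [polyValue_eq_sum, Finset.untrop_sum']
    refine Finset.le_inf fun v _ => ?_
    simp only [Function.comp, untrop_termValue]
    exact h.2 v
  · rintro ⟨hu, h⟩
    refine ⟨?_, fun v => ?_⟩
    · simpa using (coeffVec_ne_top hι).2 hu
    · simp only [← untrop_termValue]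
      by_cases hv : v ∈ f.support
      · rw [h]; exact untrop_polyValue_le ι _ f hv
      · have : coeffVec ι f v = ⊤ := by
          by_contra hc; exact hv ((coeffVec_ne_top hι).1 hc)
        rw [untrop_termValue ι w f v, this, top_add]
        exact le_top

theorem mem_support_initialForm {ι : K →+* TropReal} (hι : ∀ c, ι c = 0 → c = 0) (w : σ → ℝ)
    (f : MvPolynomial σ K) (u : σ →₀ ℕ) :
    u ∈ (initialForm ι w f).support ↔ u ∈ initSet w (coeffVec ι f) := by
  classical
  rw [mem_initSet_coeffVec_iff hι, mem_support_iff, initialForm, coeff_sum, Ne,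
    boolSemi_sum_eq_zero]
  push Not
  simp only [Finset.mem_filter, coeff_monomial]
  constructor
  · rintro ⟨v, hv, h⟩
    by_cases hvu : v = u
    · exact hvu ▸ hv
    · rw [if_neg hvu] at h
      exact absurd rfl h
  · intro h
    exact ⟨u, h, by rw [if_pos rfl]; exact boolSemi_one_ne_zero⟩

/-- The initial forms of the elements of `I` have the same supports as those of the vectors
in `S`. -/
def HasInitSets (ι : K →+* TropReal) (I : Ideal (MvPolynomial σ K))
    (S : Set ((σ →₀ ℕ) → WithTop ℝ)) : Prop :=
  ∀ w U, (∃ f ∈ I, initSet w (coeffVec ι f) = U) ↔ ∃ f ∈ S, initSet w f = U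

variable {ι : K →+* TropReal} {I : Ideal (MvPolynomial σ K)} {S : Set ((σ →₀ ℕ) → WithTop ℝ)}

theorem mem_initialIdeal_iff (hι : ∀ c, ι c = 0 → c = 0) (hS : IsTropSystem S)
    (hI : HasInitSets ι I S) (w : σ → ℝ) (p : MvPolynomial σ BoolSemi) :
    p ∈ initialIdeal ι w I ↔
      ∀ u ∈ p.support, ∃ f ∈ S, u ∈ initSet w f ∧ initSet w f ⊆ p.support := by
  rw [initialIdeal, boolPoly_mem_span_iff]
  · refine forall₂_congr fun u _ => ?_
    constructor
    · rintro ⟨_, ⟨f, hf, rfl⟩, h1, h2⟩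
      obtain ⟨g, hg, hgf⟩ := (hI w _).1 ⟨f, hf, rfl⟩
      rw [mem_support_initialForm hι] at h1
      refine ⟨g, hg, hgf ▸ h1, fun v hv => h2 ?_⟩
      rw [mem_support_initialForm hι]
      exact hgf ▸ hv
    · rintro ⟨g, hg, h1, h2⟩
      obtain ⟨f, hf, hfg⟩ := (hI w _).2 ⟨g, hg, rfl⟩
      refine ⟨_, ⟨f, hf, rfl⟩, ?_, fun v hv => h2 ?_⟩
      · rw [mem_support_initialForm hι]; exact hfg ▸ h1
      · rw [mem_support_initialForm hι] at hv; exact hfg ▸ hv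
  · rintro _ ⟨f, hf, rfl⟩ a
    obtain ⟨g, hg, hgf⟩ := (hI w _).1 ⟨f, hf, rfl⟩
    obtain ⟨k, hk, hkg⟩ := hS.exists_shift hg a w
    obtain ⟨f', hf', hfk⟩ := (hI w _).2 ⟨k, hk, rfl⟩
    refine ⟨f', hf', boolPoly_ext fun v => ?_⟩
    rw [mem_support_initialForm hι, hfk, hkg, hgf]
    classical
    constructor
    · intro hv
      obtain ⟨c, hc, b, hb, rfl⟩ := Finset.mem_add.1 (support_mul _ _ hv)
      have : c = a := by simpa using support_monomial_subset hc
      rw [mem_support_initialForm hι] at hb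
      exact ⟨b, hb, by rw [this]; exact add_comm _ _⟩
    · rintro ⟨b, hb, rfl⟩
      have hc1 : a ∈ (monomial a (1 : BoolSemi)).support := by
        rw [mem_support_iff, coeff_monomial, if_pos rfl]
        exact boolSemi_one_ne_zero
      change b + a ∈ _
      rw [add_comm b a]
      refine boolPoly_mul_mem_support hc1 ?_
      rw [mem_support_initialForm hι]
      exact hb

theorem initialIdeal_eq_iff (hι : ∀ c, ι c = 0 → c = 0) (hS : IsTropSystem S)
    (hI : HasInitSets ι I S) {w w' : σ → ℝ} :
    initialIdeal ι w I = initialIdeal ι w' I ↔ InitLE S w w' ∧ InitLE S w' w := by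
  have h1 : ∀ {w w'}, initialIdeal ι w I = initialIdeal ι w' I → InitLE S w w' := by
    intro w w' h g hg u hu
    obtain ⟨f, hf, hfg⟩ := (hI w _).2 ⟨g, hg, rfl⟩
    have hp : initialForm ι w f ∈ initialIdeal ι w' I := by
      rw [← h]; exact Ideal.subset_span ⟨f, hf, rfl⟩
    rw [mem_initialIdeal_iff hι hS hI] at hp
    obtain ⟨k, hk, h1, h2⟩ := hp u ((mem_support_initialForm hι w f u).2 (hfg ▸ hu))
    exact ⟨k, hk, h1, fun v hv => hfg ▸ (mem_support_initialForm hι w f v).1 (h2 hv)⟩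
  have h2 : ∀ {w w'}, InitLE S w w' → initialIdeal ι w I ≤ initialIdeal ι w' I := by
    intro w w' h p hp
    rw [mem_initialIdeal_iff hι hS hI] at hp ⊢
    intro u hu
    obtain ⟨f, hf, hu', hsub⟩ := hp u hu
    obtain ⟨g, hg, hug, hgs⟩ := h f hf u hu'
    exact ⟨g, hg, hug, hgs.trans hsub⟩
  exact ⟨fun h => ⟨h1 h, h1 h.symm⟩, fun h => le_antisymm (h2 h.1) (h2 h.2)⟩

theorem initialIdeal_eq_iff_bases [DecidableEq σ] (hι : ∀ c, ι c = 0 → c = 0)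
    (hS : IsTropSystem S) (hI : HasInitSets ι I S) {D : ℕ} (hD : GeneratedBy S D)
    {lt : (σ →₀ ℕ) → (σ →₀ ℕ) → Prop} (hlt : IsMonomialOrder lt) {w w' : σ → ℝ} :
    initialIdeal ι w I = initialIdeal ι w' I ↔
      bases (monos σ D) (trunc S D) w = bases (monos σ D) (trunc S D) w' :=
  (initialIdeal_eq_iff hι hS hI).trans (hS.initLE_iff hD hlt)

theorem groebnerComplex_eq [DecidableEq σ] (hι : ∀ c, ι c = 0 → c = 0)
    (hS : IsTropSystem S) (hI : HasInitSets ι I S) {D : ℕ} (hD : GeneratedBy S D)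
    {lt : (σ →₀ ℕ) → (σ →₀ ℕ) → Prop} (hlt : IsMonomialOrder lt) :
    groebnerComplex ι I = Set.range (cell (monos σ D) (trunc S D)) := by
  ext P
  simp only [groebnerComplex, Set.mem_ofPred_eq, Set.mem_range,
    initialIdeal_eq_iff_bases hι hS hI hD hlt, closure_bases_eq (hS.isElim_trunc D)]
  exact ⟨fun ⟨w, h⟩ => ⟨w, h.symm⟩, fun ⟨w, h⟩ => ⟨w, h.symm⟩⟩

/-- The coefficient vectors of the elements of an ideal over the tropical semiring. -/
def coeffVecs (I : Ideal (MvPolynomial σ TropReal)) : Set ((σ →₀ ℕ) → WithTop ℝ) :=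
  {g | ∃ f ∈ I, g = coeffVec realIncl f}

omit [Fintype σ] in
theorem isTropSystem_coeffVecs {I : Ideal (MvPolynomial σ TropReal)} (hI : IsTropicalIdeal I)
    (hhom : IsHomogeneousIdeal I) : IsTropSystem (coeffVecs I) where
  finite := by
    rintro _ ⟨f, hf, rfl⟩
    exact f.support.finite_toSet.subset fun u hu => (coeffVec_ne_top realIncl_injective_zero).1 hu
  scale := by
    rintro _ ⟨f, hf, rfl⟩ r
    refine ⟨C (Tropical.trop (r : WithTop ℝ)) * f, I.mul_mem_left _ hf, funext fun u => ?_⟩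
    simp only [coeffVec, coeff_C_mul, map_mul, Tropical.untrop_mul, RingHom.id_apply,
      Tropical.untrop_trop]
    exact add_comm _ _
  elim := by
    rintro _ ⟨f, hf, rfl⟩ _ ⟨g, hg, rfl⟩ u huv hu
    obtain ⟨h, hh, h1, h2⟩ := hI f hf g hg u (Tropical.untrop_injective huv) (untrop_ne_top.1 hu)
    refine ⟨_, ⟨h, hh, rfl⟩, ?_, fun v => ⟨?_, fun hne => ?_⟩⟩
    · simp only [coeffVec, RingHom.id_apply, h1, Tropical.untrop_zero]
    · exact Tropical.untrop_monotone (h2 v).1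
    · have := (h2 v).2 fun hc => hne (by simp only [coeffVec, hc])
      simp only [coeffVec, RingHom.id_apply, this]
      exact Tropical.untrop_monotone.map_min
  shift := by
    rintro _ ⟨f, hf, rfl⟩ a
    refine ⟨_, ⟨monomial a 1 * f, I.mul_mem_left _ hf, rfl⟩, fun u => ?_, fun v hv => ?_⟩
    · rw [coeffVec, coeffVec, add_comm u a, coeff_monomial_mul, one_mul]
    · have := (coeffVec_ne_top realIncl_injective_zero).1 hv
      rw [mem_support_iff, coeff_monomial_mul'] at this
      by_cases hav : a ≤ v
      · exact ⟨v - a, (tsub_add_cancel_of_le hav).symm⟩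
      · rw [if_neg hav] at this
        exact absurd rfl this
  component := by
    rintro _ ⟨f, hf, rfl⟩ d
    refine ⟨_, ⟨homogeneousComponent d f, hhom f hf d, rfl⟩, fun u hu => ?_, fun u hu => ?_⟩
    · rw [coeffVec, coeffVec, coeff_homogeneousComponent, if_pos hu]
    · rw [coeffVec, coeff_homogeneousComponent, if_neg hu, map_zero, Tropical.untrop_zero]

theorem hasInitSets_coeffVecs (I : Ideal (MvPolynomial σ TropReal)) :
    HasInitSets realIncl I (coeffVecs I) := by
  intro w U
  constructor
  · rintro ⟨f, hf, h⟩
    exact ⟨_, ⟨f, hf, rfl⟩, h⟩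
  · rintro ⟨_, ⟨f, hf, rfl⟩, h⟩
    exact ⟨f, hf, h⟩

omit [Fintype σ] in
theorem trivHom_surjective : Function.Surjective trivHom := by
  intro b
  rcases boolSemi_eq_zero_or_one b with rfl | rfl
  · exact ⟨0, map_zero _⟩
  · exact ⟨1, map_one _⟩

omit [Fintype σ] in
theorem mem_trivialization_iff {I : Ideal (MvPolynomial σ TropReal)}
    {g : MvPolynomial σ BoolSemi} :
    g ∈ trivialization I ↔ ∃ f ∈ I, MvPolynomial.map trivHom f = g :=
  Ideal.mem_map_iff_of_surjective (MvPolynomial.map trivHom)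
    (MvPolynomial.map_surjective _ trivHom_surjective)

omit [Fintype σ] in
theorem coeffVec_map_trivHom (f : MvPolynomial σ TropReal) :
    coeffVec boolIncl (MvPolynomial.map trivHom f) = flatten (coeffVec realIncl f) 0 := by
  funext u
  by_cases hu : coeff u f = 0
  · rw [flatten_eq_top.2 (by simp [coeffVec, hu]), coeffVec, coeff_map, hu]
    simp
  · rw [flatten_of_ne_top (by simpa [coeffVec] using untrop_ne_top.2 hu), coeffVec, coeff_map]
    have : trivHom (coeff u f) = 1 := if_neg hu
    rw [this, map_one, Tropical.untrop_one]
    rfl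

theorem hasInitSets_flat_coeffVecs (I : Ideal (MvPolynomial σ TropReal)) :
    HasInitSets boolIncl (trivialization I) (flat (coeffVecs I)) := by
  intro w U
  constructor
  · rintro ⟨g, hg, h⟩
    obtain ⟨f, hf, rfl⟩ := mem_trivialization_iff.1 hg
    exact ⟨_, ⟨_, ⟨f, hf, rfl⟩, 0, rfl⟩, by rw [← coeffVec_map_trivHom, h]⟩
  · rintro ⟨_, ⟨_, ⟨f, hf, rfl⟩, r, rfl⟩, h⟩
    refine ⟨_, mem_trivialization_iff.2 ⟨f, hf, rfl⟩, ?_⟩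
    rw [coeffVec_map_trivHom, ← initSet_flatten w _ r, h]

end Polynomials

/-! ### Farkas' lemma -/

section Farkas

/-- Farkas' lemma over a linearly ordered field, by Bartl's induction on the number of
inequalities. -/
theorem farkas {𝕜 V κ : Type*} [Field 𝕜] [LinearOrder 𝕜] [IsStrictOrderedRing 𝕜] [AddCommGroup V]
    [Module 𝕜 V] (s : Finset κ) (a : κ → Module.Dual 𝕜 V) (c : Module.Dual 𝕜 V)
    (h : ∀ x, (∀ i ∈ s, 0 ≤ a i x) → 0 ≤ c x) :
    ∃ l : κ → 𝕜, (∀ i, 0 ≤ l i) ∧ c = ∑ i ∈ s, l i • a i := by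
  classical
  induction s using Finset.induction_on generalizing a c with
  | empty =>
    refine ⟨0, fun _ => le_rfl, ?_⟩
    ext x
    have h1 := h x (by simp)
    have h2 := h (-x) (by simp)
    rw [map_neg] at h2
    simp only [Finset.sum_empty, LinearMap.zero_apply]
    linarith
  | insert j s hj ih =>
    by_cases hc : ∀ x, (∀ i ∈ s, 0 ≤ a i x) → 0 ≤ c x
    · obtain ⟨l, hl, hcl⟩ := ih a c hc
      refine ⟨fun i => if i = j then 0 else l i, fun i => by dsimp only; split_ifs <;> simp [hl],
        ?_⟩
      rw [Finset.sum_insert hj, hcl]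
      simp only [if_true, zero_smul, zero_add]
      refine Finset.sum_congr rfl fun i hi => ?_
      rw [if_neg (fun h' : i = j => hj (h' ▸ hi))]
    · push Not at hc
      obtain ⟨x₁, hx₁, hcx₁⟩ := hc
      have haj : a j x₁ < 0 := by
        by_contra hcon
        refine absurd (h x₁ fun i hi => ?_) (not_le.2 hcx₁)
        rcases Finset.mem_insert.1 hi with rfl | hi
        · exact not_lt.1 hcon
        · exact hx₁ i hi
      -- normalize, so that `a j` takes the value `-1`
      set x₀ : V := (-(a j x₁))⁻¹ • x₁ with hx₀
      have hpos : 0 < (-(a j x₁))⁻¹ := inv_pos.2 (by linarith)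
      have hj0 : a j x₀ = -1 := by
        rw [hx₀, map_smul, smul_eq_mul, inv_neg, neg_mul, inv_mul_cancel₀ haj.ne]
      have hi0 : ∀ i ∈ s, 0 ≤ a i x₀ := fun i hi => by
        rw [hx₀, map_smul]; exact mul_nonneg hpos.le (hx₁ i hi)
      have hc0 : c x₀ ≤ 0 := by
        rw [hx₀, map_smul]; exact mul_nonpos_of_nonneg_of_nonpos hpos.le hcx₁.le
      obtain ⟨l, hl, hcl⟩ := ih (fun i => a i + a i x₀ • a j) (c + c x₀ • a j) fun x hx => by
        have := h (x + a j x • x₀) fun i hi => by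
          rcases Finset.mem_insert.1 hi with rfl | hi
          · simp [hj0]
          · have := hx i hi
            simp only [LinearMap.add_apply, LinearMap.smul_apply, smul_eq_mul] at this
            simp only [map_add, map_smul, smul_eq_mul]
            linarith
        simp only [map_add, map_smul, smul_eq_mul] at this
        simp only [LinearMap.add_apply, LinearMap.smul_apply, smul_eq_mul]
        linarith
      refine ⟨fun i => if i = j then ∑ k ∈ s, l k * a k x₀ - c x₀ else l i, fun i => ?_, ?_⟩
      · dsimp only
        split_ifs
        · have : 0 ≤ ∑ k ∈ s, l k * a k x₀ :=
            Finset.sum_nonneg fun k hk => mul_nonneg (hl k) (hi0 k hk)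
          linarith
        · exact hl i
      · rw [Finset.sum_insert hj]
        dsimp only
        rw [if_pos rfl]
        have h1 : ∑ i ∈ s, (if i = j then ∑ k ∈ s, l k * a k x₀ - c x₀ else l i) • a i =
            ∑ i ∈ s, l i • a i :=
          Finset.sum_congr rfl fun i hi => by
            rw [if_neg (fun h' : i = j => hj (h' ▸ hi))]
        rw [h1]
        have h2 : c = ∑ i ∈ s, l i • (a i + a i x₀ • a j) - c x₀ • a j := by
          rw [← hcl]; abel
        conv_lhs => rw [h2]
        simp only [smul_add, Finset.sum_add_distrib, smul_smul, ← Finset.sum_smul]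
        module

end Farkas

/-! ### Weight vectors that represent monomial orders -/

section TermOrder

variable {σ : Type*}

theorem IsMonomialOrder.nsmul {lt : (σ →₀ ℕ) → (σ →₀ ℕ) → Prop} (h : IsMonomialOrder lt)
    {u v : σ →₀ ℕ} (huv : lt u v) {k : ℕ} (hk : 0 < k) : lt (k • u) (k • v) := by
  induction k, hk using Nat.le_induction with
  | base => simpa using huv
  | succ k _ ih =>
    rw [succ_nsmul, succ_nsmul]
    refine h.trans _ _ _ (h.add_right _ _ u ih) ?_
    rw [add_comm (k • v), add_comm (k • v)]
    exact h.add_right _ _ _ huv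

theorem IsMonomialOrder.sum_lt {lt : (σ →₀ ℕ) → (σ →₀ ℕ) → Prop} (h : IsMonomialOrder lt)
    (Q : Finset ((σ →₀ ℕ) × (σ →₀ ℕ))) (hQ : ∀ q ∈ Q, lt q.1 q.2)
    (k : (σ →₀ ℕ) × (σ →₀ ℕ) → ℕ) :
    (∀ q ∈ Q, k q = 0) ∨ lt (∑ q ∈ Q, k q • q.1) (∑ q ∈ Q, k q • q.2) := by
  classical
  induction Q using Finset.induction_on with
  | empty => simp
  | insert a Q ha ih =>
    rw [Finset.sum_insert ha, Finset.sum_insert ha]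
    have hlt := hQ a (Finset.mem_insert_self _ _)
    rcases (k a).eq_zero_or_pos with h0 | hpos
    · rcases ih fun q hq => hQ q (Finset.mem_insert_of_mem hq) with h1 | h1
      · left
        intro q hq
        rcases Finset.mem_insert.1 hq with rfl | hq
        · exact h0
        · exact h1 q hq
      · right
        rw [h0, zero_nsmul, zero_nsmul, zero_add, zero_add]
        exact h1
    · right
      have h2 := h.nsmul hlt hpos
      rcases ih fun q hq => hQ q (Finset.mem_insert_of_mem hq) with h1 | h1
      · rw [Finset.sum_eq_zero fun q hq => by rw [h1 q hq, zero_nsmul],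
          Finset.sum_eq_zero fun q hq => by rw [h1 q hq, zero_nsmul], add_zero, add_zero]
        exact h2
      · refine h.trans _ _ _ (h.add_right _ _ _ h2) ?_
        rw [add_comm (k a • a.2), add_comm (k a • a.2)]
        exact h.add_right _ _ _ h1

theorem exists_common_denominator {κ : Type*} (s : Finset κ) (l : κ → ℚ) (hl : ∀ i, 0 ≤ l i) :
    ∃ N : ℕ, 0 < N ∧ ∀ i ∈ s, ∃ k : ℕ, (N : ℚ) * l i = k := by
  classical
  induction s using Finset.induction_on with
  | empty => exact ⟨1, one_pos, by simp⟩
  | insert a s ha ih =>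
    obtain ⟨N, hN, h⟩ := ih
    refine ⟨N * (l a).den, Nat.mul_pos hN (l a).den_pos, fun i hi => ?_⟩
    rcases Finset.mem_insert.1 hi with rfl | hi
    · refine ⟨N * (l i).num.toNat, ?_⟩
      have h1 : (((l i).num.toNat : ℤ) : ℚ) = (l i).num := by
        rw [Int.toNat_of_nonneg (Rat.num_nonneg.2 (hl i))]
      have h2 := Rat.mul_den_eq_num (l i)
      push_cast at h1 ⊢
      rw [h1, ← h2]
      ring
    · obtain ⟨k, hk⟩ := h i hi
      refine ⟨(l a).den * k, ?_⟩
      push_cast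
      rw [← hk]
      ring

variable [Fintype σ]

/-- On finitely many pairs, a monomial order is given by a weight vector: by Farkas' lemma over
`ℚ`, there would otherwise be a nontrivial relation `∑ k_q u_q = ∑ k_q v_q` with `u_q ≺ v_q`. -/
theorem IsMonomialOrder.exists_weight {lt : (σ →₀ ℕ) → (σ →₀ ℕ) → Prop} (h : IsMonomialOrder lt)
    (Q : Finset ((σ →₀ ℕ) × (σ →₀ ℕ))) (hQ : ∀ q ∈ Q, lt q.1 q.2) :
    ∃ w : σ → ℝ, ∀ q ∈ Q, dot w q.1 < dot w q.2 := by
  let φ : (σ →₀ ℕ) → Module.Dual ℚ ((σ → ℚ) × ℚ) := fun u =>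
    ∑ i, (u i : ℚ) • (LinearMap.proj i ∘ₗ LinearMap.fst ℚ _ _)
  have hφ : ∀ u x, φ u x = ∑ i, (u i : ℚ) * x.1 i := fun u x => by simp [φ]
  let a : (σ →₀ ℕ) × (σ →₀ ℕ) → Module.Dual ℚ ((σ → ℚ) × ℚ) := fun q =>
    φ q.2 - φ q.1 - LinearMap.snd ℚ _ _
  let c : Module.Dual ℚ ((σ → ℚ) × ℚ) := -LinearMap.snd ℚ _ _
  by_cases hc : ∀ x, (∀ q ∈ Q, 0 ≤ a q x) → 0 ≤ c x
  · exfalso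
    obtain ⟨l, hl, hcl⟩ := farkas Q a c hc
    have hsum : ∑ q ∈ Q, l q = 1 := by
      have := LinearMap.congr_fun hcl (0, 1)
      simp [a, c, hφ] at this
      linarith
    obtain ⟨N, hN, hk⟩ := exists_common_denominator Q l hl
    choose! k hk using hk
    have hrel : ∑ q ∈ Q, k q • q.1 = ∑ q ∈ Q, k q • q.2 := by
      classical
      ext i
      have := LinearMap.congr_fun hcl (Pi.single i 1, 0)
      simp only [a, c, hφ, LinearMap.sum_apply, LinearMap.smul_apply, LinearMap.sub_apply,
        LinearMap.snd_apply, LinearMap.neg_apply, smul_eq_mul, Pi.single_apply, mul_ite, mul_one,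
        mul_zero, Finset.sum_ite_eq', Finset.mem_univ, if_true, sub_zero, neg_zero] at this
      have h1 : (N : ℚ) * ∑ q ∈ Q, l q * ((q.2 i : ℚ) - q.1 i) = 0 := by rw [← this, mul_zero]
      rw [Finset.mul_sum, Finset.sum_congr rfl fun q hq => by rw [← mul_assoc, hk q hq]] at h1
      simp only [mul_sub, Finset.sum_sub_distrib] at h1
      rw [Finsupp.finsetSum_apply, Finsupp.finsetSum_apply]
      have h2 : ((∑ q ∈ Q, (k q • q.1) i : ℕ) : ℚ) = ((∑ q ∈ Q, (k q • q.2) i : ℕ) : ℚ) := by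
        push_cast [Finsupp.smul_apply, smul_eq_mul]
        linarith
      exact_mod_cast h2
    rcases h.sum_lt Q hQ k with h1 | h1
    · have h2 : (N : ℚ) * ∑ q ∈ Q, l q = 0 := by
        rw [Finset.mul_sum]
        exact Finset.sum_eq_zero fun q hq => by rw [hk q hq, h1 q hq, Nat.cast_zero]
      rw [hsum, mul_one] at h2
      exact hN.ne' (by exact_mod_cast h2)
    · rw [hrel] at h1
      exact h.irrefl _ h1
  · push Not at hc
    obtain ⟨x, hx, hcx⟩ := hc
    refine ⟨fun i => (x.1 i : ℝ), fun q hq => ?_⟩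
    have h1 := hx q hq
    simp only [a, c, LinearMap.sub_apply, LinearMap.snd_apply, LinearMap.neg_apply] at h1 hcx
    have h2 : φ q.1 x < φ q.2 x := by linarith
    rw [hφ, hφ] at h2
    simp only [dot]
    exact_mod_cast h2

end TermOrder

/-! ### Maximal cones and term orders -/

section MaximalCells

variable {σ : Type*} [Fintype σ] [DecidableEq σ] {A : Finset (σ →₀ ℕ)}
  {L : Set ((σ →₀ ℕ) → WithTop ℝ)}

theorem isClosed_region (hL : IsElim A L) (B : Finset (σ →₀ ℕ)) :
    IsClosed {w | B ∈ bases A L w} := by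
  by_cases hB : IsSuppBase A L B
  · obtain ⟨g, hg⟩ := exists_fund_of_isSuppBase B hB
    simp only [mem_bases_iff hL hB hg, Set.ofPred_forall, dot]
    refine isClosed_iInter fun e => isClosed_iInter fun _ => isClosed_iInter fun _ =>
      isClosed_iInter fun b => isClosed_iInter fun _ => isClosed_iInter fun c =>
      isClosed_iInter fun _ => isClosed_le (by fun_prop) (by fun_prop)
  · convert isClosed_empty
    ext w
    exact ⟨fun h => hB (isSuppBase_of_mem_bases hL h), fun h => h.elim⟩

theorem isOpen_bases_eq_singleton (hL : IsElim A L) (B : Finset (σ →₀ ℕ)) :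
    IsOpen {w | bases A L w = {B}} := by
  have : {w | bases A L w = {B}} = (⋃ C ∈ (A.powerset.erase B), {w | C ∈ bases A L w})ᶜ := by
    ext w
    simp only [Set.mem_ofPred_eq, Set.mem_compl_iff, Set.mem_iUnion, not_exists,
      Finset.mem_erase, Finset.mem_powerset]
    constructor
    · intro h C hC hCw
      rw [h] at hCw
      exact hC.1 hCw
    · intro h
      refine (bases_nonempty w).subset_singleton_iff.1 fun C hC => ?_
      by_contra hCB
      exact h C ⟨hCB, hC.1⟩ hC
  rw [this, isOpen_compl_iff]
  exact Set.Finite.isClosed_biUnion (Finset.finite_toSet _) fun C _ => isClosed_region hL C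

theorem interior_cell_of_bases_eq_singleton (hL : IsElim A L) {w : σ → ℝ} {B : Finset (σ →₀ ℕ)}
    (hw : bases A L w = {B}) : interior (cell A L w) = {x | bases A L x = {B}} := by
  refine Set.Subset.antisymm (fun x hx => ?_) (interior_maximal (fun x hx => ?_)
    (isOpen_bases_eq_singleton hL B))
  · have hcont : Continuous fun ε : ℝ => x + ε • (x - w) := by fun_prop
    have hev : ∀ᶠ ε : ℝ in nhdsWithin 0 (Set.Ioi 0), x + ε • (x - w) ∈ cell A L w := by
      refine Filter.Eventually.filter_mono nhdsWithin_le_nhds ?_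
      have : interior (cell A L w) ∈ nhds (x + (0 : ℝ) • (x - w)) := by
        simpa using isOpen_interior.mem_nhds hx
      filter_upwards [hcont.continuousAt this] with ε hε
      exact interior_subset hε
    obtain ⟨ε, hy, hε : 0 < ε⟩ := (hev.and self_mem_nhdsWithin).exists
    set y := x + ε • (x - w) with hyd
    have hBw : B ∈ bases A L w := hw ▸ rfl
    have hxy : x = y + (ε / (1 + ε)) • (w - y) := by
      funext i
      simp only [hyd, Pi.add_apply, Pi.smul_apply, Pi.sub_apply, smul_eq_mul]
      field_simp
      ring
    change bases A L x = {B}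
    rw [hxy, bases_segment hL (hy hBw) hBw (by positivity)
      (by rw [div_lt_one (by positivity)]; linarith), hw]
    exact Set.inter_eq_self_of_subset_right (Set.singleton_subset_iff.2 (hy hBw))
  · change bases A L w ⊆ bases A L x
    rw [hw, show bases A L x = {B} from hx]

omit [DecidableEq σ] in
theorem bases_eq_of_cell_eq {w w' : σ → ℝ} (h : cell A L w = cell A L w') :
    bases A L w = bases A L w' :=
  Set.Subset.antisymm (h ▸ mem_cell_self w' : w' ∈ cell A L w)
    (h ▸ mem_cell_self w : w ∈ cell A L w')

omit [DecidableEq σ] in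
theorem cell_maximal_of_bases_eq_singleton {w : σ → ℝ} {B : Finset (σ →₀ ℕ)}
    (hw : bases A L w = {B}) : Maximal (fun P => P ∈ Set.range (cell A L)) (cell A L w) := by
  refine ⟨⟨w, rfl⟩, ?_⟩
  rintro _ ⟨x, rfl⟩ hle
  have hx : bases A L x ⊆ bases A L w := hle (mem_cell_self w)
  rw [hw, (bases_nonempty x).subset_singleton_iff] at hx
  intro y hy
  change bases A L w ⊆ bases A L y
  rw [hw, ← hx]
  exact hy

variable {S : Set ((σ →₀ ℕ) → WithTop ℝ)}

/-- For each monomial order there is a weight vector at which all initial forms of the trivialized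
system are determined by the leading monomials. -/
theorem IsTropSystem.exists_weight_of_order (hS : IsTropSystem S) {D : ℕ}
    (hD : GeneratedBy (flat S) D) {lt : (σ →₀ ℕ) → (σ →₀ ℕ) → Prop} (hlt : IsMonomialOrder lt) :
    ∃ w : σ → ℝ, (∀ u ∈ leadSet (flat S) 0 lt, ∃ f ∈ flat S, initSet w f = {u}) ∧
      leadSet (flat S) w lt = leadSet (flat S) 0 lt ∧
      bases (monos σ D) (trunc (flat S) D) w = {stdMonos (flat S) 0 lt D} := by
  classical
  have hF := hS.isTropSystem_flat
  obtain ⟨w, hw⟩ := hlt.exists_weight ((monos σ D ×ˢ monos σ D).filter fun q => lt q.1 q.2)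
    fun q hq => (Finset.mem_filter.1 hq).2
  have hw' : ∀ e b, e.degree ≤ D → b.degree ≤ D → lt e b → dot w e < dot w b :=
    fun e b he hb hlt => hw (e, b) (Finset.mem_filter.2
      ⟨Finset.mem_product.2 ⟨mem_monos.2 he, mem_monos.2 hb⟩, hlt⟩)
  have h1 : ∀ u ∈ leadSet (flat S) 0 lt, ∃ f ∈ flat S, initSet w f = {u} := by
    intro u hu
    obtain ⟨m, hm, hmu, hmD⟩ := hD 0 lt hlt u hu
    obtain ⟨f, hf, hmf, hmin⟩ := hF.exists_trunc_of_mem_leadSet hm hmD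
    have hfm : initSet w f = {m} := by
      obtain ⟨g, hg, r, rfl⟩ := hf.1
      have hgm : g m ≠ ⊤ := (mem_initSet_flatten.1 hmf).1
      have hlt' : ∀ v, g v ≠ ⊤ → v ≠ m → dot w m < dot w v := by
        intro v hv hne
        refine hw' m v hmD (hf.2 v fun hc => hv (flatten_eq_top.1 hc)) (hmin v ?_ hne)
        rw [mem_initSet_flatten]
        exact ⟨hv, fun z _ => by simp [dot_zero_left]⟩
      ext v
      rw [mem_initSet_flatten, Set.mem_singleton_iff]
      constructor
      · rintro ⟨hv, hle⟩
        by_contra hne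
        exact absurd (hlt' v hv hne) (not_lt.2 (hle m hgm))
      · rintro rfl
        refine ⟨hgm, fun z hz => ?_⟩
        by_cases hzv : z = v
        · rw [hzv]
        · exact (hlt' z hz hzv).le
    obtain ⟨a, rfl⟩ := exists_add_of_le hmu
    obtain ⟨k, hk, hkf⟩ := hF.exists_shift hf.1 a w
    exact ⟨k, hk, by rw [hkf, hfm, Set.image_singleton]⟩
  have hsub : leadSet (flat S) 0 lt ⊆ leadSet (flat S) w lt := by
    intro u hu
    obtain ⟨f, hf, hfu⟩ := h1 u hu
    exact ⟨f, hf, hfu ▸ rfl, fun v hv hne => absurd (by rw [hfu] at hv; exact hv) hne⟩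
  have hstd : ∀ d, stdMonos (flat S) w lt d = stdMonos (flat S) 0 lt d := by
    intro d
    refine (isSuppBase_of_mem_bases (hF.isElim_trunc d)
      (hF.stdMonos_mem_bases w hlt d)).eq_of_subset (isSuppBase_of_mem_bases (hF.isElim_trunc d)
      (hF.stdMonos_mem_bases 0 hlt d)) fun u hu => ?_
    rw [mem_stdMonos] at hu ⊢
    exact ⟨hu.1, fun hc => hu.2 (hsub hc)⟩
  refine ⟨w, h1, Set.Subset.antisymm (fun u hu => ?_) hsub, ?_⟩
  · by_contra hc
    have : u ∈ stdMonos (flat S) 0 lt u.degree := mem_stdMonos.2 ⟨le_rfl, hc⟩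
    rw [← hstd] at this
    exact (mem_stdMonos.1 this).2 hu
  · refine (bases_nonempty w).subset_singleton_iff.1 fun C hC => ?_
    have hL := hF.isElim_trunc D
    refine (isSuppBase_of_mem_bases hL hC).eq_of_subset
      (isSuppBase_of_mem_bases hL (hF.stdMonos_mem_bases 0 hlt D)) fun u hu => ?_
    rw [mem_stdMonos]
    have huD : u.degree ≤ D := mem_monos.1 (hC.1 hu)
    refine ⟨huD, fun hlead => ?_⟩
    obtain ⟨f, hf, hfu⟩ := h1 u hlead
    obtain ⟨k, hk, huk, hks⟩ := hF.exists_trunc hf (hfu ▸ rfl : u ∈ initSet w f) huD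
    refine hC.2.1 _ ⟨k, hk, rfl⟩ ⟨u, huk⟩ fun v hv => ?_
    have hv' := hks hv
    rw [hfu] at hv'
    rw [Set.mem_singleton_iff.1 hv']
    exact_mod_cast hu

omit [DecidableEq σ] in
/-- Comparing monomials by decreasing degree first, then by the weight `v`, and then by `lt`, makes
`1` the largest monomial, whatever the signs of the entries of `v`. -/
theorem isTermOrder_weightOrder {lt : (σ →₀ ℕ) → (σ →₀ ℕ) → Prop} (hlt : IsMonomialOrder lt)
    (v : σ → ℝ) : IsTermOrder (weightOrder (fun _ => -1) (weightOrder v lt)) := by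
  have h := (hlt.weightOrder v).weightOrder (fun _ => -1)
  refine ⟨h.irrefl, h.trans, h.total, h.add_right, fun u hu => Or.inl ?_⟩
  obtain ⟨i, hi⟩ := Finsupp.ne_iff.1 hu
  have h1 : (0 : ℝ) < ∑ i, (u i : ℝ) :=
    Finset.sum_pos' (fun i _ => Nat.cast_nonneg _)
      ⟨i, Finset.mem_univ _, Nat.cast_pos.2 (Nat.pos_of_ne_zero hi)⟩
  simp only [dot, mul_neg, mul_one, Finset.sum_neg_distrib, Finsupp.coe_zero, Pi.zero_apply,
    Nat.cast_zero, Finset.sum_const_zero, neg_zero]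
  linarith

omit [DecidableEq σ] in
theorem dot_neg_one (u : σ →₀ ℕ) : dot (fun _ => -1) u = -(u.degree : ℝ) := by
  simp [dot, Finsupp.degree_eq_sum]

theorem IsTropSystem.leadSet_weightOrder (hS : IsTropSystem S)
    {lt : (σ →₀ ℕ) → (σ →₀ ℕ) → Prop} (v : σ → ℝ) :
    leadSet (flat S) 0 (weightOrder (fun _ => -1) (weightOrder v lt)) =
      leadSet (flat S) v lt := by
  have hF := hS.isTropSystem_flat
  ext u
  constructor
  · rintro ⟨f, hf, huf, hmin⟩
    obtain ⟨k, ⟨g, hg, r, rfl⟩, huk, hks, hkd⟩ := hF.exists_component hf huf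
    have hgu := (mem_initSet_flatten.1 huk).1
    have key : ∀ z, g z ≠ ⊤ → z ≠ u → weightOrder v lt u z := by
      intro z hz hne
      have hz0 : z ∈ initSet 0 (flatten g r) := by
        rw [mem_initSet_flatten]
        exact ⟨hz, fun _ _ => by simp [dot_zero_left]⟩
      rcases hmin z (hks hz0) hne with h | h
      · rw [dot_neg_one, dot_neg_one, (hkd z fun hc => hz (flatten_eq_top.1 hc)).1] at h
        exact absurd h (lt_irrefl _)
      · exact h.2
    refine ⟨_, ⟨g, hg, r, rfl⟩, mem_initSet_flatten.2 ⟨hgu, fun z hz => ?_⟩, fun z hz hne => ?_⟩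
    · by_cases hzu : z = u
      · rw [hzu]
      · rcases key z hz hzu with h | h
        · exact h.le
        · exact h.1.le
    · rw [mem_initSet_flatten] at hz
      rcases key z hz.1 hne with h | h
      · exact absurd h (not_lt.2 (hz.2 u hgu))
      · exact h.2
  · rintro ⟨f, hf, huf, hmin⟩
    obtain ⟨k, ⟨g, hg, r, rfl⟩, huk, hks, hkd⟩ := hF.exists_component hf huf
    obtain ⟨hgu, hle⟩ := mem_initSet_flatten.1 huk
    refine ⟨_, ⟨g, hg, r, rfl⟩, ?_, fun z hz hne => ?_⟩
    · rw [mem_initSet_flatten]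
      exact ⟨hgu, fun _ _ => by simp [dot_zero_left]⟩
    · have hgz := (mem_initSet_flatten.1 hz).1
      refine Or.inr ⟨?_, ?_⟩
      · rw [dot_neg_one, dot_neg_one, (hkd z fun hc => hgz (flatten_eq_top.1 hc)).1]
      · rcases (hle z hgz).lt_or_eq with h | h
        · exact Or.inl h
        · refine Or.inr ⟨h, hmin z (hks ?_) hne⟩
          rw [mem_initSet_flatten]
          exact ⟨hgz, fun y hy => h ▸ hle y hy⟩

/-- A maximal cell of the trivialized system is the cell of a weight vector that represents a term
order. -/
theorem IsTropSystem.exists_order_of_maximal (hS : IsTropSystem S) {D : ℕ}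
    {lt : (σ →₀ ℕ) → (σ →₀ ℕ) → Prop} (hlt : IsMonomialOrder lt)
    {P : Set (σ → ℝ)}
    (hP : Maximal (fun P => P ∈ Set.range (cell (monos σ D) (trunc (flat S) D))) P) :
    ∃ lt', IsTermOrder lt' ∧ ∀ w : σ → ℝ,
      bases (monos σ D) (trunc (flat S) D) w = {stdMonos (flat S) 0 lt' D} →
      P = cell (monos σ D) (trunc (flat S) D) w := by
  obtain ⟨v, rfl⟩ := hP.prop
  have hF := hS.isTropSystem_flat
  refine ⟨_, isTermOrder_weightOrder hlt v, fun w hw => ?_⟩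
  have hstd : stdMonos (flat S) 0 (weightOrder (fun _ => -1) (weightOrder v lt)) D =
      stdMonos (flat S) v lt D := by
    ext u
    rw [mem_stdMonos, mem_stdMonos, hS.leadSet_weightOrder v]
  have hsub : cell (monos σ D) (trunc (flat S) D) v ⊆ cell (monos σ D) (trunc (flat S) D) w := by
    refine cell_subset_of_mem ?_
    change bases _ _ w ⊆ bases _ _ v
    rw [hw, hstd, Set.singleton_subset_iff]
    exact hF.stdMonos_mem_bases v hlt D
  exact hsub.antisymm (hP.le_of_ge ⟨w, rfl⟩ hsub)

omit [DecidableEq σ] in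
theorem termInitialIdeal_mem_iff {I : Ideal (MvPolynomial σ TropReal)}
    (hS : IsTropSystem (coeffVecs I)) {lt : (σ →₀ ℕ) → (σ →₀ ℕ) → Prop} (hlt : IsMonomialOrder lt)
    (p : MvPolynomial σ BoolSemi) :
    p ∈ termInitialIdeal lt I ↔ ∀ u ∈ p.support, u ∈ leadSet (flat (coeffVecs I)) 0 lt := by
  have heq : {g : MvPolynomial σ BoolSemi | ∃ f ∈ I, ∃ u ∈ f.support,
      (∀ v ∈ f.support, v ≠ u → lt u v) ∧ g = monomial u 1} =
      (fun s => monomial s (1 : BoolSemi)) '' leadSet (flat (coeffVecs I)) 0 lt := by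
    have hsup : ∀ (f : MvPolynomial σ TropReal) r u,
        u ∈ initSet 0 (flatten (coeffVec realIncl f) r) ↔ u ∈ f.support := by
      intro f r u
      rw [mem_initSet_flatten, coeffVec_ne_top realIncl_injective_zero]
      simp [dot_zero_left]
    ext g
    constructor
    · rintro ⟨f, hf, u, hu, hmin, rfl⟩
      refine ⟨u, ⟨_, ⟨_, ⟨f, hf, rfl⟩, 0, rfl⟩, (hsup f 0 u).2 hu, fun v hv hne => ?_⟩, rfl⟩
      exact hmin v ((hsup f 0 v).1 hv) hne
    · rintro ⟨u, ⟨_, ⟨_, ⟨f, hf, rfl⟩, r, rfl⟩, hu, hmin⟩, rfl⟩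
      exact ⟨f, hf, u, (hsup f r u).1 hu, fun v hv hne => hmin v ((hsup f r v).2 hv) hne, rfl⟩
  rw [termInitialIdeal, heq, mem_ideal_span_monomial_image]
  refine forall₂_congr fun u _ => ⟨?_, fun h => ⟨u, h, le_rfl⟩⟩
  rintro ⟨m, hm, hmu⟩
  exact hS.isTropSystem_flat.mem_leadSet_of_le hlt hm hmu

omit [DecidableEq σ] in
/-- At a weight vector as in `IsTropSystem.exists_weight_of_order`, the initial ideal is the
monomial ideal of the leading monomials. -/
theorem initialIdeal_eq_termInitialIdeal {I : Ideal (MvPolynomial σ TropReal)}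
    (hS : IsTropSystem (coeffVecs I)) {lt : (σ →₀ ℕ) → (σ →₀ ℕ) → Prop} (hlt : IsMonomialOrder lt)
    {w : σ → ℝ}
    (h1 : ∀ u ∈ leadSet (flat (coeffVecs I)) 0 lt, ∃ f ∈ flat (coeffVecs I), initSet w f = {u})
    (h2 : leadSet (flat (coeffVecs I)) w lt = leadSet (flat (coeffVecs I)) 0 lt) :
    initialIdeal boolIncl w (trivialization I) = termInitialIdeal lt I := by
  have hF := hS.isTropSystem_flat
  ext p
  rw [termInitialIdeal_mem_iff hS hlt, mem_initialIdeal_iff boolIncl_injective_zero hF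
    (hasInitSets_flat_coeffVecs I)]
  refine forall₂_congr fun u hu => ⟨?_, fun h => ?_⟩
  · rintro ⟨f, hf, huf, -⟩
    obtain ⟨k, hk, huk, -⟩ := hF.exists_trunc hf huf le_rfl
    -- otherwise `u` is in the span of the other standard monomials
    by_contra hlead
    have hB := hF.stdMonos_mem_bases w hlt u.degree
    have hE := (hF.isElim_trunc u.degree).isElim_translate (dot w)
    have husp : Spans (translate (trunc (flat (coeffVecs I)) u.degree) (dot w))
        ((stdMonos (flat (coeffVecs I)) w lt u.degree : Set (σ →₀ ℕ)) \ {u}) u := by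
      refine hE.spans_of_forall (by simp) ⟨k, hk, rfl⟩ huk fun v hv hvu hvB => ?_
      have hvd := hk.2 v (ne_top_of_mem_initSet hv)
      have hvl : v ∈ leadSet (flat (coeffVecs I)) 0 lt := by
        by_contra hc
        rw [← h2] at hc
        exact hvB ⟨Finset.mem_coe.2 (mem_stdMonos.2 ⟨hvd, hc⟩), hvu⟩
      obtain ⟨g, hg, hgv⟩ := h1 v hvl
      obtain ⟨g', hg', hvg', hgs⟩ := hF.exists_trunc hg (hgv ▸ rfl : v ∈ initSet w g) hvd
      refine ⟨_, ⟨g', hg', rfl⟩, hvg', fun z hz => Or.inl ?_⟩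
      have := hgs hz
      rw [hgv] at this
      exact this
    refine hB.2.1.not_spans (Set.insert_subset ?_ Set.sdiff_subset) husp
    exact Finset.mem_coe.2 (mem_stdMonos.2 ⟨le_rfl, h2 ▸ hlead⟩)
  · obtain ⟨f, hf, hfu⟩ := h1 u h
    exact ⟨f, hf, hfu ▸ rfl, by rw [hfu]; simpa using hu⟩

theorem exists_equiv_maximal_cells {I : Ideal (MvPolynomial σ TropReal)}
    (hS : IsTropSystem (coeffVecs I)) {D : ℕ} (hD : GeneratedBy (flat (coeffVecs I)) D)
    {lt : (σ →₀ ℕ) → (σ →₀ ℕ) → Prop} (hlt : IsMonomialOrder lt) :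
    ∃ e : {C : Set (σ → ℝ) //
        Maximal (fun P => P ∈ groebnerComplex boolIncl (trivialization I)) C} ≃
      {J : Ideal (MvPolynomial σ BoolSemi) //
        ∃ lt : (σ →₀ ℕ) → (σ →₀ ℕ) → Prop, IsTermOrder lt ∧ J = termInitialIdeal lt I},
      ∀ C, (interior C.1).Nonempty ∧
        interior C.1 = {w | initialIdeal boolIncl w (trivialization I) = (e C).1} := by
  have hF := hS.isTropSystem_flat
  have hL := hF.isElim_trunc D
  rw [groebnerComplex_eq boolIncl_injective_zero hF (hasInitSets_flat_coeffVecs I) hD hlt]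
  have hiff := fun w w' => initialIdeal_eq_iff_bases boolIncl_injective_zero hF
    (hasInitSets_flat_coeffVecs I) hD hlt (w := w) (w' := w')
  -- a maximal cell is represented by a weight vector
  have hmax : ∀ C : {C : Set (σ → ℝ) // Maximal (fun P => P ∈
      Set.range (cell (monos σ D) (trunc (flat (coeffVecs I)) D))) C},
      ∃ w, ∃ B, ∃ lt', C.1 = cell (monos σ D) (trunc (flat (coeffVecs I)) D) w ∧
        bases (monos σ D) (trunc (flat (coeffVecs I)) D) w = {B} ∧ IsTermOrder lt' ∧
        initialIdeal boolIncl w (trivialization I) = termInitialIdeal lt' I := by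
    rintro ⟨C, hC⟩
    obtain ⟨lt', hlt', hcell⟩ := hS.exists_order_of_maximal hlt hC
    obtain ⟨w, h1, h2, h3⟩ := hS.exists_weight_of_order hD hlt'.isMonomialOrder
    exact ⟨w, _, lt', hcell w h3, h3, hlt',
      initialIdeal_eq_termInitialIdeal hS hlt'.isMonomialOrder h1 h2⟩
  choose w B lt' hC hB hlt' hJ using hmax
  refine ⟨Equiv.ofBijective (fun C => ⟨initialIdeal boolIncl (w C) (trivialization I),
    lt' C, hlt' C, hJ C⟩) ⟨fun C C' h => ?_, ?_⟩, fun C => ?_⟩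
  · have := (hiff _ _).1 (congrArg Subtype.val h)
    refine Subtype.ext ?_
    rw [hC, hC C']
    unfold cell
    rw [this]
  · rintro ⟨_, lt₁, hlt₁, rfl⟩
    obtain ⟨w₁, h1, h2, h3⟩ := hS.exists_weight_of_order hD hlt₁.isMonomialOrder
    refine ⟨⟨_, cell_maximal_of_bases_eq_singleton h3⟩, Subtype.ext ?_⟩
    refine Eq.trans ?_ (initialIdeal_eq_termInitialIdeal hS hlt₁.isMonomialOrder h1 h2)
    exact (hiff _ _).2 (bases_eq_of_cell_eq (hC _).symm)
  · have hint : interior C.1 =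
        {x | bases (monos σ D) (trunc (flat (coeffVecs I)) D) x = {B C}} := by
      rw [hC C]
      exact interior_cell_of_bases_eq_singleton hL (hB C)
    refine ⟨⟨w C, by rw [hint]; exact hB C⟩, ?_⟩
    rw [hint]
    ext x
    change bases _ _ x = {B C} ↔ initialIdeal boolIncl x (trivialization I) =
      initialIdeal boolIncl (w C) (trivialization I)
    rw [hiff, hB]

end MaximalCells

/-! ### Linear programming over lattice points -/

section LinearProgram

open Filter Topology

/-- Farkas' lemma with inequalities and equations. -/
theorem farkas_of_eq {V κ τ : Type*} [Fintype τ] [AddCommGroup V] [Module ℝ V] (s : Finset κ)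
    (a : κ → Module.Dual ℝ V) (b : τ → Module.Dual ℝ V) (c : Module.Dual ℝ V)
    (h : ∀ x, (∀ i ∈ s, 0 ≤ a i x) → (∀ j, b j x = 0) → 0 ≤ c x) :
    ∃ (l : κ → ℝ) (μ : τ → ℝ), (∀ i, 0 ≤ l i) ∧ c = ∑ i ∈ s, l i • a i + ∑ j, μ j • b j := by
  obtain ⟨l, hl, hc⟩ := farkas (s.disjSum (Finset.univ : Finset (τ ⊕ τ)))
    (Sum.elim a (Sum.elim b fun j => -b j)) c fun x hx => by
      refine h x (fun i hi => hx (Sum.inl i) (by simpa using hi)) fun j => ?_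
      have h1 := hx (Sum.inr (Sum.inl j)) (by simp)
      have h2 := hx (Sum.inr (Sum.inr j)) (by simp)
      simp only [Sum.elim_inr, Sum.elim_inl, LinearMap.neg_apply] at h1 h2
      linarith
  refine ⟨fun i => l (Sum.inl i), fun j => l (Sum.inr (Sum.inl j)) - l (Sum.inr (Sum.inr j)),
    fun i => hl _, ?_⟩
  rw [hc, Finset.sum_disjSum, Fintype.sum_sum_type]
  ext x
  simp [LinearMap.sum_apply, add_mul, sub_eq_add_neg, Finset.sum_add_distrib]

/-- An infeasible system of finitely many linear inequalities stays infeasible when the right-hand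
sides are relaxed a little. -/
theorem exists_pos_of_infeasible {V κ : Type*} [Finite κ] [AddCommGroup V] [Module ℝ V]
    (a : κ → Module.Dual ℝ V) (b : κ → ℝ) (h : ¬ ∃ x, ∀ i, a i x ≤ b i) :
    ∃ ε : ℝ, 0 < ε ∧ ¬ ∃ x, ∀ i, a i x ≤ b i + ε := by
  cases nonempty_fintype κ
  obtain ⟨l, hl, hc⟩ := farkas Finset.univ
    (fun i => b i • LinearMap.snd ℝ V ℝ - a i ∘ₗ LinearMap.fst ℝ V ℝ) (-LinearMap.snd ℝ V ℝ)
    fun x hx => by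
      by_contra hcon
      have hx2 : 0 < x.2 := by simpa using hcon
      refine h ⟨x.2⁻¹ • x.1, fun i => ?_⟩
      have := hx i (Finset.mem_univ i)
      simp only [LinearMap.sub_apply, LinearMap.smul_apply, LinearMap.snd_apply, smul_eq_mul,
        LinearMap.comp_apply, LinearMap.fst_apply] at this
      rw [map_smul, smul_eq_mul, inv_mul_le_iff₀ hx2]
      linarith
  have key : ∀ x : V, ∀ t : ℝ, -t = ∑ i, l i * (b i * t - a i x) := fun x t => by
    have := congrArg (fun φ => φ (x, t)) hc
    simpa [LinearMap.sum_apply] using this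
  have hsum : 0 ≤ ∑ i, l i := Finset.sum_nonneg fun i _ => hl i
  refine ⟨1 / (2 * (∑ i, l i + 1)), by positivity, fun ⟨x, hx⟩ => ?_⟩
  set ε := 1 / (2 * (∑ i, l i + 1)) with hε
  have h1 := key x 1
  have h2 : ∑ i, l i * -ε ≤ ∑ i, l i * (b i * 1 - a i x) :=
    Finset.sum_le_sum fun i _ => mul_le_mul_of_nonneg_left (by linarith [hx i]) (hl i)
  rw [← Finset.sum_mul, ← h1] at h2
  have h3 : (∑ i, l i) * ε < 1 := by
    rw [hε, mul_one_div, div_lt_one (by positivity)]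
    linarith
  linarith

variable {σ ι K : Type*} [Fintype σ] [Fintype ι] [Fintype K] [DecidableEq K]

/-- Convex weights on the fibres of `k : ι → K`, whose weighted sum of exponents is `m`. -/
def IsFeasible (k : ι → K) (p : ι → σ →₀ ℕ) (f : ι → ℝ) (m : σ →₀ ℕ) : Prop :=
  (∀ i, 0 ≤ f i) ∧ (∀ q, ∑ i with k i = q, f i = 1) ∧ ∀ t, ∑ i, f i * p i t = m t

theorem IsFeasible.degree_le {k : ι → K} {p : ι → σ →₀ ℕ} {f : ι → ℝ} {m : σ →₀ ℕ}
    (h : IsFeasible k p f m) {d : ℕ} (hp : ∀ i, (p i).degree ≤ d) :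
    m.degree ≤ Fintype.card K * d := by
  have h1 : (m.degree : ℝ) = ∑ i, f i * (p i).degree := by
    simp only [Finsupp.degree_eq_sum, Nat.cast_sum, ← h.2.2, Finset.mul_sum]
    exact Finset.sum_comm
  have h2 : ∑ i, f i = Fintype.card K := by
    rw [← Finset.sum_fiberwise Finset.univ k, Finset.sum_congr rfl fun q _ => h.2.1 q]
    simp
  have h3 : (m.degree : ℝ) ≤ ∑ i, f i * d :=
    h1 ▸ Finset.sum_le_sum fun i _ =>
      mul_le_mul_of_nonneg_left (by exact_mod_cast hp i) (h.1 i)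
  rw [← Finset.sum_mul, h2] at h3
  exact_mod_cast h3

/-- The sum of a linear cost and an arbitrary function of the lattice point attains its minimum. -/
theorem exists_isFeasible_min (k : ι → K) (hk : Function.Surjective k) (p : ι → σ →₀ ℕ)
    (cost : ι → ℝ) (z : (σ →₀ ℕ) → ℝ) :
    ∃ f m, IsFeasible k p f m ∧ ∀ f' m', IsFeasible k p f' m' →
      ∑ i, f i * cost i + z m ≤ ∑ i, f' i * cost i + z m' := by
  classical
  obtain ⟨d, hd⟩ : ∃ d, ∀ i, (p i).degree ≤ d :=
    ⟨∑ i, (p i).degree, fun i => Finset.single_le_sum (f := fun i => (p i).degree)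
      (fun _ _ => Nat.zero_le _) (Finset.mem_univ i)⟩
  -- for a fixed lattice point, the feasible set is compact
  have hcpt : ∀ m, IsCompact {f | IsFeasible k p f m} := fun m => by
    refine IsCompact.of_isClosed_subset (isCompact_univ_pi fun _ : ι => isCompact_Icc (a := (0 : ℝ))
      (b := 1)) ?_ fun f hf i _ => ⟨hf.1 i, ?_⟩
    · simp only [IsFeasible, Set.ofPred_and, Set.ofPred_forall]
      refine ((isClosed_iInter fun i => isClosed_le continuous_const (continuous_apply i)).inter
        ((isClosed_iInter fun q => isClosed_eq ?_ continuous_const).inter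
        (isClosed_iInter fun t => isClosed_eq ?_ continuous_const)))
      · exact continuous_finsetSum _ fun i _ => continuous_apply i
      · exact continuous_finsetSum _ fun i _ => (continuous_apply i).mul continuous_const
    · rw [← hf.2.1 (k i)]
      exact Finset.single_le_sum (fun j _ => hf.1 j) (by simp)
  have hmin : ∀ m, (∃ f, IsFeasible k p f m) → ∃ f, IsFeasible k p f m ∧
      ∀ f', IsFeasible k p f' m → ∑ i, f i * cost i ≤ ∑ i, f' i * cost i := fun m hm => by
    obtain ⟨f, hf, hmin⟩ := (hcpt m).exists_isMinOn hm
      (f := fun f => ∑ i, f i * cost i)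
      (continuous_finsetSum _ fun i _ => (continuous_apply i).mul continuous_const).continuousOn
    exact ⟨f, hf, fun f' hf' => hmin hf'⟩
  choose! F hF hFmin using hmin
  obtain ⟨s, hs⟩ := hk.hasRightInverse
  have hne : ((monos σ (Fintype.card K * d)).filter fun m => ∃ f, IsFeasible k p f m).Nonempty := by
    have hfeas : IsFeasible k p (fun i => if i = s (k i) then 1 else 0) (∑ q, p (s q)) := by
      refine ⟨fun i => by dsimp only; split_ifs <;> simp, fun q => ?_, fun t => ?_⟩
      · rw [Finset.sum_ite, Finset.sum_const_zero, add_zero, Finset.sum_const, nsmul_eq_mul,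
          mul_one]
        have : (Finset.univ.filter fun i => k i = q).filter (fun i => i = s (k i)) = {s q} := by
          ext i
          simp only [Finset.mem_filter, Finset.mem_univ, true_and, Finset.mem_singleton]
          constructor
          · rintro ⟨rfl, h⟩; exact h
          · rintro rfl; exact ⟨hs q, by rw [hs q]⟩
        rw [this]; simp
      · rw [← Finset.sum_fiberwise Finset.univ k, Finsupp.finsetSum_apply, Nat.cast_sum]
        refine Finset.sum_congr rfl fun q _ => ?_
        rw [Finset.sum_eq_single (s q)]
        · simp [hs q]
        · intro i hi hne
          have : k i = q := (Finset.mem_filter.1 hi).2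
          dsimp only
          rw [this, if_neg hne, zero_mul]
        · intro h
          exact absurd (Finset.mem_filter.2 ⟨Finset.mem_univ (s q), hs q⟩) h
    exact ⟨_, Finset.mem_filter.2 ⟨mem_monos.2 (hfeas.degree_le hd), _, hfeas⟩⟩
  obtain ⟨m, hm, hmle⟩ := Finset.exists_min_image _
    (fun m => ∑ i, F m i * cost i + z m) hne
  have hm' := (Finset.mem_filter.1 hm).2
  refine ⟨F m, m, hF m hm', fun f' m' hf' => ?_⟩
  have h1 := hmle m' (Finset.mem_filter.2 ⟨mem_monos.2 (hf'.degree_le hd), f', hf'⟩)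
  have h2 := hFmin m' ⟨f', hf'⟩ f' hf'
  linarith

/-- Linear programming duality with complementary slackness, for the minimization of a cost among
the feasible weights of a fixed lattice point. -/
theorem IsFeasible.exists_dual {k : ι → K} {p : ι → σ →₀ ℕ} {f : ι → ℝ} {m : σ →₀ ℕ}
    (h : IsFeasible k p f m) {cost : ι → ℝ}
    (hmin : ∀ f', IsFeasible k p f' m → ∑ i, f i * cost i ≤ ∑ i, f' i * cost i) :
    ∃ (w : σ → ℝ) (μ : K → ℝ), ∀ i, μ (k i) ≤ cost i + dot w (p i) ∧
      (0 < f i → μ (k i) = cost i + dot w (p i)) := by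
  classical
  obtain ⟨l, μ, hl, hc⟩ := farkas_of_eq (Finset.univ.filter fun i => f i = 0)
    (fun i => (LinearMap.proj i : Module.Dual ℝ (ι → ℝ)))
    (Sum.elim (fun q : K => ∑ i with k i = q, (LinearMap.proj i : Module.Dual ℝ (ι → ℝ)))
      fun t : σ => ∑ i, (p i t : ℝ) • (LinearMap.proj i : Module.Dual ℝ (ι → ℝ)))
    (∑ i, cost i • (LinearMap.proj i : Module.Dual ℝ (ι → ℝ))) fun x hx0 hx => by
      -- `x` is a feasible direction at `f`
      have hx1 : ∀ q, ∑ i with k i = q, x i = 0 := fun q => by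
        simpa [LinearMap.sum_apply] using hx (Sum.inl q)
      have hx2 : ∀ t, ∑ i, (p i t : ℝ) * x i = 0 := fun t => by
        simpa [LinearMap.sum_apply] using hx (Sum.inr t)
      obtain ⟨t, ht, ht0⟩ : ∃ t : ℝ, (∀ i, 0 ≤ f i + t * x i) ∧ 0 < t := by
        have : ∀ᶠ t in 𝓝[>] (0 : ℝ), (∀ i, 0 ≤ f i + t * x i) ∧ 0 < t := by
          refine (eventually_all.2 fun i => ?_).and self_mem_nhdsWithin
          rcases (h.1 i).eq_or_lt with h0 | h0
          · filter_upwards [self_mem_nhdsWithin] with t ht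
            have := hx0 i (by simp [← h0])
            rw [← h0, zero_add]
            exact mul_nonneg (le_of_lt ht) this
          · have hcont : Tendsto (fun t : ℝ => f i + t * x i) (𝓝[>] 0) (𝓝 (f i)) := by
              have : Tendsto (fun t : ℝ => f i + t * x i) (𝓝 0) (𝓝 (f i + 0 * x i)) :=
                (Continuous.tendsto (by fun_prop) 0)
              rw [zero_mul, add_zero] at this
              exact this.mono_left nhdsWithin_le_nhds
            filter_upwards [hcont.eventually (lt_mem_nhds h0)] with t ht
            exact ht.le
        exact this.exists
      have hle := hmin (fun i => f i + t * x i) ⟨ht, fun q => by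
        rw [Finset.sum_add_distrib, ← Finset.mul_sum, h.2.1, hx1]; simp, fun s => by
        simp only [add_mul, Finset.sum_add_distrib, h.2.2, mul_assoc, ← Finset.mul_sum]
        rw [Finset.sum_congr rfl fun i _ => mul_comm (x i) _, hx2]; simp⟩
      simp only [add_mul, Finset.sum_add_distrib, mul_assoc, ← Finset.mul_sum] at hle
      have : 0 ≤ ∑ i, x i * cost i := by
        by_contra hcon
        nlinarith
      simpa [LinearMap.sum_apply, mul_comm] using this
  have key : ∀ i, cost i = (if f i = 0 then l i else 0) + μ (Sum.inl (k i)) +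
      dot (fun t => μ (Sum.inr t)) (p i) := fun i => by
    have := congrArg (fun φ => φ (Pi.single i 1)) hc
    simp only [LinearMap.sum_apply, LinearMap.smul_apply, LinearMap.proj_apply, smul_eq_mul,
      Pi.single_apply, mul_ite, mul_one, mul_zero, Finset.sum_ite_eq', Finset.mem_univ, if_true,
      LinearMap.add_apply, Fintype.sum_sum_type, Sum.elim_inl, Sum.elim_inr,
      Finset.mem_filter, true_and, Finset.sum_ite_eq, add_assoc, dot] at this ⊢
    rw [this]
    simp [mul_comm]
  refine ⟨fun t => -μ (Sum.inr t), fun q => μ (Sum.inl q), fun i => ?_⟩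
  have hneg : dot (fun t => -μ (Sum.inr t)) (p i) = -dot (fun t => μ (Sum.inr t)) (p i) :=
    dot_neg _ _
  rw [hneg, key i]
  refine ⟨?_, fun hi => ?_⟩
  · have : 0 ≤ if f i = 0 then l i else 0 := by split_ifs <;> simp [hl]
    linarith
  · rw [if_neg hi.ne']; ring

end LinearProgram

/-! ### Common roots of finitely many tropical polynomials -/

section CommonRoot

open Filter Topology

variable {σ κ : Type*} [Fintype σ]

/-- If finitely many tropical polynomials have no common root, then at every point one of them has
a term that is smaller than the others by a margin that does not depend on the point. -/
theorem exists_gap [Finite κ] (A : κ → Finset (σ →₀ ℕ)) (hA : ∀ j, (A j).Nonempty)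
    (c : κ → (σ →₀ ℕ) → ℝ)
    (h : ∀ x : σ → ℝ, ∃ j, ∃ u ∈ A j, ∀ v ∈ A j, v ≠ u → c j u + dot x u < c j v + dot x v) :
    ∃ ε : ℝ, 0 < ε ∧ ∀ x : σ → ℝ, ∃ j, ∃ u ∈ A j, ∀ v ∈ A j, v ≠ u →
      c j u + dot x u + ε ≤ c j v + dot x v := by
  have hw : ∀ (x : σ → ℝ) u, weight {u} x = dot x u := fun x u => by simp [weight]
  -- choose two terms of each polynomial, and ask that they are minimal
  have hev : ∀ᶠ ε in 𝓝[>] (0 : ℝ), ∀ π : (j : κ) → Bool → A j, (∀ j, π j true ≠ π j false) →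
      ¬ ∃ x, ∀ i : (j : κ) × (A j × Bool),
        (weight {(π i.1 i.2.2).1} - weight {i.2.1.1}) x ≤
          c i.1 i.2.1 - c i.1 (π i.1 i.2.2) + ε := by
    refine eventually_all.2 fun π => ?_
    by_cases hπ : ∀ j, π j true ≠ π j false
    · obtain ⟨ε, hε, hno⟩ := exists_pos_of_infeasible
        (fun i : (j : κ) × (A j × Bool) => weight {(π i.1 i.2.2).1} - weight {i.2.1.1})
        (fun i => c i.1 i.2.1 - c i.1 (π i.1 i.2.2)) fun ⟨x, hx⟩ => by
          obtain ⟨j, u, hu, hlt⟩ := h x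
          obtain ⟨b, hb⟩ : ∃ b, (π j b).1 ≠ u := by
            by_contra hcon
            push Not at hcon
            exact hπ j (Subtype.ext ((hcon true).trans (hcon false).symm))
          have h1 := hlt _ (π j b).2 hb
          have h2 := hx ⟨j, ⟨u, hu⟩, b⟩
          simp only [LinearMap.sub_apply, hw] at h2
          linarith
      filter_upwards [Ioo_mem_nhdsGT hε] with δ hδ _
      rintro ⟨x, hx⟩
      exact hno ⟨x, fun i => (hx i).trans (by linarith [hδ.2])⟩
    · exact Eventually.of_forall fun _ h => absurd h hπ
  obtain ⟨ε, hε, hε0⟩ := (hev.and self_mem_nhdsWithin).exists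
  refine ⟨ε, hε0, fun x => ?_⟩
  by_contra hcon
  push Not at hcon
  have hmin : ∀ j, ∃ u ∈ A j, ∀ v ∈ A j, c j u + dot x u ≤ c j v + dot x v := fun j =>
    Finset.exists_min_image (A j) _ (hA j)
  choose u hu hmin using hmin
  choose v hv hvu hvε using fun j => hcon j (u j) (hu j)
  refine hε (fun j b => if b then ⟨u j, hu j⟩ else ⟨v j, hv j⟩)
    (fun j hj => hvu j (by simpa using (congrArg Subtype.val hj).symm)) ⟨x, ?_⟩
  rintro ⟨j, ⟨y, hy⟩, b⟩
  have h1 := hmin j y hy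
  have h2 := hvε j
  have h3 : 0 < ε := hε0
  cases b <;> simp [hw] <;> linarith

/-- A linear form with arbitrarily small values separates the points of a finite set. -/
theorem IsMonomialOrder.exists_small_weight {lt : (σ →₀ ℕ) → (σ →₀ ℕ) → Prop}
    (hlt : IsMonomialOrder lt) (U : Finset (σ →₀ ℕ)) {ε : ℝ} (hε : 0 < ε) :
    ∃ e : σ → ℝ, ∀ u ∈ U, ∀ v ∈ U, u ≠ v → dot e u ≠ dot e v ∧ dot e u - dot e v < ε := by
  classical
  obtain ⟨w, hw⟩ := hlt.exists_weight ((U ×ˢ U).filter fun q => lt q.1 q.2)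
    fun q hq => (Finset.mem_filter.1 hq).2
  have hne : ∀ u ∈ U, ∀ v ∈ U, u ≠ v → dot w u ≠ dot w v := fun u hu v hv huv => by
    rcases hlt.total u v huv with h | h
    · exact (hw (u, v) (by simp [hu, hv, h])).ne
    · exact (hw (v, u) (by simp [hu, hv, h])).ne'
  have hev : ∀ᶠ t in 𝓝[>] (0 : ℝ), ∀ u ∈ U, ∀ v ∈ U, t * (dot w u - dot w v) < ε := by
    refine (Filter.eventually_all_finset U).2 fun u _ =>
      (Filter.eventually_all_finset U).2 fun v _ => ?_
    have : Tendsto (fun t : ℝ => t * (dot w u - dot w v)) (𝓝 0) (𝓝 (0 * (dot w u - dot w v))) :=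
      Continuous.tendsto (by fun_prop) 0
    rw [zero_mul] at this
    exact (this.mono_left nhdsWithin_le_nhds).eventually (gt_mem_nhds hε)
  obtain ⟨t, ht, ht0⟩ := (hev.and self_mem_nhdsWithin).exists
  refine ⟨t • w, fun u hu v hv huv => ?_⟩
  rw [dot_smul, dot_smul, ← mul_sub]
  refine ⟨fun h => hne u hu v hv huv (mul_left_cancel₀ (ne_of_gt ht0) h), ht u hu v hv⟩

/-- The tropical dual Nullstellensatz of Grigoriev and Podolskii: if `z` solves the linear system
given by the multiples `x^a f_j` up to a sufficiently large degree, then the tropical polynomials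
`f_j = ⊕ c_j(u) x^u` have a common root. For a root `x` the function `u ↦ x · u` solves this system,
but `z` need not be linear. Minimizing `z` together with the costs of two perturbed copies of every
`f_j` over the corresponding Minkowski sum produces a term of some `f_j` at which `z` violates the
system, unless there is a common root. -/
theorem IsMonomialOrder.exists_common_root [Fintype κ] {lt : (σ →₀ ℕ) → (σ →₀ ℕ) → Prop}
    (hlt : IsMonomialOrder lt) (A : κ → Finset (σ →₀ ℕ)) (hA : ∀ j, (A j).Nonempty) {d : ℕ}
    (hd : ∀ j, ∀ u ∈ A j, u.degree ≤ d) (c : κ → (σ →₀ ℕ) → ℝ) (z : (σ →₀ ℕ) → ℝ)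
    (hz : ∀ j, ∀ a : σ →₀ ℕ, a.degree ≤ Fintype.card (κ × Bool) * d → ∀ u ∈ A j,
      ∃ v ∈ A j, v ≠ u ∧ c j v + z (a + v) ≤ c j u + z (a + u)) :
    ∃ x : σ → ℝ, ∀ j, ∀ u ∈ A j, ∃ v ∈ A j, v ≠ u ∧ c j v + dot x v ≤ c j u + dot x u := by
  classical
  by_contra hcon
  push Not at hcon
  obtain ⟨ε, hε, hgap⟩ := exists_gap A hA c hcon
  obtain ⟨e, he⟩ := hlt.exists_small_weight (Finset.univ.biUnion A) hε
  have hU : ∀ {j u}, u ∈ A j → u ∈ Finset.univ.biUnion A := fun {j u} hu =>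
    Finset.mem_biUnion.2 ⟨j, Finset.mem_univ _, hu⟩
  let sgn : Bool → ℝ := fun b => if b then 1 else -1
  let k : ((q : κ × Bool) × A q.1) → κ × Bool := Sigma.fst
  let p : ((q : κ × Bool) × A q.1) → σ →₀ ℕ := fun i => i.2.1
  let cost : ((q : κ × Bool) × A q.1) → ℝ := fun i => c i.1.1 (p i) + sgn i.1.2 * dot e (p i)
  obtain ⟨f, m, hf, hmin⟩ := exists_isFeasible_min k
    (fun q => ⟨⟨q, ⟨_, (hA q.1).choose_spec⟩⟩, rfl⟩) p cost z
  obtain ⟨w, μ, hdual⟩ := hf.exists_dual (cost := cost) fun f' hf' => by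
    have := hmin f' m hf'
    linarith
  obtain ⟨j, u, hu, hgap⟩ := hgap w
  -- by the gap, both copies of `f_j` are concentrated at `u`
  have hzero : ∀ b, ∀ v (hv : v ∈ A j), v ≠ u → f ⟨(j, b), ⟨v, hv⟩⟩ = 0 := fun b v hv hvu => by
    by_contra h0
    have h1 := (hdual ⟨(j, b), ⟨v, hv⟩⟩).2 (lt_of_le_of_ne (hf.1 _) (Ne.symm h0))
    have h2 := (hdual ⟨(j, b), ⟨u, hu⟩⟩).1
    have h3 := hgap v hv hvu
    have h4 := (he u (hU hu) v (hU hv) hvu.symm).2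
    have h5 := (he v (hU hv) u (hU hu) hvu).2
    simp only [k, p, cost, sgn] at h1 h2
    cases b <;> simp at h1 h2 <;> linarith
  have hone : ∀ b, f ⟨(j, b), ⟨u, hu⟩⟩ = 1 := fun b => by
    rw [← hf.2.1 (j, b), Finset.sum_eq_single ⟨(j, b), ⟨u, hu⟩⟩]
    · rintro ⟨q, v, hv⟩ hi hne
      obtain rfl : q = (j, b) := (Finset.mem_filter.1 hi).2
      exact hzero b v hv fun h => hne (by subst h; rfl)
    · intro h
      exact (h (Finset.mem_filter.2 ⟨Finset.mem_univ _, rfl⟩)).elim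
  have hum : u ≤ m := fun t => by
    have : (u t : ℝ) ≤ m t := by
      rw [← hf.2.2 t]
      refine le_trans ?_ (Finset.single_le_sum (f := fun i => f i * (p i t : ℝ))
        (fun i _ => mul_nonneg (hf.1 i) (Nat.cast_nonneg _))
        (Finset.mem_univ ⟨(j, true), ⟨u, hu⟩⟩))
      simp [hone, p]
    exact_mod_cast this
  have hdeg : (m - u).degree ≤ Fintype.card (κ × Bool) * d :=
    le_trans (by
      conv_rhs => rw [← tsub_add_cancel_of_le hum]
      rw [map_add]; exact Nat.le_add_right _ _) (hf.degree_le fun i => hd _ _ i.2.2)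
  obtain ⟨v, hv, hvu, hle⟩ := hz j (m - u) hdeg u hu
  -- move the copy of `f_j` for which `v` is cheaper than `u` from `u` to `v`
  obtain ⟨b, hb⟩ : ∃ b, sgn b * dot e v < sgn b * dot e u := by
    rcases lt_or_gt_of_ne (he v (hU hv) u (hU hu) hvu).1 with h | h
    · exact ⟨true, by simpa [sgn] using h⟩
    · exact ⟨false, by simpa [sgn] using h⟩
  set iu : (q : κ × Bool) × A q.1 := ⟨(j, b), ⟨u, hu⟩⟩ with hiu
  set iv : (q : κ × Bool) × A q.1 := ⟨(j, b), ⟨v, hv⟩⟩ with hiv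
  have hne : iv ≠ iu := fun h => hvu (congrArg p h)
  have hsum : ∀ (s : Finset ((q : κ × Bool) × A q.1)) (g : (q : κ × Bool) × A q.1 → ℝ),
      ∑ i ∈ s, (f i + ((if i = iv then 1 else 0) - if i = iu then 1 else 0)) * g i =
        ∑ i ∈ s, f i * g i + ((if iv ∈ s then g iv else 0) - if iu ∈ s then g iu else 0) :=
    fun s g => by
      simp only [add_mul, sub_mul, Finset.sum_add_distrib, Finset.sum_sub_distrib,
        ite_mul, one_mul, zero_mul, Finset.sum_ite_eq']
  have hfeas : IsFeasible k p (fun i => f i + ((if i = iv then 1 else 0) - if i = iu then 1 else 0))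
      (m - u + v) := by
    refine ⟨fun i => ?_, fun q => ?_, fun t => ?_⟩
    · have := hf.1 i
      by_cases h1 : i = iu
      · subst h1
        simp [hiu, hone]
        split_ifs <;> simp
      · simp only [h1, if_false, sub_zero]
        split_ifs <;> linarith
    · have := hsum (Finset.univ.filter fun i => k i = q) fun _ => 1
      simp only [mul_one] at this
      rw [this, hf.2.1 q]
      have : k iv = k iu := rfl
      simp [this]
    · rw [hsum, hf.2.2 t]
      have : (m - u) t + u t = m t := by
        rw [← Finsupp.add_apply, tsub_add_cancel_of_le hum]
      simp only [Finset.mem_univ, if_true, Finsupp.add_apply, Nat.cast_add, ← this, hiv, hiu, p]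
      ring
  have hlast := hmin _ _ hfeas
  rw [hsum] at hlast
  simp only [Finset.mem_univ, if_true, cost, hiv, hiu, p] at hlast
  rw [tsub_add_cancel_of_le hum] at hle
  linarith

end CommonRoot

/-! ### Rays in the variety -/

section Roots

open Filter

variable {σ : Type*} [Fintype σ] {S : Set ((σ →₀ ℕ) → WithTop ℝ)}

/-- At `w`, no vector of `S` attains its minimum exactly once. -/
def IsRoot (S : Set ((σ →₀ ℕ) → WithTop ℝ)) (w : σ → ℝ) : Prop :=
  ∀ f ∈ S, ∀ u, initSet w f ≠ {u}

theorem mem_realVariety_iff {K : Type*} [CommSemiring K] {ι : K →+* TropReal}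
    (hι : ∀ c, ι c = 0 → c = 0) {I : Ideal (MvPolynomial σ K)} (hI : HasInitSets ι I S)
    {w : σ → ℝ} : w ∈ realVariety ι I ↔ IsRoot S w := by
  have h1 : IsRoot S w ↔ ∀ f ∈ I, ∀ u, initSet w (coeffVec ι f) ≠ {u} := by
    constructor
    · intro h f hf u hu
      obtain ⟨g, hg, hgf⟩ := (hI w _).1 ⟨f, hf, rfl⟩
      exact h g hg u (hgf.trans hu)
    · intro h g hg u hu
      obtain ⟨f, hf, hfg⟩ := (hI w _).2 ⟨g, hg, rfl⟩
      exact h f hf u (hfg.trans hu)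
  rw [h1]
  refine forall₂_congr fun f _ => ⟨?_, fun h => ?_⟩
  · rintro (h | ⟨u, v, huv, hu, hv⟩) y hy
    · have hmem := (mem_initSet_coeffVec_iff hι w f y).1 (hy ▸ rfl : y ∈ initSet w (coeffVec ι f))
      have h2 := congrArg Tropical.untrop (hmem.2.trans h)
      rw [untrop_termValue, Tropical.untrop_zero, WithTop.add_eq_top] at h2
      exact h2.elim (fun h3 => (coeffVec_ne_top hι).2 hmem.1 h3) WithTop.coe_ne_top
    · -- the value is finite at `y`, hence the terms at `u` and `v` are in the support
      have hmem := (mem_initSet_coeffVec_iff hι w f y).1 (hy ▸ rfl : y ∈ initSet w (coeffVec ι f))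
      have hsupp : ∀ x, termValue ι (toTrop w) f x = polyValue ι (toTrop w) f →
          x = y := fun x hx => by
        have hxs : x ∈ f.support := by
          rw [← coeffVec_ne_top hι]
          intro hc
          have h2 := congrArg Tropical.untrop (hmem.2.trans hx.symm)
          rw [untrop_termValue, untrop_termValue, hc, top_add, WithTop.add_eq_top] at h2
          exact h2.elim (fun h3 => (coeffVec_ne_top hι).2 hmem.1 h3) WithTop.coe_ne_top
        have : x ∈ initSet w (coeffVec ι f) := (mem_initSet_coeffVec_iff hι w f x).2 ⟨hxs, hx⟩
        rw [hy] at this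
        exact this
      exact huv ((hsupp u hu).trans (hsupp v hv).symm)
  · by_cases hf : f.support.Nonempty
    · obtain ⟨u, hu, hmin⟩ := Finset.exists_mem_eq_inf f.support hf
        (Tropical.untrop ∘ termValue ι (toTrop w) f)
      rw [← Finset.untrop_sum', ← polyValue_eq_sum] at hmin
      have hu' : u ∈ initSet w (coeffVec ι f) := (mem_initSet_coeffVec_iff hι w f u).2
        ⟨hu, (Tropical.untrop_injective hmin).symm⟩
      obtain ⟨v, hv, hvu⟩ : ∃ v ∈ initSet w (coeffVec ι f), v ≠ u := by
        by_contra hcon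
        push Not at hcon
        exact h u (Set.eq_singleton_iff_unique_mem.2 ⟨hu', hcon⟩)
      exact Or.inr ⟨u, v, hvu.symm, (Tropical.untrop_injective hmin).symm,
        ((mem_initSet_coeffVec_iff hι w f v).1 hv).2⟩
    · left
      rw [polyValue_eq_sum, Finset.not_nonempty_iff_eq_empty.1 hf, Finset.sum_empty]

open Classical in
/-- The part of `f` at the positions of its support that have the least `v`-weight. -/
noncomputable def levelPart (v : σ → ℝ) (f : (σ →₀ ℕ) → WithTop ℝ) : (σ →₀ ℕ) → WithTop ℝ :=
  fun u => if ∀ y, f y ≠ ⊤ → dot v u ≤ dot v y then f u else ⊤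

theorem levelPart_ne_top {v : σ → ℝ} {f : (σ →₀ ℕ) → WithTop ℝ} {u : σ →₀ ℕ} :
    levelPart v f u ≠ ⊤ ↔ f u ≠ ⊤ ∧ ∀ y, f y ≠ ⊤ → dot v u ≤ dot v y := by
  unfold levelPart
  split_ifs with h
  · exact ⟨fun h' => ⟨h', h⟩, fun h' => h'.1⟩
  · exact ⟨fun h' => absurd rfl h', fun h' => absurd h'.2 h⟩

theorem levelPart_ne_top_iff_mem {v : σ → ℝ} {f : (σ →₀ ℕ) → WithTop ℝ} {u : σ →₀ ℕ} {r : ℝ} :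
    levelPart v f u ≠ ⊤ ↔ u ∈ initSet v (flatten f r) :=
  levelPart_ne_top.trans mem_initSet_flatten.symm

open Classical in
theorem levelPart_apply {v : σ → ℝ} {f : (σ →₀ ℕ) → WithTop ℝ} {u : σ →₀ ℕ}
    (hu : levelPart v f u ≠ ⊤) (y : σ →₀ ℕ) :
    levelPart v f y = if dot v y = dot v u then f y else ⊤ := by
  obtain ⟨hfu, hmin⟩ := levelPart_ne_top.1 hu
  unfold levelPart
  by_cases hy : f y = ⊤
  · simp [hy]
  · congr 1
    refine propext ⟨fun h => le_antisymm (h u hfu) (hmin y hy), fun h z hz => h ▸ hmin z hz⟩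

theorem levelPart_add_const (v : σ → ℝ) (f : (σ →₀ ℕ) → WithTop ℝ) (r : ℝ) :
    levelPart v (fun u => f u + (r : WithTop ℝ)) = fun u => levelPart v f u + (r : WithTop ℝ) := by
  funext u
  unfold levelPart
  have hiff : (∀ y, f y + (r : WithTop ℝ) ≠ ⊤ → dot v u ≤ dot v y) ↔
      ∀ y, f y ≠ ⊤ → dot v u ≤ dot v y := by simp
  by_cases h : ∀ y, f y ≠ ⊤ → dot v u ≤ dot v y
  · rw [if_pos h, if_pos (hiff.2 h)]
  · rw [if_neg h, if_neg fun hc => h (hiff.1 hc), top_add]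

theorem levelPart_eq_apply {v : σ → ℝ} {f : (σ →₀ ℕ) → WithTop ℝ} {u : σ →₀ ℕ}
    (hu : levelPart v f u ≠ ⊤) : levelPart v f u = f u := by
  rw [levelPart_apply hu, if_pos rfl]

/-- Far out in the direction `v`, the initial positions of `f` are those of its part of least
`v`-weight. -/
theorem eventually_initSet_eq (x v : σ → ℝ) {f : (σ →₀ ℕ) → WithTop ℝ}
    (hf : {u | f u ≠ ⊤}.Finite) :
    ∀ᶠ t : ℝ in atTop, initSet (x + t • v) f = initSet x (levelPart v f) := by
  have hev : ∀ᶠ t : ℝ in atTop, ∀ u ∈ {u | f u ≠ ⊤}, ∀ y ∈ {u | f u ≠ ⊤}, dot v u < dot v y →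
      f u + (dot (x + t • v) u : WithTop ℝ) < f y + (dot (x + t • v) y : WithTop ℝ) := by
    refine (eventually_all_finite hf).2 fun u hu => (eventually_all_finite hf).2 fun y hy => ?_
    obtain ⟨a, ha⟩ := WithTop.ne_top_iff_exists.1 hu
    obtain ⟨b, hb⟩ := WithTop.ne_top_iff_exists.1 hy
    by_cases huy : dot v u < dot v y
    · filter_upwards [eventually_gt_atTop ((a + dot x u - b - dot x y) / (dot v y - dot v u))]
        with t ht _
      rw [div_lt_iff₀ (by linarith)] at ht
      rw [← ha, ← hb]
      norm_cast
      simp only [dot_add, dot_smul]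
      linarith
    · exact Eventually.of_forall fun _ h => absurd h huy
  filter_upwards [hev] with t ht
  ext u
  constructor
  · intro hu
    have hfu := ne_top_of_mem_initSet hu
    have hlu : levelPart v f u ≠ ⊤ := levelPart_ne_top.2 ⟨hfu, fun y hy => by
      by_contra hcon
      exact absurd (hu.2 y) (not_le.2 (ht y hy u hfu (not_le.1 hcon)))⟩
    refine ⟨by simpa using hlu, fun y => ?_⟩
    by_cases hy : levelPart v f y = ⊤
    · simp [hy]
    · have hvy : dot v y = dot v u := by
        by_contra hc
        rw [levelPart_apply hlu, if_neg hc] at hy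
        exact hy rfl
      obtain ⟨a, ha⟩ := WithTop.ne_top_iff_exists.1 hfu
      obtain ⟨b, hb⟩ := WithTop.ne_top_iff_exists.1 (levelPart_ne_top.1 hy).1
      have := hu.2 y
      simp only [levelPart_eq_apply hlu, levelPart_eq_apply hy, ← ha, ← hb] at this ⊢
      norm_cast at this ⊢
      simp only [dot_add, dot_smul, hvy] at this
      linarith
  · intro hu
    have hlu := ne_top_of_mem_initSet hu
    have hfu := (levelPart_ne_top.1 hlu).1
    refine ⟨by simpa using hfu, fun y => ?_⟩
    by_cases hy : f y = ⊤
    · simp [hy]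
    · rcases ((levelPart_ne_top.1 hlu).2 y hy).lt_or_eq with h | h
      · exact (ht u hfu y hy h).le
      · obtain ⟨a, ha⟩ := WithTop.ne_top_iff_exists.1 hfu
        obtain ⟨b, hb⟩ := WithTop.ne_top_iff_exists.1 hy
        have := hu.2 y
        simp only [levelPart_eq_apply hlu, levelPart_apply hlu y, if_pos h.symm, ← ha,
          ← hb] at this ⊢
        norm_cast at this ⊢
        simp only [dot_add, dot_smul, h]
        linarith

/-- If a ray in the direction `v` stays in the variety, then `v` is a root of the trivialized
system. -/
theorem IsTropSystem.isRoot_flat_of_ray (hS : IsTropSystem S) {x v : σ → ℝ}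
    (h : ∃ᶠ t : ℝ in atTop, IsRoot S (x + t • v)) : IsRoot (flat S) v := by
  rintro _ ⟨f, hf, r, rfl⟩ u hu
  obtain ⟨t, ht, hroot⟩ := ((eventually_initSet_eq x v (hS.finite f hf)).and_frequently h).exists
  refine hroot f hf u (ht.trans ?_)
  have hsupp : ∀ y, levelPart v f y ≠ ⊤ → y = u := fun y hy => by
    rw [levelPart_ne_top_iff_mem (r := r), hu] at hy
    exact hy
  have huu : levelPart v f u ≠ ⊤ := by
    rw [levelPart_ne_top_iff_mem (r := r), hu]; rfl
  refine Set.eq_singleton_iff_unique_mem.2 ⟨⟨by simpa using huu, fun y => ?_⟩, fun y hy =>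
    hsupp y (ne_top_of_mem_initSet hy)⟩
  by_cases hy : levelPart v f y = ⊤
  · simp [hy]
  · rw [hsupp y hy]

/-- There is a finite tropical basis: a weight vector outside of the variety is
detected by one of finitely many vectors, which can be taken to be fundamental vectors of the
bases of a sufficiently large truncation. -/
theorem IsTropSystem.exists_tropicalBasis [DecidableEq σ] (hS : IsTropSystem S)
    {lt : (σ →₀ ℕ) → (σ →₀ ℕ) → Prop} (hlt : IsMonomialOrder lt) :
    ∃ F ⊆ S, F.Finite ∧ ∀ w, ¬ IsRoot S w → ∃ f ∈ F, ∃ u, initSet w f = {u} := by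
  obtain ⟨D, hD⟩ := hS.exists_generatedBy
  -- the degrees of the loops are bounded, as there are only finitely many initial ideals
  obtain ⟨N, hN⟩ : ∃ N : ℕ, ∀ w, ¬ IsRoot S w → ∃ f ∈ S, ∃ u, initSet w f = {u} ∧
      u.degree ≤ N := by
    have hcls : ∀ C : Set (Finset (σ →₀ ℕ)), ∃ N : ℕ, ∀ w,
        bases (monos σ D) (trunc S D) w = C → ¬ IsRoot S w →
        ∃ f ∈ S, ∃ u, initSet w f = {u} ∧ u.degree ≤ N := by
      intro C
      by_cases hC : ∃ w, bases (monos σ D) (trunc S D) w = C ∧ ¬ IsRoot S w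
      · obtain ⟨w₀, rfl, hw₀⟩ := hC
        unfold IsRoot at hw₀
        push Not at hw₀
        obtain ⟨f, hf, u, hu⟩ := hw₀
        refine ⟨u.degree, fun w hw _ => ?_⟩
        obtain ⟨g, hg, hug, hgs⟩ := ((hS.initLE_iff hD hlt).2 hw.symm).1 f hf u (hu ▸ rfl)
        exact ⟨g, hg, u, (hgs.trans hu.subset).antisymm (Set.singleton_subset_iff.2 hug), le_rfl⟩
      · exact ⟨0, fun w hw hr => absurd ⟨w, hw, hr⟩ hC⟩
    choose N hN using hcls
    have hfin : {C : Set (Finset (σ →₀ ℕ)) | C ⊆ ((monos σ D).powerset : Set _)}.Finite :=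
      (Finset.finite_toSet _).finite_subsets
    obtain ⟨M, hM⟩ := (hfin.image N).bddAbove
    refine ⟨M, fun w hw => ?_⟩
    obtain ⟨f, hf, u, hu, hdeg⟩ := hN _ w rfl hw
    exact ⟨f, hf, u, hu, hdeg.trans (hM ⟨_, fun B hB =>
      Finset.mem_coe.2 (Finset.mem_powerset.2 hB.1), rfl⟩)⟩
  have hL := hS.isElim_trunc N
  obtain ⟨G, hG⟩ := exists_fund (monos σ N) (trunc S N)
  refine ⟨(fun q : Finset (σ →₀ ℕ) × (σ →₀ ℕ) => G q.1 q.2) ''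
    ((monos σ N).powerset ×ˢ monos σ N : Finset _) ∩ S, Set.inter_subset_right,
    ((Finset.finite_toSet _).image _).inter_of_left _, fun w hw => ?_⟩
  obtain ⟨f, hf, u, hu, hdeg⟩ := hN w hw
  obtain ⟨g, hg, hug, hgs⟩ := hS.exists_trunc hf (hu ▸ rfl : u ∈ initSet w f) hdeg
  obtain ⟨B, hB⟩ := bases_nonempty (A := monos σ N) (L := trunc S N) w
  have hloop : ∀ C ∈ bases (monos σ N) (trunc S N) w, u ∉ C := fun C hC huC => by
    refine hC.2.1 _ ⟨g, hg, rfl⟩ ⟨u, hug⟩ ((hgs.trans hu.subset).trans ?_)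
    exact Set.singleton_subset_iff.2 (Finset.mem_coe.2 huC)
  have huA : u ∈ monos σ N := mem_monos.2 hdeg
  have hBS := isSuppBase_of_mem_bases hL hB
  have hfund := hG B hBS u huA (hloop B hB)
  refine ⟨G B u, ⟨⟨(B, u), Finset.mem_coe.2 (Finset.mem_product.2
    ⟨Finset.mem_powerset.2 hB.1, huA⟩), rfl⟩, hfund.mem.1⟩, u, ?_⟩
  -- a tie would produce a base that contains the loop `u`
  have hlt' : ∀ b ∈ B, ∀ c : ℝ, G B u b = c → dot w u < c + dot w b := fun b hb c hc => by
    refine lt_of_le_of_ne ((mem_bases_iff hL hBS (hG B hBS) w).1 hB u huA (hloop B hB) b hb c hc)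
      fun heq => ?_
    exact hloop _ ((IsBase.exchange_iff hL hB (hloop B hB) hb hfund).2 ⟨c, hc, heq⟩)
      (Finset.mem_insert_self _ _)
  have hcase : ∀ y, y ≠ u → G B u y ≠ ⊤ →
      G B u u + (dot w u : WithTop ℝ) < G B u y + (dot w y : WithTop ℝ) := fun y hyu hy => by
    obtain ⟨c, hc⟩ := WithTop.ne_top_iff_exists.1 hy
    rw [hfund.apply_self, ← hc, zero_add]
    exact_mod_cast hlt' y ((hfund.supp y hy).resolve_left hyu) c hc.symm
  refine Set.eq_singleton_iff_unique_mem.2 ⟨⟨by simp [hfund.apply_self], fun y => ?_⟩,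
    fun y hy => ?_⟩
  · by_cases hyu : y = u
    · rw [hyu]
    · by_cases hy : G B u y = ⊤
      · simp [hy]
      · exact (hcase y hyu hy).le
  · by_contra hyu
    exact absurd (hy.2 u) (not_le.2 (hcase y hyu (ne_top_of_mem_initSet hy)))

/-- The parts of least `v`-weight of the vectors of `S`, together with `∞`, satisfy the
elimination axiom. -/
theorem IsTropSystem.isElim_levelPart (hS : IsTropSystem S) (v : σ → ℝ) (N : ℕ) :
    IsElim (monos σ N) (trunc ({fun _ => ⊤} ∪ levelPart v '' S) N) where
  supp f hf u hu := mem_monos.2 (hf.2 u hu)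
  scale := by
    rintro _ ⟨rfl | ⟨f, hf, rfl⟩, hdeg⟩ r
    · exact ⟨Or.inl (by funext; simp), fun u hu => by simp at hu⟩
    · exact ⟨Or.inr ⟨_, hS.scale f hf r, levelPart_add_const v f r⟩,
        fun u hu => hdeg u fun hc => hu (by simp [hc])⟩
  elim := by
    classical
    rintro _ ⟨rfl | ⟨f, hf, rfl⟩, hfN⟩ _ ⟨rfl | ⟨g, hg, rfl⟩, hgN⟩ u huv hu
    · exact absurd rfl hu
    · exact absurd rfl hu
    · exact absurd huv hu
    have hgu : levelPart v g u ≠ ⊤ := huv ▸ hu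
    have hfu := levelPart_eq_apply hu
    have hfg : f u = g u := by rw [← hfu, huv, levelPart_eq_apply hgu]
    obtain ⟨k, hk, hku, hkle⟩ := hS.elim f hf g hg u hfg (hfu ▸ hu)
    -- the part of `k` at the common level of `f` and `g`, which may be `∞`
    set h : (σ →₀ ℕ) → WithTop ℝ := fun y => if dot v y = dot v u then k y else ⊤ with hh
    have hhle : ∀ y, min (levelPart v f y) (levelPart v g y) ≤ h y ∧
        (levelPart v f y ≠ levelPart v g y → h y = min (levelPart v f y) (levelPart v g y)) := by
      intro y
      rw [levelPart_apply hu, levelPart_apply hgu]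
      simp only [hh]
      split_ifs
      · exact hkle y
      · simp
    refine ⟨h, ⟨?_, fun y hy => ?_⟩, by simp [hh, hku], hhle⟩
    · by_cases hne : ∃ y, h y ≠ ⊤
      · obtain ⟨y, hy⟩ := hne
        have hyu : dot v y = dot v u := by
          by_contra hc; exact hy (if_neg hc)
        have hky : k y ≠ ⊤ := by simpa [hh, hyu] using hy
        have hly : levelPart v k y ≠ ⊤ := levelPart_ne_top.2 ⟨hky, fun z hz => by
          rw [hyu]
          by_cases hfz : f z = ⊤
          · refine (levelPart_ne_top.1 hgu).2 z fun hgz => hz ?_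
            have := (hkle z).1
            rw [hfz, hgz, min_self, top_le_iff] at this
            exact this
          · exact (levelPart_ne_top.1 hu).2 z hfz⟩
        refine Or.inr ⟨k, hk, funext fun z => ?_⟩
        rw [levelPart_apply hly, hyu]
      · push Not at hne
        exact Or.inl (funext hne)
    · by_contra hcon
      have hfy : levelPart v f y = ⊤ := by
        by_contra hc; exact hcon (hfN y hc)
      have hgy : levelPart v g y = ⊤ := by
        by_contra hc; exact hcon (hgN y hc)
      have := (hhle y).1
      rw [hfy, hgy, min_self, top_le_iff] at this
      exact hy this

/-- If `v` is a root of the trivialized system, then finitely many of the parts of least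
`v`-weight have a common root. -/
theorem IsTropSystem.exists_root_levelPart (hS : IsTropSystem S)
    {lt : (σ →₀ ℕ) → (σ →₀ ℕ) → Prop} (hlt : IsMonomialOrder lt) {v : σ → ℝ}
    (hv : IsRoot (flat S) v) {F : Set ((σ →₀ ℕ) → WithTop ℝ)} (hFS : F ⊆ S) (hF : F.Finite) :
    ∃ x : σ → ℝ, ∀ f ∈ F, ∀ u, initSet x (levelPart v f) ≠ {u} := by
  classical
  set F' : Set ((σ →₀ ℕ) → WithTop ℝ) := {f ∈ F | ∃ u, levelPart v f u ≠ ⊤} with hF'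
  have hF'fin : F'.Finite := hF.subset fun f hf => hf.1
  have : Fintype F' := hF'fin.fintype
  have hfin : ∀ f ∈ S, {u | levelPart v f u ≠ ⊤}.Finite := fun f hf =>
    (hS.finite f hf).subset fun u hu => (levelPart_ne_top.1 hu).1
  let A : F' → Finset (σ →₀ ℕ) := fun f => (hfin f.1 (hFS f.2.1)).toFinset
  have hA : ∀ f u, u ∈ A f ↔ levelPart v f.1 u ≠ ⊤ := fun f u => by simp [A]
  let c : F' → (σ →₀ ℕ) → ℝ := fun f u => (f.1 u).untopD 0
  have hc : ∀ f, ∀ u ∈ A f, levelPart v f.1 u = c f u := fun f u hu => by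
    rw [hA] at hu
    obtain ⟨a, ha⟩ := WithTop.ne_top_iff_exists.1 (levelPart_ne_top.1 hu).1
    rw [levelPart_eq_apply hu]
    simp [c, ← ha]
  set d : ℕ := (Finset.univ.biUnion A).sup Finsupp.degree with hd
  have hdeg : ∀ f, ∀ u ∈ A f, u.degree ≤ d := fun f u hu =>
    Finset.le_sup (f := Finsupp.degree) (Finset.mem_biUnion.2 ⟨f, Finset.mem_univ _, hu⟩)
  obtain ⟨z, hz⟩ := (hS.isElim_levelPart v
      (Fintype.card (F' × Bool) * d + d)).exists_no_loop (by
    rintro _ ⟨rfl | ⟨f, hf, rfl⟩, -⟩ u hu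
    · exact absurd rfl hu
    · by_contra hcon
      push Not at hcon
      refine hv _ ⟨f, hf, 0, rfl⟩ u (Set.eq_singleton_iff_unique_mem.2
        ⟨levelPart_ne_top_iff_mem.1 hu, fun y hy => ?_⟩)
      by_contra hyu
      exact levelPart_ne_top_iff_mem.2 hy (hcon y hyu))
  obtain ⟨x, hx⟩ := hlt.exists_common_root A
    (fun f => by obtain ⟨u, hu⟩ := f.2.2; exact ⟨u, (hA f u).2 hu⟩) hdeg c z fun f a ha u hu => by
      obtain ⟨g, hg, hga, hgs⟩ := hS.shift f.1 (hFS f.2.1) a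
      have hlev : ∀ y, levelPart v g (y + a) = levelPart v f.1 y := fun y => by
        unfold levelPart
        rw [hga]
        congr 1
        refine propext ⟨fun h y' hy' => ?_, fun h y' hy' => ?_⟩
        · have := h (y' + a) (by rwa [hga])
          rw [dot_add_right, dot_add_right] at this
          linarith
        · obtain ⟨y'', rfl⟩ := hgs y' hy'
          rw [hga] at hy'
          rw [dot_add_right, dot_add_right]
          linarith [h y'' hy']
      have hsupp : ∀ y, levelPart v g y ≠ ⊤ → ∃ y' ∈ A f, y = y' + a := fun y hy => by
        obtain ⟨y', rfl⟩ := hgs y (levelPart_ne_top.1 hy).1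
        exact ⟨y', (hA f y').2 (hlev y' ▸ hy), rfl⟩
      have hmem : (fun y => levelPart v g y + (z y : WithTop ℝ)) ∈ translate (trunc
          ({fun _ => ⊤} ∪ levelPart v '' S) (Fintype.card (F' × Bool) * d + d)) z := by
        refine ⟨_, ⟨Or.inr ⟨g, hg, rfl⟩, fun y hy => ?_⟩, rfl⟩
        obtain ⟨y', hy', rfl⟩ := hsupp y hy
        rw [map_add, add_comm]
        exact add_le_add ha (hdeg f y' hy')
      have hne := minSet_nonempty_of_finite
        (f := fun y => levelPart v g y + (z y : WithTop ℝ)) (u := u + a)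
        ((hfin g hg).subset fun y hy hcon => hy (by simp [hcon]))
        (by simpa [hlev] using (hA f u).1 hu)
      obtain ⟨y, hy, hyu⟩ : ∃ y ∈ minSet (fun y => levelPart v g y + (z y : WithTop ℝ)),
          y ≠ u + a := by
        obtain ⟨y, hy⟩ := hne
        by_cases h : y = u + a
        · obtain ⟨y', hy', hne'⟩ := hz _ hmem y hy
          exact ⟨y', hy', h ▸ hne'⟩
        · exact ⟨y, hy, h⟩
      obtain ⟨y, hyA, rfl⟩ := hsupp y fun hcon => hy.1 (by simp [hcon])
      refine ⟨y, hyA, fun h => hyu (h ▸ rfl), ?_⟩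
      have := hy.2 (u + a)
      simp only [hlev, hc f u hu, hc f y hyA] at this
      rw [add_comm a y, add_comm a u]
      exact_mod_cast this
  refine ⟨x, fun f hf u hu => ?_⟩
  have huf : u ∈ initSet x (levelPart v f) := hu ▸ rfl
  have hlu := ne_top_of_mem_initSet huf
  let f' : F' := ⟨f, hf, u, hlu⟩
  obtain ⟨y, hy, hyu, hle⟩ := hx f' u ((hA f' u).2 hlu)
  refine hyu ?_
  have hmem : y ∈ initSet x (levelPart v f) := by
    refine ⟨by simpa using (hA f' y).1 hy, fun y' => le_trans ?_ (huf.2 y')⟩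
    have h1 : levelPart v f y = c f' y := hc f' y hy
    have h2 : levelPart v f u = c f' u := hc f' u ((hA f' u).2 hlu)
    simp only [h1, h2]
    exact_mod_cast hle
  rw [hu] at hmem
  exact hmem

/-- Every root of the trivialized system is the direction of a ray in the variety. -/
theorem IsTropSystem.exists_ray (hS : IsTropSystem S) [DecidableEq σ]
    {lt : (σ →₀ ℕ) → (σ →₀ ℕ) → Prop} (hlt : IsMonomialOrder lt) {v : σ → ℝ}
    (hv : IsRoot (flat S) v) : ∃ x : σ → ℝ, ∀ᶠ t : ℝ in atTop, IsRoot S (x + t • v) := by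
  obtain ⟨F, hFS, hF, hbasis⟩ := hS.exists_tropicalBasis hlt
  obtain ⟨x, hx⟩ := hS.exists_root_levelPart hlt hv hFS hF
  refine ⟨x, ?_⟩
  filter_upwards [(eventually_all_finite hF).2 fun f hf =>
    eventually_initSet_eq x v (hS.finite f (hFS hf))] with t ht
  by_contra hcon
  obtain ⟨f, hf, u, hu⟩ := hbasis _ hcon
  exact hx f hf u ((ht f hf).symm.trans hu)

/-- A direction in which a polyhedron is met arbitrarily far out by a ray belongs to the recession
cone. -/
theorem IsPolyhedron.mem_recessionCone {P : Set (σ → ℝ)} (hP : IsPolyhedron P) {x v : σ → ℝ}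
    (h : ∃ᶠ t : ℝ in atTop, x + t • v ∈ P) : v ∈ recessionCone P := by
  obtain ⟨m, a, b, rfl⟩ := hP
  have hav : ∀ j, ∑ i, a j i * v i ≤ 0 := fun j => by
    by_contra hcon
    push Not at hcon
    obtain ⟨t, ht, hmem⟩ := ((eventually_gt_atTop
      ((b j - ∑ i, a j i * x i) / ∑ i, a j i * v i)).and_frequently h).exists
    have := hmem j
    rw [div_lt_iff₀ hcon] at ht
    simp only [Pi.add_apply, Pi.smul_apply, smul_eq_mul, mul_add, Finset.sum_add_distrib,
      mul_left_comm _ t, ← Finset.mul_sum] at this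
    linarith
  intro y hy t ht j
  have := hy j
  simp only [Pi.add_apply, Pi.smul_apply, smul_eq_mul, mul_add, Finset.sum_add_distrib,
    mul_left_comm _ t, ← Finset.mul_sum]
  nlinarith [mul_nonneg ht (neg_nonneg.2 (hav j))]

theorem sUnion_recessionFan_eq [DecidableEq σ] {I : Ideal (MvPolynomial σ TropReal)}
    (hS : IsTropSystem (coeffVecs I)) {lt : (σ →₀ ℕ) → (σ →₀ ℕ) → Prop}
    (hlt : IsMonomialOrder lt) {T : Set (Set (σ → ℝ))} (hT : IsPolyhedralComplex T)
    (hTI : ⋃₀ T = realVariety realIncl I) :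
    ⋃₀ recessionFan T = realVariety boolIncl (trivialization I) := by
  have hreal : ∀ x, x ∈ ⋃₀ T ↔ IsRoot (coeffVecs I) x := fun x => by
    rw [hTI, mem_realVariety_iff realIncl_injective_zero (hasInitSets_coeffVecs I)]
  ext v
  rw [mem_realVariety_iff boolIncl_injective_zero (hasInitSets_flat_coeffVecs I)]
  constructor
  · rintro ⟨_, ⟨P, hP, ⟨x, hx⟩, rfl⟩, hv⟩
    refine hS.isRoot_flat_of_ray (x := x) (Eventually.frequently ?_)
    filter_upwards [eventually_ge_atTop 0] with t ht
    exact (hreal _).1 ⟨P, hP, hv x hx t ht⟩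
  · intro hv
    obtain ⟨x, hx⟩ := hS.exists_ray hlt hv
    obtain ⟨P, hP, hfreq⟩ : ∃ P ∈ T, ∃ᶠ t : ℝ in atTop, x + t • v ∈ P := by
      by_contra hcon
      push Not at hcon
      have hev := (eventually_all_finite hT.finite).2 hcon
      obtain ⟨t, h1, h2⟩ := (hev.and hx).exists
      obtain ⟨P, hP, hmem⟩ := (hreal _).2 h2
      exact h1 P hP hmem
    obtain ⟨t, ht⟩ := hfreq.exists
    exact ⟨_, ⟨P, hP, ⟨_, ht⟩, rfl⟩, (hT.polyhedron P hP).mem_recessionCone hfreq⟩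

end Roots

theorem isMonomialOrder_toLex {σ : Type*} [LinearOrder σ] [WellFoundedGT σ] :
    IsMonomialOrder fun u v : σ →₀ ℕ => toLex u < toLex v where
  irrefl _ := lt_irrefl _
  trans _ _ _ := lt_trans
  total _ _ h := lt_or_gt_of_ne fun hc => h (toLex.injective hc)
  add_right _ _ v h := add_lt_add_left h (toLex v)

end TropIdeal

open TropIdeal in
theorem propositionp (n : ℕ) (I : Ideal (MvPolynomial (Fin (n + 1)) TropReal))
    (hI : IsTropicalIdeal I) (hhom : IsHomogeneousIdeal I) :
    -- the Gröbner complex of `I` is a finite `ℝ`-rational polyhedral complex, the Gröbner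
    -- complex of the trivialization is an `ℝ`-rational fan, and it is the recession fan of the
    -- Gröbner complex of `I`
    (IsPolyhedralComplex (groebnerComplex realIncl I) ∧
      (∀ P ∈ groebnerComplex realIncl I, IsRRationalPolyhedron P) ∧
      IsPolyhedralFan (groebnerComplex boolIncl (trivialization I)) ∧
      (∀ C ∈ groebnerComplex boolIncl (trivialization I), IsRRationalPolyhedron C) ∧
      groebnerComplex boolIncl (trivialization I) = recessionFan (groebnerComplex realIncl I)) ∧
    -- the maximal cones correspond to the initial ideals for monomial term orders
    (∃ e : {C : Set (Fin (n + 1) → ℝ) //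
          Maximal (fun D => D ∈ groebnerComplex boolIncl (trivialization I)) C} ≃
        {J : Ideal (MvPolynomial (Fin (n + 1)) BoolSemi) //
          ∃ lt : (Fin (n + 1) →₀ ℕ) → (Fin (n + 1) →₀ ℕ) → Prop,
            IsTermOrder lt ∧ J = termInitialIdeal lt I},
      ∀ C, (interior C.1).Nonempty ∧
        interior C.1 = {w | initialIdeal boolIncl w (trivialization I) = (e C).1}) ∧
    -- recession fans of arbitrary finite polyhedral complexes supported on the variety
    (∀ S : Set (Set (Fin (n + 1) → ℝ)), IsPolyhedralComplex S →
      ⋃₀ S = realVariety realIncl I →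
      ⋃₀ recessionFan S = realVariety boolIncl (trivialization I)) := by
  have hS := isTropSystem_coeffVecs hI hhom
  have hlt := isMonomialOrder_toLex (σ := Fin (n + 1))
  obtain ⟨D₁, hD₁⟩ := hS.exists_generatedBy
  obtain ⟨D₂, hD₂⟩ := hS.isTropSystem_flat.exists_generatedBy
  have hreal := groebnerComplex_eq realIncl_injective_zero hS (hasInitSets_coeffVecs I)
    (hD₁.mono (le_max_left D₁ D₂)) hlt
  have hbool := groebnerComplex_eq boolIncl_injective_zero hS.isTropSystem_flat
    (hasInitSets_flat_coeffVecs I) (hD₂.mono (le_max_right D₁ D₂)) hlt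
  rw [trunc_flat] at hbool
  have hL := hS.isElim_trunc (max D₁ D₂)
  refine ⟨?_, exists_equiv_maximal_cells hS hD₂ hlt, fun T hT hTI =>
    sUnion_recessionFan_eq hS hlt hT hTI⟩
  rw [hreal, hbool]
  refine ⟨isPolyhedralComplex_range_cell hL, ?_, isPolyhedralFan_range_cell_flat hL, ?_,
    (recessionFan_range_cell hL).symm⟩
  · rintro _ ⟨w, rfl⟩
    exact isRRationalPolyhedron_cell hL w
  · rintro _ ⟨w, rfl⟩
    exact isRRationalPolyhedron_cell hL.flat w
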